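/- **Setting.** Let $\mathcal A$ be a simple arrangement of $n$ pseudolines $l_1,\dots,l_n$: graphs of continuous functions $\mathbb R\to\mathbb R$, any two of which meet in exactly one point and cross there, no three of which meet in a point, numbered from bottom to top at the far left. It is described by the lists $S_i$ of the pseudolines crossed by $l_i$ from left to right. ($\mathcal A$ need not be stretchable.) *The polygon.* Each $l_i$ is replaced by its channel $Ch(l_i)$, a thin convex region bounded by an upper and a lower chain that share the two endpoints of the channel; the break-points of the chains are the crossings of chains of different channels, so two channels have four common vertices. The crossings divide each channel into $n$ corridors. The union of the channels is a polygon with holes; the holes are its boundary cycles that contain no channel endpoint. On each boundary segment of a hole between two crossing points one further vertex is added. The holes are then opened one after the other: a pair of parallel, close cut edges is drawn across a corridor, from a boundary segment of a hole that is still closed to a segment of the current outer boundary on the opposite side of the corridor, until no hole is left; the four endpoints of the two cut edges become vertices. For any such choice of cuts let $\mathcal P$ be the resulting cyclic order of all vertices along the boundary of the resulting simple polygon, and let $\mathcal G_{int}$ be its internal visibility graph: two vertices are adjacent if and only if they belong to the same channel and no cut across this channel separates them. Both depend only on the lists $S_i$ and the cuts. *Blocking vertices.* Let $G$ be a graph with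 a Hamiltonian cycle $P$, and let $(a,b)$ be an ordered invisible pair (two distinct non-adjacent vertices). A vertex $o$ is a blocking vertex of $(a,b)$ if, on one of the two walks from $a$ to $b$ along $P$, $o$ lies strictly between $a$ and $b$ and all vertices from $a$ (included) to $o$ (excluded) are non-adjacent to all vertices from $o$ (excluded) to $b$ (included); the second of Ghosh's necessary conditions for visibility graphs asks for such a vertex for every invisible pair. A blocking vertex assignment of $(G,P)$ is a function that assigns to each ordered invisible pair $(a,b)$ a blocking vertex of $(a,b)$ that is adjacent to $a$. **Theorem.** For every such arrangement and every such choice of cuts, the boundary cycle $\mathcal P$ exists and is a Hamiltonian cycle of $\mathcal G_{int}$, and $(\mathcal G_{int},\mathcal P)$ has exactly one blocking vertex assignment. Moreover, there is one program (of a random access machine with unit costs, addition and subtraction) which, given $\mathcal G_{int}$ and $\mathcal P$ for any such arrangement and cuts, under any numbering of the vertices by $0,\dots,N-1$, outputs this assignment within a number of steps polynomial in the number $N$ of vertices. The program uses nothing about its input beyond Ghosh's second condition: for every graph on $N$ vertices given with a Hamiltonian cycle, it halts within the same polynomial bound, and it outputs, for each ordered invisible pair $(a,b)$ that has a blocking vertex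 adjacent to $a$, such a blocking vertex. -/

import Mathlib

/-! ## Graphs with a Hamiltonian cycle and blocking vertex assignments -/

section Blocking

variable {V : Type*}

/-- `P` is a Hamiltonian cycle of `G`: a cyclic sequence that runs through every vertex exactly once,
consecutive vertices being adjacent. -/
def IsHamiltonianCycle (G : SimpleGraph V) (P : Cycle V) : Prop :=
  P.Nodup ∧ (∀ v, v ∈ P) ∧ P.Chain G.Adj

/-- `o` blocks `(p, q)` on the walk from `p` to `q` in the direction of `P`: on this walk every vertex
from `p` (included) to `o` (excluded) is invisible to every vertex from `o` (excluded) to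
`q` (included). -/
def BlocksAlong (G : SimpleGraph V) (P : Cycle V) (p q o : V) : Prop :=
  ∃ A B C : List V,
    P = ((p :: A ++ o :: (B ++ q :: C) : List V) : Cycle V) ∧
      ∀ x ∈ p :: A, ∀ y ∈ B ++ [q], ¬ G.Adj x y

/-- `o` is a blocking vertex of `(p, q)`, on one of the two walks from `p` to `q` along `P`. -/
def IsBlockingVertex (G : SimpleGraph V) (P : Cycle V) (p q o : V) : Prop :=
  BlocksAlong G P p q o ∨ BlocksAlong G P.reverse p q o

/-- Ordered invisible pairs: two distinct vertices that are not adjacent. -/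
def InvisiblePair (G : SimpleGraph V) : Type _ :=
  {p : V × V // p.1 ≠ p.2 ∧ ¬ G.Adj p.1 p.2}

/-- A blocking vertex assignment gives each ordered invisible pair `(a, b)` a blocking vertex of the
pair that is visible from `a`. -/
def IsBlockingVertexAssignment (G : SimpleGraph V) (P : Cycle V) (β : InvisiblePair G → V) : Prop :=
  ∀ p : InvisiblePair G, G.Adj p.1.1 (β p) ∧ IsBlockingVertex G P p.1.1 p.1.2 (β p)

end Blocking

/-! ## Pseudoline arrangements -/

/-- `S` is the description of a simple arrangement of `n` pseudolines. The pseudolines are the graphs of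
continuous functions `f i : ℝ → ℝ`, numbered from bottom to top at the far left. Any two of them meet in
exactly one point, with abscissa `X i j`, and cross there; no three of them meet in a point. `S i` is
the list of the pseudolines crossed by the pseudoline `i`, from left to right. -/
def IsPseudolineArrangement {n : ℕ} (S : Fin n → List (Fin n)) : Prop :=
  ∃ (f : Fin n → ℝ → ℝ) (X : Fin n → Fin n → ℝ),
    (∀ i, Continuous (f i)) ∧
    (∀ i j, X i j = X j i) ∧
    (∀ i j, i < j → ∀ t,
      (t < X i j → f i t < f j t) ∧ (t = X i j → f i t = f j t) ∧ (X i j < t → f j t < f i t)) ∧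
    (∀ i j k, i ≠ j → i ≠ k → j ≠ k → X i j ≠ X i k) ∧
    (∀ i j, j ∈ S i ↔ j ≠ i) ∧
    (∀ i, (S i).Pairwise fun j k => X i j < X i k)

/-! ## The polygon of an arrangement

The channel of the pseudoline `i` is a thin convex region around `i`, bounded by an upper chain `(i, true)`
and a lower chain `(i, false)` which join the two endpoints of the channel. The break-points of the
chains are the points where chains of different channels cross. The crossings divide the channel into
`n` corridors `(i, k)`, `k = 0, …, n - 1`, from left to right; a side `(i, k, u)` is the part of the
chain `(i, u)` that bounds the corridor `(i, k)`. The polygon with holes is the union of the channels,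
and its boundary consists of the sides. -/

/-- Names for the points that can be vertices of the polygon. -/
inductive Point (n : ℕ) : Type
  /-- the left endpoint of the channel `i` -/
  | leftEnd (i : Fin n) : Point n
  /-- the right endpoint of the channel `i` -/
  | rightEnd (i : Fin n) : Point n
  /-- the common point of the chains `(i, u)` and `(j, v)`, used for `i < j` -/
  | cross (i : Fin n) (u : Bool) (j : Fin n) (v : Bool) : Point n
  /-- the additional point on the side `(i, k, u)` of a hole -/
  | mid (i k : Fin n) (u : Bool) : Point n
  /-- the endpoint on the side `(i, k, u)` of the left (`r = false`) or right (`r = true`) one of the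
  two parallel cut edges across the corridor `(i, k)` -/
  | cut (i k : Fin n) (u r : Bool) : Point n

/-- The common point of the chains `(i, u)` and `(j, v)`, where `i ≠ j`. -/
def crossPoint {n : ℕ} (i : Fin n) (u : Bool) (j : Fin n) (v : Bool) : Point n :=
  if i < j then .cross i u j v else .cross j v i u

/-- The left end of the side `(i, k, u)`: the endpoint of the channel if `k = 0`; otherwise the
point where `(i, u)` leaves the channel `j` crossed just before the corridor. From left to right, `i` passes
`j` from below to above if `i < j`, and then it leaves through the upper chain of `j`. -/
def leftPoint {n : ℕ} (S : Fin n → List (Fin n)) (i k : Fin n) (u : Bool) : Point n :=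
  match k.val with
  | 0 => .leftEnd i
  | m + 1 =>
    match (S i)[m]? with
    | none => .leftEnd i
    | some j => crossPoint i u j (decide (i < j))

/-- The right end of the side `(i, k, u)`: the point where `(i, u)` enters the channel `j` crossed just
after the corridor, or the right endpoint of the channel if there is no such `j`. -/
def rightPoint {n : ℕ} (S : Fin n → List (Fin n)) (i k : Fin n) (u : Bool) : Point n :=
  match (S i)[k.val]? with
  | none => .rightEnd i
  | some j => crossPoint i u j (decide (j < i))

/-- Sides `(i, k, u)`. -/
abbrev Side (n : ℕ) : Type := Fin n × Fin n × Bool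

/-- `x` is one of the two ends of the side `s`. -/
def IsEndOf {n : ℕ} (S : Fin n → List (Fin n)) (x : Point n) (s : Side n) : Prop :=
  x = leftPoint S s.1 s.2.1 s.2.2 ∨ x = rightPoint S s.1 s.2.1 s.2.2

/-- `s` and `t` lie on the same boundary cycle of the polygon with holes: they are joined by a
sequence of sides in which consecutive sides have a common end. -/
def SameBoundary {n : ℕ} (S : Fin n → List (Fin n)) (s t : Side n) : Prop :=
  Relation.ReflTransGen (fun a b => ∃ x, IsEndOf S x a ∧ IsEndOf S x b) s t

/-- The side `s` lies on a hole, that is, on a boundary cycle that contains no endpoint of a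
channel (all these endpoints lie on the outer boundary). -/
def OnHole {n : ℕ} (S : Fin n → List (Fin n)) (s : Side n) : Prop :=
  ∀ t, SameBoundary S s t → ∀ i, ¬ IsEndOf S (.leftEnd i) t ∧ ¬ IsEndOf S (.rightEnd i) t

/-- A choice of cuts: the corridors that are cut, the last one first, and for each side, whether the
cut meets it to the right of the additional point (which matters only on a cut side of a hole). -/
structure Cuts (n : ℕ) where
  corridors : List (Fin n × Fin n)
  rightOfMid : Fin n → Fin n → Bool → Bool

/-- `CutsReach S l O`: one can cut the corridors in `l` one after the other, starting with the
last entry of `l`, so that each cut leads from a side on the current outer boundary to the opposite side,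
which lies on a hole that is still closed; `O` is the set of the sides that are then on the
outer boundary. -/
inductive CutsReach {n : ℕ} (S : Fin n → List (Fin n)) :
    List (Fin n × Fin n) → Set (Side n) → Prop
  | start : CutsReach S [] {s | ¬ OnHole S s}
  | step (l : List (Fin n × Fin n)) (O : Set (Side n)) (i k : Fin n) (u : Bool) :
      CutsReach S l O → (i, k, u) ∈ O → (i, k, !u) ∉ O →
        CutsReach S ((i, k) :: l) (O ∪ {s | SameBoundary S (i, k, !u) s})

/-- The cuts open all holes, each exactly once. -/
def Cuts.OpenAllHoles {n : ℕ} (K : Cuts n) (S : Fin n → List (Fin n)) : Prop :=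
  CutsReach S K.corridors Set.univ

open Classical in
/-- The vertices, from left to right, of the side `(i, k, u)` of a corridor without a cut. -/
noncomputable def wholeSide {n : ℕ} (S : Fin n → List (Fin n)) (i k : Fin n) (u : Bool) :
    List (Point n) :=
  leftPoint S i k u :: ((if OnHole S (i, k, u) then [.mid i k u] else []) ++ [rightPoint S i k u])

open Classical in
/-- The vertices, from left to right, of the part of the side `(i, k, u)` on the left of the cut. -/
noncomputable def leftPart {n : ℕ} (S : Fin n → List (Fin n)) (K : Cuts n) (i k : Fin n) (u : Bool) :
    List (Point n) :=
  leftPoint S i k u ::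
    ((if OnHole S (i, k, u) ∧ K.rightOfMid i k u = true then [.mid i k u] else []) ++ [.cut i k u false])

open Classical in
/-- The vertices, from left to right, of the part of the side `(i, k, u)` on the right of the cut. -/
noncomputable def rightPart {n : ℕ} (S : Fin n → List (Fin n)) (K : Cuts n) (i k : Fin n) (u : Bool) :
    List (Point n) :=
  .cut i k u true ::
    ((if OnHole S (i, k, u) ∧ K.rightOfMid i k u = false then [.mid i k u] else []) ++
      [rightPoint S i k u])

open Classical in
/-- The one or two parts of the side `(i, k, u)` on the boundary of the simple polygon. -/
noncomputable def sideParts {n : ℕ} (S : Fin n → List (Fin n)) (K : Cuts n) (i k : Fin n) (u : Bool) :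
    List (List (Point n)) :=
  if (i, k) ∈ K.corridors then [leftPart S K i k u, rightPart S K i k u] else [wholeSide S i k u]

/-- The vertices of the simple polygon obtained from the arrangement `S` and the cuts `K`. -/
def PolygonVertex {n : ℕ} (S : Fin n → List (Fin n)) (K : Cuts n) : Type :=
  {x : Point n // ∃ i k u, ∃ L ∈ sideParts S K i k u, x ∈ L}

/-- `y` follows `x` on the boundary of the simple polygon, with the polygon on the left. Upper sides
are run through from right to left and lower sides from left to right, and the boundary crosses a
corridor along each cut edge. -/
inductive BoundaryStep {n : ℕ} (S : Fin n → List (Fin n)) (K : Cuts n) : Point n → Point n → Prop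
  | lower (i k : Fin n) (L : List (Point n)) (x y : Point n) :
      L ∈ sideParts S K i k false → [x, y] <:+: L → BoundaryStep S K x y
  | upper (i k : Fin n) (L : List (Point n)) (x y : Point n) :
      L ∈ sideParts S K i k true → [y, x] <:+: L → BoundaryStep S K x y
  | cutLeft (i k : Fin n) : (i, k) ∈ K.corridors →
      BoundaryStep S K (.cut i k false false) (.cut i k true false)
  | cutRight (i k : Fin n) : (i, k) ∈ K.corridors →
      BoundaryStep S K (.cut i k true true) (.cut i k false true)

/-- `P` is the cyclic order of the vertices along the boundary of the simple polygon. -/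
def IsBoundaryCycle {n : ℕ} (S : Fin n → List (Fin n)) (K : Cuts n) (P : Cycle (PolygonVertex S K)) :
    Prop :=
  P.Nodup ∧ (∀ v, v ∈ P) ∧ P.Chain fun x y => BoundaryStep S K x.1 y.1

/-- The point `x` is a vertex of the channel `i`. -/
def OnChannel {n : ℕ} (S : Fin n → List (Fin n)) (K : Cuts n) (i : Fin n) (x : Point n) : Prop :=
  ∃ k u, ∃ L ∈ sideParts S K i k u, x ∈ L

/-- The vertex `x` of the channel `i` lies on the left of the cut across the corridor `(i, k)`. -/
def LeftOfCut {n : ℕ} (S : Fin n → List (Fin n)) (K : Cuts n) (i k : Fin n) (x : Point n) : Prop :=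
  (∃ k' u, k' < k ∧ ∃ L ∈ sideParts S K i k' u, x ∈ L) ∨ ∃ u, x ∈ leftPart S K i k u

/-- The internal visibility graph: two vertices see each other if and only if they belong to the same
channel and no cut across this channel separates them. -/
def internalVisibility {n : ℕ} (S : Fin n → List (Fin n)) (K : Cuts n) :
    SimpleGraph (PolygonVertex S K) where
  Adj x y := x ≠ y ∧ ∃ i, OnChannel S K i x.1 ∧ OnChannel S K i y.1 ∧
    ∀ k, (i, k) ∈ K.corridors → (LeftOfCut S K i k x.1 ↔ LeftOfCut S K i k y.1)
  symm := ⟨fun _ _ ⟨hne, i, hx, hy, h⟩ => ⟨hne.symm, i, hy, hx, fun k hk => (h k hk).symm⟩⟩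
  loopless := ⟨fun _ h => h.1 rfl⟩

/-! ## A random access machine with unit costs

Registers and memory cells hold natural numbers. There is no multiplication, so that `t` steps lengthen
the numbers by at most `t` bits, and polynomial time is the same as for Turing machines. -/

/-- The state of the machine. -/
structure RamState where
  reg : ℕ → ℕ
  mem : ℕ → ℕ

/-- Programs. -/
inductive RamProgram : Type
  /-- `reg r := c` -/
  | const (r c : ℕ) : RamProgram
  /-- `reg r := reg a + reg b` -/
  | add (r a b : ℕ) : RamProgram
  /-- `reg r := reg a - reg b`, truncated at zero -/
  | sub (r a b : ℕ) : RamProgram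
  /-- `reg r := mem (reg a)` -/
  | load (r a : ℕ) : RamProgram
  /-- `mem (reg a) := reg r` -/
  | store (a r : ℕ) : RamProgram
  /-- `p` and then `q` -/
  | seq (p q : RamProgram) : RamProgram
  /-- `p` if `reg r` is not zero, and `q` otherwise -/
  | ifPos (r : ℕ) (p q : RamProgram) : RamProgram
  /-- repeat `p` as long as `reg r` is not zero -/
  | whilePos (r : ℕ) (p : RamProgram) : RamProgram

/-- `RamProgram.Runs Q s t s'`: started in the state `s`, the program `Q` halts after exactly `t` steps,
in the state `s'`. Every elementary instruction and every test costs one step. -/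
inductive RamProgram.Runs : RamProgram → RamState → ℕ → RamState → Prop
  | const (r c : ℕ) (s : RamState) :
      Runs (.const r c) s 1 { s with reg := Function.update s.reg r c }
  | add (r a b : ℕ) (s : RamState) :
      Runs (.add r a b) s 1 { s with reg := Function.update s.reg r (s.reg a + s.reg b) }
  | sub (r a b : ℕ) (s : RamState) :
      Runs (.sub r a b) s 1 { s with reg := Function.update s.reg r (s.reg a - s.reg b) }
  | load (r a : ℕ) (s : RamState) :
      Runs (.load r a) s 1 { s with reg := Function.update s.reg r (s.mem (s.reg a)) }
  | store (a r : ℕ) (s : RamState) :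
      Runs (.store a r) s 1 { s with mem := Function.update s.mem (s.reg a) (s.reg r) }
  | seq (p q : RamProgram) (s s₁ s₂ : RamState) (t₁ t₂ : ℕ) :
      Runs p s t₁ s₁ → Runs q s₁ t₂ s₂ → Runs (.seq p q) s (t₁ + t₂) s₂
  | ifTrue (r : ℕ) (p q : RamProgram) (s s₁ : RamState) (t : ℕ) :
      s.reg r ≠ 0 → Runs p s t s₁ → Runs (.ifPos r p q) s (t + 1) s₁
  | ifFalse (r : ℕ) (p q : RamProgram) (s s₁ : RamState) (t : ℕ) :
      s.reg r = 0 → Runs q s t s₁ → Runs (.ifPos r p q) s (t + 1) s₁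
  | whileStop (r : ℕ) (p : RamProgram) (s : RamState) :
      s.reg r = 0 → Runs (.whilePos r p) s 1 s
  | whileStep (r : ℕ) (p : RamProgram) (s s₁ s₂ : RamState) (t₁ t₂ : ℕ) :
      s.reg r ≠ 0 → Runs p s t₁ s₁ → Runs (.whilePos r p) s₁ t₂ s₂ →
        Runs (.whilePos r p) s (t₁ + t₂ + 1) s₂

open Classical in
/-- The initial state for a graph with vertices `0, …, N - 1` and the list `c` of its vertices in the
order of a Hamiltonian cycle. Register `0` holds `N` and the other registers hold `0`. The memory holds
the list, followed by the adjacency matrix row by row, and zeros from there on. -/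
noncomputable def inputState {N : ℕ} (G : SimpleGraph (Fin N)) (c : List (Fin N)) : RamState where
  reg r := if r = 0 then N else 0
  mem x :=
    if x < N then (c.map Fin.val).getD x 0
    else if ∃ a b : Fin N, a.val = (x - N) / N ∧ b.val = (x - N) % N ∧ G.Adj a b then 1 else 0

/-- The memory cell for the entry `(a, b)` of the output, an `N × N` table that follows the input. -/
def outputCell {N : ℕ} (a b : Fin N) : ℕ := N + N * N + (a.val * N + b.val)

/-! Everything rests on a combinatorial form of the fact that the cuts make the union of the
channels simply connected. Give each corridor a value in `ZMod 2` such that the four corridors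
around every crossing sum to zero. The total flow below a side is then a potential on the sides: it
is constant on each boundary cycle, jumps across a corridor by the flow of that corridor, and is
zero on the outer boundary if the flow vanishes on all first and last corridors. If the flow also
vanishes on the cut corridors, the cuts carry the potential zero from hole to hole, so the flow is
zero (`flow_eq_zero`). Of the arrangement only the order of the crossings is used, and that two
lines, when they cross, are on the same side of every third line.

Now color the boundary edges with two colors. The difference of the colors on the two sides of a
corridor is such a flow as soon as the color changes at an even number of corners of each crossing;
so opposite sides agree (`endColor_lower_iff_upper`). This is used twice. If the colored edges are
one orbit of the successor map, there are no changes at all, a parity count on each hole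
(`color_across_cuts`) extends the agreement across the cuts, and the color is constant: the boundary
is a single cycle. If the colored edges are the arc between the two corners of a door (the mouth of
a corridor at a crossing), the changes are exactly these two corners. Then the color along the
channels changes only at the door (`exists_door_coloring`). Hence vertices inside the two arcs see
each other only along the channel of the door, and the arc behind the door, its pocket, contains no
vertex of the piece of the other channel at this crossing.

For an invisible pair `(a, b)`, let `o` be the last vertex before `b` that `a` sees. It is a corner
of the crossing of the channel `j`, along which `a` sees `o`, and the channel `i` of the boundary
edge after `o`. The four corners of this crossing split the boundary into four pockets; `b` lies in
a pocket of `i` and `a` in a pocket of `j`. No vertex of the pocket of `b` sees a vertex of the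
pocket of `a`, so the corner shared by the two pockets blocks. The other corner of the door of `b`
does not: a corner of the crossing that is passed before it sees a vertex of the pocket that comes
after it. Any further candidate is invisible from `a` or has a vertex visible from `a` behind it
(`blockingVertex_iff_eq`).

The program tries all triples of positions on the cycle and tests the blocking condition directly.
Every value it writes is a correct answer, so overwriting does no harm, and every pair with an
answer is reached. By uniqueness the output is the assignment. -/

/-! ## Arrangements with integral crossing times -/

/-- `a` runs below `l` just before the time `t`. -/
def BelowAt {n : ℕ} (X : Fin n → Fin n → ℕ) (a l : Fin n) (t : ℕ) : Prop :=
  if a < l then t ≤ X a l else X a l < t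

/-- The combinatorial content of a pseudoline arrangement: the crossing of `i` and `j` takes place at
the time `X i j`, and lines that cross each other are then on the same side of every other line. -/
structure CrossingTimes {n : ℕ} (S : Fin n → List (Fin n)) (X : Fin n → Fin n → ℕ) : Prop where
  symm : ∀ i j, X i j = X j i
  ne : ∀ i j k, i ≠ j → i ≠ k → j ≠ k → X i j ≠ X i k
  mem : ∀ i j, j ∈ S i ↔ j ≠ i
  sorted : ∀ i, (S i).Pairwise fun j k => X i j < X i k
  sameSide : ∀ a b l, a ≠ b → a ≠ l → b ≠ l → (BelowAt X a l (X a b) ↔ BelowAt X b l (X a b))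

/-- Only the order of the finitely many abscissae matters, so each is replaced by its rank. The
condition `sameSide` holds because the two lines pass through one point, which does not lie on the
third line. -/
theorem IsPseudolineArrangement.exists_crossingTimes {n : ℕ} {S : Fin n → List (Fin n)}
    (h : IsPseudolineArrangement S) : ∃ X, CrossingTimes S X := by
  obtain ⟨f, X, -, hsymm, hf, hne, hmem, hpw⟩ := h
  set T : Finset ℝ := Finset.univ.image fun p : Fin n × Fin n => X p.1 p.2 with hT
  have hXT : ∀ i j, X i j ∈ T := fun i j => Finset.mem_image.2 ⟨(i, j), Finset.mem_univ _, rfl⟩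
  set rk : ℝ → ℕ := fun x => (T.filter (· < x)).card with hrk
  have hlt : ∀ x ∈ T, ∀ y, x < y → rk x < rk y := by
    intro x hx y hxy
    refine Finset.card_lt_card (Finset.ssubset_iff_of_subset ?_ |>.2 ⟨x, ?_, ?_⟩)
    · intro z hz
      rw [Finset.mem_filter] at hz ⊢
      exact ⟨hz.1, hz.2.trans hxy⟩
    · simp [hx, hxy]
    · simp
  have hiff : ∀ x ∈ T, ∀ y ∈ T, (rk x < rk y ↔ x < y) := by
    intro x hx y hy
    refine ⟨fun h => ?_, hlt x hx y⟩
    by_contra hc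
    rcases eq_or_lt_of_le (not_lt.1 hc) with h' | h'
    · rw [h'] at h; exact lt_irrefl _ h
    · exact lt_asymm h (hlt y hy x h')
  refine ⟨fun i j => rk (X i j), ⟨fun i j => by rw [hsymm], ?_, hmem, ?_, ?_⟩⟩
  · intro i j k h1 h2 h3 he
    rcases lt_or_gt_of_ne (hne i j k h1 h2 h3) with h | h
    · exact absurd he (hlt _ (hXT _ _) _ h).ne
    · exact absurd he (hlt _ (hXT _ _) _ h).ne'
  · exact fun i => (hpw i).imp fun h => hlt _ (hXT _ _) _ h
  · intro a b l hab hal hbl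
    -- At the crossing of `a` and `b` the line `l` is elsewhere, so "just before" and "at" the
    -- crossing give the same order of heights.
    have key : ∀ a b, a ≠ b → a ≠ l → b ≠ l →
        (BelowAt (fun i j => rk (X i j)) a l (rk (X a b)) ↔ f a (X a b) < f l (X a b)) := by
      intro a b hab hal hbl
      have hX : X a b ≠ X a l := hne a b l hab hal hbl
      unfold BelowAt
      split_ifs with h
      · rw [← not_lt, hiff _ (hXT _ _) _ (hXT _ _)]
        obtain ⟨h1, h2, h3⟩ := hf a l h (X a b)
        rcases lt_or_gt_of_ne hX with h' | h'
        · exact iff_of_true (not_lt.2 h'.le) (h1 h')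
        · exact iff_of_false (not_not.2 h') (h3 h').le.not_gt
      · rw [hiff _ (hXT _ _) _ (hXT _ _)]
        have hla : l < a := lt_of_le_of_ne (not_lt.1 h) hal.symm
        obtain ⟨h1, h2, h3⟩ := hf l a hla (X a b)
        rw [hsymm l a] at h1 h2 h3
        rcases lt_or_gt_of_ne hX with h' | h'
        · exact iff_of_false h'.le.not_gt (h1 h').le.not_gt
        · exact iff_of_true h' (h3 h')
    have heq : f a (X a b) = f b (X a b) := by
      rcases lt_or_gt_of_ne hab with h | h
      · exact (hf a b h _).2.1 rfl
      · exact ((hf b a h _).2.1 (hsymm a b)).symm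
    rw [key a b hab hal hbl]
    have := key b a hab.symm hbl hal
    rw [hsymm b a] at this
    rw [this, heq]

/-- The corridor of the line `i` just before the time `t`. -/
def corridorAt {n : ℕ} (S : Fin n → List (Fin n)) (X : Fin n → Fin n → ℕ) (i : Fin n) (t : ℕ) : ℕ :=
  (S i).countP fun l => X i l < t

namespace CrossingTimes

variable {n : ℕ} {S : Fin n → List (Fin n)} {X : Fin n → Fin n → ℕ}

theorem nodup (A : CrossingTimes S X) (i : Fin n) : (S i).Nodup :=
  (A.sorted i).imp fun h he => by subst he; exact lt_irrefl _ h

theorem length (A : CrossingTimes S X) (i : Fin n) : (S i).length = n - 1 := by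
  rw [← List.toFinset_card_of_nodup (A.nodup i)]
  have : (S i).toFinset = Finset.univ.erase i := by
    ext j; simp [A.mem]
  rw [this, Finset.card_erase_of_mem (Finset.mem_univ _), Finset.card_univ, Fintype.card_fin]

/-- The list is sorted by crossing time: the first `m` entries are counted at both times, `j` at the
later one only, and the rest at neither. -/
theorem corridorAt_getElem (A : CrossingTimes S X) {i j : Fin n} {m : ℕ}
    (h : (S i)[m]? = some j) :
    corridorAt S X i (X i j) = m ∧ corridorAt S X i (X i j + 1) = m + 1 := by
  obtain ⟨hm, hj⟩ := List.getElem?_eq_some_iff.1 h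
  have hS : S i = (S i).take m ++ j :: (S i).drop (m + 1) := by
    rw [← hj, List.getElem_cons_drop, List.take_append_drop]
  have hp := A.sorted i
  rw [hS, List.pairwise_append, List.pairwise_cons] at hp
  obtain ⟨-, ⟨h2, -⟩, h3⟩ := hp
  have hlen : ((S i).take m).length = m := by simp; omega
  unfold corridorAt
  have h4 : ∀ t, X i j ≤ t → ((S i).take m).countP (fun l => decide (X i l < t)) = m := by
    intro t ht
    conv_rhs => rw [← hlen]
    rw [List.countP_eq_length]
    intro a ha
    simpa using lt_of_lt_of_le (h3 a ha j (by simp)) ht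
  have h5 : ∀ t, t ≤ X i j + 1 →
      ((S i).drop (m + 1)).countP (fun l => decide (X i l < t)) = 0 := by
    intro t ht
    rw [List.countP_eq_zero]
    intro a ha
    have := h2 a ha
    simp; omega
  constructor
  · conv_lhs => rw [hS]
    rw [List.countP_append, List.countP_cons, h4 _ le_rfl, h5 _ (by omega)]
    simp
  · conv_lhs => rw [hS]
    rw [List.countP_append, List.countP_cons, h4 _ (by omega), h5 _ le_rfl]
    simp

theorem getElem_corridorAt (A : CrossingTimes S X) {i j : Fin n} (h : j ≠ i) :
    (S i)[corridorAt S X i (X i j)]? = some j := by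
  obtain ⟨m, hm⟩ := List.mem_iff_getElem?.1 ((A.mem i j).2 h)
  rwa [(A.corridorAt_getElem hm).1]

theorem corridorAt_succ (A : CrossingTimes S X) {i j : Fin n} (h : j ≠ i) :
    corridorAt S X i (X i j + 1) = corridorAt S X i (X i j) + 1 := by
  have h1 := A.corridorAt_getElem (A.getElem_corridorAt h)
  exact h1.2

theorem corridorAt_lt (A : CrossingTimes S X) {i j : Fin n} (h : j ≠ i) :
    corridorAt S X i (X i j) + 1 < n := by
  obtain ⟨hm, -⟩ := List.getElem?_eq_some_iff.1 (A.getElem_corridorAt h)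
  rw [A.length] at hm
  omega

theorem corridorAt_congr {i : Fin n} {t : ℕ} (A : CrossingTimes S X)
    (h : ∀ l, l ≠ i → X i l ≠ t) : corridorAt S X i (t + 1) = corridorAt S X i t := by
  unfold corridorAt
  refine List.countP_congr fun l hl => ?_
  have := h l ((A.mem i l).1 hl)
  simp; omega

theorem corridorAt_zero (i : Fin n) : corridorAt S X i 0 = 0 := by simp [corridorAt]

theorem corridorAt_of_lt (A : CrossingTimes S X) {i : Fin n} {t : ℕ} (h : ∀ l, X i l < t) :
    corridorAt S X i t = n - 1 := by
  unfold corridorAt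
  rw [← A.length i, List.countP_eq_length]
  simpa using fun l _ => h l

theorem corridorAt_mono (i : Fin n) {s t : ℕ} (h : s ≤ t) :
    corridorAt S X i s ≤ corridorAt S X i t :=
  List.countP_mono_left fun l _ hl => by simp at hl ⊢; omega

theorem belowAt_asymm (A : CrossingTimes S X) {a l : Fin n} (h : a ≠ l) (t : ℕ) :
    BelowAt X a l t ↔ ¬ BelowAt X l a t := by
  unfold BelowAt
  rw [A.symm l a]
  rcases lt_or_gt_of_ne h with h' | h'
  · rw [if_pos h', if_neg h'.not_gt]; omega
  · rw [if_pos h', if_neg h'.not_gt]; omega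

theorem belowAt_succ {a l : Fin n} {t : ℕ} (h : X a l ≠ t) :
    BelowAt X a l (t + 1) ↔ BelowAt X a l t := by
  unfold BelowAt
  split_ifs <;> omega

/-! ### Conserved flows modulo two -/

/-- A flow on the corridors which is conserved at every crossing. -/
def IsFlow (S : Fin n → List (Fin n)) (X : Fin n → Fin n → ℕ) (h : Fin n → ℕ → ZMod 2) : Prop :=
  ∀ i j, i ≠ j → h i (corridorAt S X i (X i j)) + h i (corridorAt S X i (X i j) + 1) +
    (h j (corridorAt S X j (X i j)) + h j (corridorAt S X j (X i j) + 1)) = 0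

open Classical in
/-- A set of lines that is closed under crossing at the time `t` carries the same flow just before and
just after `t`. -/
theorem sum_flow_succ (A : CrossingTimes S X) {h : Fin n → ℕ → ZMod 2} (hh : IsFlow S X h) (t : ℕ)
    (B : Finset (Fin n)) (hB : ∀ a ∈ B, ∀ b, a ≠ b → X a b = t → b ∈ B) :
    ∑ j ∈ B, h j (corridorAt S X j (t + 1)) = ∑ j ∈ B, h j (corridorAt S X j t) := by
  rw [← sub_eq_zero, ← Finset.sum_sub_distrib]
  let g : Fin n → Fin n := fun a => if e : ∃ b, a ≠ b ∧ X a b = t then e.choose else a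
  have hg : ∀ a b, a ≠ b → X a b = t → g a = b := by
    intro a b hab hX
    have e : ∃ b, a ≠ b ∧ X a b = t := ⟨b, hab, hX⟩
    have h1 := e.choose_spec
    simp only [g, dif_pos e]
    by_contra hc
    exact A.ne a b e.choose hab h1.1 (Ne.symm hc) (hX.trans h1.2.symm)
  have hg' : ∀ a, (¬ ∃ b, a ≠ b ∧ X a b = t) → g a = a := by
    intro a e
    simp only [g, dif_neg e]
  have h0 : ∀ a, (¬ ∃ b, a ≠ b ∧ X a b = t) →
      h a (corridorAt S X a (t + 1)) - h a (corridorAt S X a t) = 0 := by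
    intro a e
    rw [A.corridorAt_congr fun l hl hX => e ⟨l, hl.symm, hX⟩, sub_self]
  -- Each line is paired with the line it crosses at the time `t`. Conservation at that crossing
  -- cancels the two terms; a line without a partner contributes zero.
  refine Finset.sum_involution (fun a _ => g a) ?_ ?_ ?_ ?_
  · intro a _
    by_cases e : ∃ b, a ≠ b ∧ X a b = t
    · obtain ⟨b, hab, hX⟩ := e
      rw [hg a b hab hX]
      have := hh a b hab
      have hXb : X b a = t := by rw [A.symm, hX]
      have h1 := A.corridorAt_succ hab.symm
      have h2 := A.corridorAt_succ hab
      rw [hX] at this h1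
      rw [hXb] at h2
      rw [h1, h2]
      rw [← this]
      simp only [CharTwo.sub_eq_add]
      ring
    · rw [hg' a e, h0 a e, add_zero]
  · intro a _ hne hga
    by_cases e : ∃ b, a ≠ b ∧ X a b = t
    · obtain ⟨b, hab, hX⟩ := e
      rw [hg a b hab hX] at hga
      exact hab hga.symm
    · exact hne (h0 a e)
  · intro a ha
    by_cases e : ∃ b, a ≠ b ∧ X a b = t
    · obtain ⟨b, hab, hX⟩ := e
      rw [hg a b hab hX]
      exact hB a ha b hab hX
    · rw [hg' a e]; exact ha
  · intro a _
    by_cases e : ∃ b, a ≠ b ∧ X a b = t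
    · obtain ⟨b, hab, hX⟩ := e
      rw [hg a b hab hX]
      exact hg b a hab.symm (by rw [A.symm, hX])
    · rw [hg' a e, hg' a e]

open Classical in
/-- The lines below `i` just before the time `t`. -/
noncomputable def linesBelow (X : Fin n → Fin n → ℕ) (i : Fin n) (t : ℕ) : Finset (Fin n) :=
  Finset.univ.filter fun j => j ≠ i ∧ BelowAt X j i t

/-- The flow below `i` just before the time `t`. -/
noncomputable def flowBelow (S : Fin n → List (Fin n)) (X : Fin n → Fin n → ℕ)
    (h : Fin n → ℕ → ZMod 2) (i : Fin n) (t : ℕ) : ZMod 2 :=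
  ∑ j ∈ linesBelow X i t, h j (corridorAt S X j t)

/-- If `i` crosses nothing at the time `t`, the set of lines below it stays the same, and by
`sameSide` a line below `i` can only cross another line below `i`. -/
theorem flowBelow_succ (A : CrossingTimes S X) {h : Fin n → ℕ → ZMod 2} (hh : IsFlow S X h)
    {i : Fin n} {t : ℕ} (ht : ∀ l, l ≠ i → X i l ≠ t) :
    flowBelow S X h i (t + 1) = flowBelow S X h i t := by
  have hset : linesBelow X i (t + 1) = linesBelow X i t := by
    ext j
    simp only [linesBelow, Finset.mem_filter, Finset.mem_univ, true_and]
    refine and_congr_right fun hj => belowAt_succ ?_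
    rw [A.symm]; exact ht j hj
  unfold flowBelow
  rw [hset]
  refine A.sum_flow_succ hh t _ fun a ha b hab hX => ?_
  simp only [linesBelow, Finset.mem_filter, Finset.mem_univ, true_and] at ha ⊢
  have hbi : b ≠ i := by
    rintro rfl
    exact ht a hab (by rw [A.symm, hX])
  refine ⟨hbi, ?_⟩
  rw [← hX]
  rw [← A.sameSide a b i hab ha.1 hbi, hX]
  exact ha.2

/-- The corridor number grows at every crossing of `i`, so between two times with equal numbers `i`
crosses no line. This makes the flow below a corridor well defined. -/
theorem flowBelow_eq (A : CrossingTimes S X) {h : Fin n → ℕ → ZMod 2} (hh : IsFlow S X h)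
    {i : Fin n} {s t : ℕ} (hst : corridorAt S X i s = corridorAt S X i t) :
    flowBelow S X h i s = flowBelow S X h i t := by
  wlog hle : s ≤ t generalizing s t
  · exact (this hst.symm (by omega)).symm
  induction t, hle using Nat.le_induction with
  | base => rfl
  | succ m hm ih =>
    have h1 := corridorAt_mono (S := S) (X := X) i hm
    have h2 := corridorAt_mono (S := S) (X := X) i (Nat.le_succ m)
    rw [ih (by simp only [Nat.succ_eq_add_one] at h2; omega)]
    refine (A.flowBelow_succ hh fun l hl hX => ?_).symm
    have := A.corridorAt_succ hl
    rw [hX] at this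
    omega

/-- The sets of lines below two lines around their crossing. -/
theorem flowBelow_crossing (A : CrossingTimes S X) {h : Fin n → ℕ → ZMod 2} (hh : IsFlow S X h)
    {a b : Fin n} (hab : a < b) :
    flowBelow S X h b (X a b) =
        flowBelow S X h a (X a b) + h a (corridorAt S X a (X a b)) ∧
      flowBelow S X h a (X a b + 1) =
        flowBelow S X h b (X a b + 1) + h b (corridorAt S X b (X a b) + 1) ∧
      flowBelow S X h b (X a b + 1) = flowBelow S X h a (X a b) := by
  classical
  have hne := hab.ne
  have hX : ∀ l, l ≠ a → l ≠ b → X l a ≠ X a b ∧ X l b ≠ X a b := by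
    intro l h1 h2
    rw [A.symm l a, A.symm l b]
    refine ⟨A.ne a l b h1.symm hne h2, ?_⟩
    rw [A.symm a b]
    exact A.ne b l a h2.symm hne.symm h1
  have hA : a ∉ linesBelow X a (X a b) := by simp [linesBelow]
  have hB : b ∉ linesBelow X a (X a b) := by
    rw [linesBelow, Finset.mem_filter, BelowAt, if_neg hab.not_gt, A.symm b a]
    exact fun h => lt_irrefl _ h.2.2
  -- The lines other than `a` and `b` that lie below both form one and the same set before and after
  -- the crossing. The upper one of the two lines has the lower one below it in addition: `a` before
  -- the crossing, `b` after it.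
  have e1 : linesBelow X b (X a b) = insert a (linesBelow X a (X a b)) := by
    ext l
    simp only [linesBelow, Finset.mem_filter, Finset.mem_univ, true_and, Finset.mem_insert]
    by_cases hla : l = a
    · subst hla; simp [BelowAt, hab, hne]
    by_cases hlb : l = b
    · subst hlb; simp [BelowAt, hab.not_gt, hne.symm, A.symm l a]
    · simp only [hla, hlb, ne_eq, not_false_eq_true, true_and, false_or]
      have := A.sameSide a b l hne (Ne.symm hla) (Ne.symm hlb)
      rw [A.belowAt_asymm hlb, A.belowAt_asymm hla, this]
  have e2 : linesBelow X b (X a b + 1) = linesBelow X a (X a b) := by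
    ext l
    simp only [linesBelow, Finset.mem_filter, Finset.mem_univ, true_and]
    by_cases hla : l = a
    · subst hla; simp [BelowAt, hab]
    by_cases hlb : l = b
    · subst hlb; simp [BelowAt, hab.not_gt, A.symm l a]
    · simp only [hla, hlb, ne_eq, not_false_eq_true, true_and]
      have := A.sameSide a b l hne (Ne.symm hla) (Ne.symm hlb)
      rw [belowAt_succ (hX l hla hlb).2, A.belowAt_asymm hlb, A.belowAt_asymm hla, this]
  have e3 : linesBelow X a (X a b + 1) = insert b (linesBelow X a (X a b)) := by
    ext l
    simp only [linesBelow, Finset.mem_filter, Finset.mem_univ, true_and, Finset.mem_insert]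
    by_cases hla : l = a
    · subst hla; simp [BelowAt, hne]
    by_cases hlb : l = b
    · subst hlb; simp [BelowAt, hab.not_gt, hne.symm, A.symm l a]
    · simp only [hla, hlb, ne_eq, not_false_eq_true, true_and, false_or]
      rw [belowAt_succ (hX l hla hlb).1]
  -- Other pairs may cross at the same time. The common set below is closed under these crossings,
  -- so its total flow is unchanged.
  have e4 : ∑ j ∈ linesBelow X a (X a b), h j (corridorAt S X j (X a b + 1)) =
      ∑ j ∈ linesBelow X a (X a b), h j (corridorAt S X j (X a b)) := by
    refine A.sum_flow_succ hh _ _ fun c hc d hcd hXcd => ?_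
    have hca : c ≠ a := by rintro rfl; exact hA hc
    have hcb : c ≠ b := by rintro rfl; exact hB hc
    have hda : d ≠ a := by rintro rfl; exact (hX c hca hcb).1 hXcd
    have hdb : d ≠ b := by rintro rfl; exact (hX c hca hcb).2 hXcd
    simp only [linesBelow, Finset.mem_filter, Finset.mem_univ, true_and] at hc ⊢
    refine ⟨hda, ?_⟩
    have := A.sameSide c d a hcd hca hda
    rw [hXcd] at this
    exact this.1 hc.2
  have hc := A.corridorAt_succ hne
  rw [A.symm b a] at hc
  refine ⟨?_, ?_, ?_⟩
  · simp only [flowBelow]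
    rw [e1, Finset.sum_insert hA, add_comm]
  · simp only [flowBelow]
    rw [e2, e3, Finset.sum_insert hB, hc, add_comm]
  · simp only [flowBelow]
    rw [e2, e4]

end CrossingTimes

/-! ## The ends of the sides -/

/-- The left (`r = false`) or right (`r = true`) end of the side `(i, k, u)`. -/
def sidePoint {n : ℕ} (S : Fin n → List (Fin n)) (i : Fin n) (k : ℕ) (u r : Bool) : Point n :=
  if r then
    match (S i)[k]? with
    | none => .rightEnd i
    | some j => crossPoint i u j (decide (j < i))
  else
    match k with
    | 0 => .leftEnd i
    | m + 1 =>
      match (S i)[m]? with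
      | none => .leftEnd i
      | some j => crossPoint i u j (decide (i < j))

theorem leftPoint_eq {n : ℕ} (S : Fin n → List (Fin n)) (i k : Fin n) (u : Bool) :
    leftPoint S i k u = sidePoint S i k u false := by
  obtain ⟨k, hk⟩ := k
  cases k <;> rfl

theorem rightPoint_eq {n : ℕ} (S : Fin n → List (Fin n)) (i k : Fin n) (u : Bool) :
    rightPoint S i k u = sidePoint S i k u true := rfl

theorem isEndOf_iff {n : ℕ} (S : Fin n → List (Fin n)) (x : Point n) (s : Side n) :
    IsEndOf S x s ↔ ∃ r, x = sidePoint S s.1 s.2.1 s.2.2 r := by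
  unfold IsEndOf
  rw [leftPoint_eq, rightPoint_eq]
  simp

namespace CrossingTimes

variable {n : ℕ} {S : Fin n → List (Fin n)} {X : Fin n → Fin n → ℕ}

/-- The line `a` rises through the channel of `b`, so it meets the lower chain of `b` first: that
corner is the right end of the corridor before the crossing, and the corner on the upper chain is
the left end of the next corridor. -/
theorem sidePoint_fst (A : CrossingTimes S X) {a b : Fin n} (hab : a < b) (p q : Bool) :
    sidePoint S a (corridorAt S X a (X a b) + q.toNat) p (!q) = .cross a p b q := by
  have h := A.getElem_corridorAt hab.ne'
  cases q <;> simp [sidePoint, h, crossPoint, hab, hab.not_gt]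

/-- Here the line descends and meets the upper chain of `a` first, hence the negation in the index.
-/
theorem sidePoint_snd (A : CrossingTimes S X) {a b : Fin n} (hab : a < b) (p q : Bool) :
    sidePoint S b (corridorAt S X b (X a b) + (!p).toNat) q p = .cross a p b q := by
  have h := A.getElem_corridorAt hab.ne
  rw [A.symm] at h
  cases p <;> simp [sidePoint, h, crossPoint, hab, hab.not_gt]

theorem corridorAt_fst_lt (A : CrossingTimes S X) {a b : Fin n} (hab : a < b) (q : Bool) :
    corridorAt S X a (X a b) + q.toNat < n := by
  have := A.corridorAt_lt hab.ne'
  cases q <;> simp <;> omega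

theorem corridorAt_snd_lt (A : CrossingTimes S X) {a b : Fin n} (hab : a < b) (p : Bool) :
    corridorAt S X b (X a b) + (!p).toNat < n := by
  have := A.corridorAt_lt hab.ne
  rw [A.symm] at this
  cases p <;> simp <;> omega

/-- Every end of a side is an end of a channel or the crossing point of two chains. -/
theorem sidePoint_cases (A : CrossingTimes S X) {i : Fin n} {k : ℕ} (hk : k < n) (u r : Bool) :
    (r = false ∧ k = 0 ∧ sidePoint S i k u r = .leftEnd i) ∨
    (r = true ∧ k = n - 1 ∧ sidePoint S i k u r = .rightEnd i) ∨
    (∃ b q, i < b ∧ r = !q ∧ k = corridorAt S X i (X i b) + q.toNat ∧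
      sidePoint S i k u r = .cross i u b q) ∨
    (∃ a p, a < i ∧ r = p ∧ k = corridorAt S X i (X a i) + (!p).toNat ∧
      sidePoint S i k u r = .cross a p i u) := by
  have hlen := A.length i
  cases r with
  | true =>
    rcases h : (S i)[k]? with _ | j
    · rw [List.getElem?_eq_none_iff] at h
      exact Or.inr (Or.inl ⟨rfl, by omega, by
        have : (S i)[k]? = none := List.getElem?_eq_none_iff.2 h
        simp [sidePoint, this]⟩)
    · have hj : j ≠ i := (A.mem i j).1 (List.mem_of_getElem? h)
      have hc := (A.corridorAt_getElem h).1
      rcases lt_or_gt_of_ne hj with h' | h'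
      · refine Or.inr (Or.inr (Or.inr ⟨j, true, h', rfl, ?_, ?_⟩))
        · rw [A.symm j i, hc]; rfl
        · simp [sidePoint, h, crossPoint, h', h'.not_gt]
      · refine Or.inr (Or.inr (Or.inl ⟨j, false, h', rfl, ?_, ?_⟩))
        · rw [hc]; rfl
        · simp [sidePoint, h, crossPoint, h', h'.not_gt]
  | false =>
    cases k with
    | zero => exact Or.inl ⟨rfl, rfl, rfl⟩
    | succ m =>
      rcases h : (S i)[m]? with _ | j
      · rw [List.getElem?_eq_none_iff] at h
        omega
      · have hj : j ≠ i := (A.mem i j).1 (List.mem_of_getElem? h)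
        have hc := (A.corridorAt_getElem h).1
        rcases lt_or_gt_of_ne hj with h' | h'
        · refine Or.inr (Or.inr (Or.inr ⟨j, false, h', rfl, ?_, ?_⟩))
          · rw [A.symm j i, hc]; rfl
          · simp [sidePoint, h, crossPoint, h'.not_gt]
        · refine Or.inr (Or.inr (Or.inl ⟨j, true, h', rfl, ?_, ?_⟩))
          · rw [hc]; rfl
          · simp [sidePoint, h, crossPoint, h']

theorem sidePoint_eq_leftEnd (A : CrossingTimes S X) {i a : Fin n} {k : ℕ} (hk : k < n)
    {u r : Bool} (h : sidePoint S i k u r = .leftEnd a) : i = a ∧ k = 0 ∧ r = false := by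
  rcases A.sidePoint_cases (i := i) hk u r with ⟨h1, h2, h3⟩ | ⟨h1, h2, h3⟩ | ⟨b, q, h1, h2, h3, h4⟩ |
    ⟨b, q, h1, h2, h3, h4⟩ <;> simp_all

theorem sidePoint_eq_rightEnd (A : CrossingTimes S X) {i a : Fin n} {k : ℕ} (hk : k < n)
    {u r : Bool} (h : sidePoint S i k u r = .rightEnd a) : i = a ∧ k = n - 1 ∧ r = true := by
  rcases A.sidePoint_cases (i := i) hk u r with ⟨h1, h2, h3⟩ | ⟨h1, h2, h3⟩ | ⟨b, q, h1, h2, h3, h4⟩ |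
    ⟨b, q, h1, h2, h3, h4⟩
  · simp_all
  · exact ⟨by simpa [h3] using h, h2, h1⟩
  · simp_all
  · simp_all

theorem sidePoint_eq_cross (A : CrossingTimes S X) {i a b : Fin n} {k : ℕ} (hk : k < n)
    {u r p q : Bool} (h : sidePoint S i k u r = .cross a p b q) : a < b ∧
      ((i = a ∧ u = p ∧ r = (!q) ∧ k = corridorAt S X a (X a b) + q.toNat) ∨
        (i = b ∧ u = q ∧ r = p ∧ k = corridorAt S X b (X a b) + (!p).toNat)) := by
  rcases A.sidePoint_cases (i := i) hk u r with ⟨h1, h2, h3⟩ | ⟨h1, h2, h3⟩ | ⟨b', q', h1, h2, h3, h4⟩ |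
    ⟨b', q', h1, h2, h3, h4⟩
  · simp_all
  · simp_all
  · rw [h4] at h
    simp only [Point.cross.injEq] at h
    obtain ⟨rfl, rfl, rfl, rfl⟩ := h
    exact ⟨h1, Or.inl ⟨rfl, rfl, h2, h3⟩⟩
  · rw [h4] at h
    simp only [Point.cross.injEq] at h
    obtain ⟨rfl, rfl, rfl, rfl⟩ := h
    exact ⟨h1, Or.inr ⟨rfl, rfl, h2, h3⟩⟩

/-- At every end of a side, one side begins and one side ends. -/
theorem sidePoint_inj (A : CrossingTimes S X) {i j : Fin n} {k l : ℕ} (hk : k < n) (hl : l < n)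
    {u r v s : Bool} (h : sidePoint S i k u r = sidePoint S j l v s) (hd : (u == r) = (v == s)) :
    i = j ∧ k = l ∧ u = v ∧ r = s := by
  rcases A.sidePoint_cases (i := i) hk u r with ⟨h1, h2, h3⟩ | ⟨h1, h2, h3⟩ | ⟨b', q', h1, h2, h3, h4⟩ |
    ⟨b', q', h1, h2, h3, h4⟩
  · obtain ⟨rfl, rfl, rfl⟩ := A.sidePoint_eq_leftEnd hl (h.symm.trans h3)
    subst h1 h2
    exact ⟨rfl, rfl, by revert hd; cases u <;> cases v <;> simp, rfl⟩
  · obtain ⟨rfl, h5, rfl⟩ := A.sidePoint_eq_rightEnd hl (h.symm.trans h3)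
    subst h1
    exact ⟨rfl, by omega, by revert hd; cases u <;> cases v <;> simp, rfl⟩
  · obtain ⟨-, ⟨rfl, rfl, rfl, h5⟩ | ⟨rfl, rfl, rfl, h5⟩⟩ := A.sidePoint_eq_cross hl (h.symm.trans h4)
    · exact ⟨rfl, by omega, rfl, h2⟩
    · subst h2; revert hd; cases s <;> cases v <;> simp
  · obtain ⟨-, ⟨rfl, rfl, rfl, h5⟩ | ⟨rfl, rfl, rfl, h5⟩⟩ := A.sidePoint_eq_cross hl (h.symm.trans h4)
    · subst h2; revert hd; cases u <;> cases r <;> simp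
    · exact ⟨rfl, by omega, rfl, h2⟩

/-- The boundary runs along a chain `u` from its end `u` to its end `!u`, so `u == r` says that the
side begins at its end `r`. Where one side begins another one ends: the other chain of the crossing,
or the other chain of the same channel at its endpoint. -/
theorem exists_sidePoint_eq (A : CrossingTimes S X) {i : Fin n} {k : ℕ} (hk : k < n) (u r : Bool) :
    ∃ j l v s, l < n ∧ sidePoint S j l v s = sidePoint S i k u r ∧ (v == s) = !(u == r) := by
  rcases A.sidePoint_cases (i := i) hk u r with ⟨h1, h2, h3⟩ | ⟨h1, h2, h3⟩ | ⟨b, q, h1, h2, h3, h4⟩ |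
    ⟨a, p, h1, h2, h3, h4⟩
  · refine ⟨i, k, !u, r, hk, ?_, by cases u <;> cases r <;> rfl⟩
    subst h1 h2; rfl
  · refine ⟨i, k, !u, r, hk, ?_, by cases u <;> cases r <;> rfl⟩
    subst h1
    have : (S i)[k]? = none := List.getElem?_eq_none_iff.2 (by rw [A.length]; omega)
    simp [sidePoint, this]
  · refine ⟨b, _, q, u, A.corridorAt_snd_lt h1 u, (A.sidePoint_snd h1 u q).trans h4.symm, ?_⟩
    subst h2; cases u <;> cases q <;> rfl
  · refine ⟨a, _, p, !u, A.corridorAt_fst_lt h1 u, (A.sidePoint_fst h1 p u).trans h4.symm, ?_⟩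
    subst h2; cases u <;> cases r <;> rfl

/-! ### Flows that vanish on the cuts -/

/-- A time at which the line `i` is in its corridor `k`. -/
theorem exists_time (A : CrossingTimes S X) (i : Fin n) {k : ℕ} (hk : k < n) :
    ∃ t, corridorAt S X i t = k := by
  cases k with
  | zero => exact ⟨0, corridorAt_zero i⟩
  | succ m =>
    have hm : m < (S i).length := by rw [A.length]; omega
    exact ⟨_, (A.corridorAt_getElem (List.getElem?_eq_getElem hm)).2⟩

/-- The flow below the side `(i, k, u)`. -/
noncomputable def sidePotential (A : CrossingTimes S X) (h : Fin n → ℕ → ZMod 2) (s : Side n) :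
    ZMod 2 :=
  flowBelow S X h s.1 (A.exists_time s.1 s.2.1.2).choose + if s.2.2 then h s.1 s.2.1 else 0

theorem sidePotential_eq (A : CrossingTimes S X) {h : Fin n → ℕ → ZMod 2} (hh : IsFlow S X h)
    {i k : Fin n} (u : Bool) {t : ℕ} (ht : corridorAt S X i t = k) :
    A.sidePotential h (i, k, u) = flowBelow S X h i t + if u then h i k else 0 := by
  have := (A.exists_time i k.2).choose_spec
  unfold sidePotential
  rw [A.flowBelow_eq hh (this.trans ht.symm)]

/-- Two sides that meet at a corner have the same flow below them. The corner under both lines and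
those to the left and to the right follow from the comparison of the sets of lines below; the corner
above both also needs conservation at this very crossing. -/
theorem sidePotential_cross (A : CrossingTimes S X) {h : Fin n → ℕ → ZMod 2} (hh : IsFlow S X h)
    {a b k l : Fin n} (hab : a < b) (p q : Bool)
    (hk : (k : ℕ) = corridorAt S X a (X a b) + q.toNat)
    (hl : (l : ℕ) = corridorAt S X b (X a b) + (!p).toNat) :
    A.sidePotential h (a, k, p) = A.sidePotential h (b, l, q) := by
  have ha := A.corridorAt_succ hab.ne'
  have hb := A.corridorAt_succ hab.ne
  rw [A.symm b a] at hb
  rw [A.sidePotential_eq hh p (t := X a b + q.toNat) (by cases q <;> simp [hk, ha]),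
    A.sidePotential_eq hh q (t := X a b + (!p).toNat) (by cases p <;> simp [hl, hb]), hk, hl]
  obtain ⟨h1, h2, h3⟩ := A.flowBelow_crossing hh hab
  have h4 := hh a b hab.ne
  cases p <;> cases q <;> simp only [Bool.toNat_true, Bool.toNat_false, add_zero, Bool.not_true,
    Bool.not_false, if_true, if_false, Bool.false_eq_true]
  · exact h3.symm
  · exact h2
  · exact h1.symm
  · rw [h2, h1, h3]
    have h5 := CharTwo.add_self_eq_zero (h a (corridorAt S X a (X a b)))
    have h6 := CharTwo.add_self_eq_zero (h b (corridorAt S X b (X a b)))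
    linear_combination h4 - h5 - h6

/-- Before all crossings every line is in its first corridor, and after all of them in its last one,
where the flow is zero; hence so is every sum of it over lines below. -/
theorem sidePotential_eq_zero_of_end (A : CrossingTimes S X) {h : Fin n → ℕ → ZMod 2}
    (hh : IsFlow S X h) (h0 : ∀ i, h i 0 = 0) (h1 : ∀ i, h i (n - 1) = 0) {s : Side n} {i : Fin n}
    (hs : IsEndOf S (.leftEnd i) s ∨ IsEndOf S (.rightEnd i) s) : A.sidePotential h s = 0 := by
  obtain ⟨j, k, u⟩ := s
  rw [isEndOf_iff, isEndOf_iff] at hs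
  rcases hs with ⟨r, hr⟩ | ⟨r, hr⟩
  · obtain ⟨rfl, h2, rfl⟩ := A.sidePoint_eq_leftEnd k.2 hr.symm
    rw [A.sidePotential_eq hh u (t := 0) (by rw [corridorAt_zero, h2]), h2, h0]
    simp [flowBelow, corridorAt_zero, h0]
  · obtain ⟨rfl, h2, rfl⟩ := A.sidePoint_eq_rightEnd k.2 hr.symm
    obtain ⟨M, hM⟩ : ∃ M, ∀ a b, X a b < M := by
      refine ⟨(Finset.univ.sup fun p : Fin n × Fin n => X p.1 p.2) + 1, fun a b => ?_⟩
      exact Nat.lt_succ_of_le (Finset.le_sup (f := fun p : Fin n × Fin n => X p.1 p.2)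
        (Finset.mem_univ (a, b)))
    have hc : ∀ a, corridorAt S X a M = n - 1 := fun a => A.corridorAt_of_lt (hM a)
    rw [A.sidePotential_eq hh u (t := M) (by rw [hc, h2]), h2, h1]
    simp [flowBelow, hc, h1]

theorem sidePotential_eq_of_common_end (A : CrossingTimes S X) {h : Fin n → ℕ → ZMod 2}
    (hh : IsFlow S X h) (h0 : ∀ i, h i 0 = 0) (h1 : ∀ i, h i (n - 1) = 0) {s t : Side n} {x : Point n}
    (hs : IsEndOf S x s) (ht : IsEndOf S x t) : A.sidePotential h s = A.sidePotential h t := by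
  obtain ⟨i, k, u⟩ := s
  obtain ⟨j, l, v⟩ := t
  have hs' := hs
  have ht' := ht
  rw [isEndOf_iff] at hs' ht'
  obtain ⟨r, hr⟩ := hs'
  obtain ⟨r', hr'⟩ := ht'
  dsimp only at hr hr'
  rcases A.sidePoint_cases (i := i) k.2 u r with ⟨-, -, h3⟩ | ⟨-, -, h3⟩ | ⟨b, q, h2, h3, h4, h5⟩ |
    ⟨a, p, h2, h3, h4, h5⟩
  · rw [hr, h3] at hs ht
    rw [A.sidePotential_eq_zero_of_end hh h0 h1 (Or.inl hs),
      A.sidePotential_eq_zero_of_end hh h0 h1 (Or.inl ht)]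
  · rw [hr, h3] at hs ht
    rw [A.sidePotential_eq_zero_of_end hh h0 h1 (Or.inr hs),
      A.sidePotential_eq_zero_of_end hh h0 h1 (Or.inr ht)]
  · obtain ⟨-, ⟨rfl, rfl, h6, h7⟩ | ⟨rfl, rfl, rfl, h7⟩⟩ :=
      A.sidePoint_eq_cross l.2 (hr'.symm.trans (hr.trans h5))
    · have : k = l := Fin.ext (h4.trans h7.symm)
      rw [this]
    · exact A.sidePotential_cross hh h2 _ _ h4 h7
  · obtain ⟨-, ⟨rfl, rfl, h6, h7⟩ | ⟨rfl, rfl, rfl, h7⟩⟩ :=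
      A.sidePoint_eq_cross l.2 (hr'.symm.trans (hr.trans h5))
    · exact (A.sidePotential_cross hh h2 _ _ h7 h4).symm
    · have : k = l := Fin.ext (h4.trans h7.symm)
      rw [this]

theorem sidePotential_eq_of_sameBoundary (A : CrossingTimes S X) {h : Fin n → ℕ → ZMod 2}
    (hh : IsFlow S X h) (h0 : ∀ i, h i 0 = 0) (h1 : ∀ i, h i (n - 1) = 0) {s t : Side n}
    (hst : SameBoundary S s t) : A.sidePotential h s = A.sidePotential h t := by
  induction hst with
  | refl => rfl
  | tail _ hx ih =>
    obtain ⟨x, hx1, hx2⟩ := hx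
    exact ih.trans (A.sidePotential_eq_of_common_end hh h0 h1 hx1 hx2)

/-- In characteristic two the jump is the same upwards and downwards. -/
theorem sidePotential_not (A : CrossingTimes S X) {h : Fin n → ℕ → ZMod 2} (i k : Fin n) (u : Bool) :
    A.sidePotential h (i, k, !u) = A.sidePotential h (i, k, u) + h i k := by
  have := CharTwo.add_self_eq_zero (h i k)
  cases u <;> simp [sidePotential, add_assoc, this]

/-- The potential vanishes on the outer boundary, and a cut corridor without flow transmits zero to
the hole that the cut opens. -/
theorem sidePotential_eq_zero (A : CrossingTimes S X) {h : Fin n → ℕ → ZMod 2}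
    (hh : IsFlow S X h) (h0 : ∀ i, h i 0 = 0) (h1 : ∀ i, h i (n - 1) = 0)
    {l : List (Fin n × Fin n)} {O : Set (Side n)} (hO : CutsReach S l O)
    (hl : ∀ i k : Fin n, (i, k) ∈ l → h i k = 0) : ∀ s ∈ O, A.sidePotential h s = 0 := by
  induction hO with
  | start =>
    intro s hs
    simp only [Set.mem_ofPred_eq, OnHole, not_forall] at hs
    obtain ⟨t, hst, i, hi⟩ := hs
    rw [A.sidePotential_eq_of_sameBoundary hh h0 h1 hst]
    exact A.sidePotential_eq_zero_of_end hh h0 h1 (i := i) (by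
      by_contra hc
      exact hi (not_or.1 hc))
  | step l O i k u _ hu _ ih =>
    have ih := ih fun i k h => hl i k (List.mem_cons_of_mem _ h)
    rintro s (hs | hs)
    · exact ih s hs
    · rw [← A.sidePotential_eq_of_sameBoundary hh h0 h1 hs, A.sidePotential_not, ih _ hu,
        hl i k List.mem_cons_self, add_zero]

/-- A flow that vanishes on the first and the last corridors and on the cut corridors is zero. -/
theorem flow_eq_zero (A : CrossingTimes S X) {h : Fin n → ℕ → ZMod 2} (hh : IsFlow S X h)
    (h0 : ∀ i, h i 0 = 0) (h1 : ∀ i, h i (n - 1) = 0) {K : Cuts n} (hK : K.OpenAllHoles S)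
    (hl : ∀ i k : Fin n, (i, k) ∈ K.corridors → h i k = 0) (i k : Fin n) : h i k = 0 := by
  have key := A.sidePotential_eq_zero hh h0 h1 hK hl
  have := A.sidePotential_not (h := h) i k true
  rw [key _ (Set.mem_univ _), key _ (Set.mem_univ _), zero_add] at this
  exact this.symm

end CrossingTimes

/-! ## Boundary steps -/

section Steps

variable {n : ℕ} (S : Fin n → List (Fin n)) (K : Cuts n)

open Classical in
/-- The part of the side `(i, k, u)` on the left (`r = false`) or on the right (`r = true`) of the cut;
the whole side if there is no cut. -/
noncomputable def sidePart (i k : Fin n) (u r : Bool) : List (Point n) :=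
  if (i, k) ∈ K.corridors then (if r then rightPart S K i k u else leftPart S K i k u)
  else wholeSide S i k u

theorem mem_sideParts_iff {i k : Fin n} {u : Bool} {L : List (Point n)} :
    L ∈ sideParts S K i k u ↔ ∃ r, L = sidePart S K i k u r := by
  unfold sideParts sidePart
  split_ifs <;> simp

/-- The additional point of the side `(i, k, u)` exists and belongs to its part `r`. -/
def HasMid (i k : Fin n) (u r : Bool) : Prop :=
  OnHole S (i, k, u) ∧ ((i, k) ∈ K.corridors → K.rightOfMid i k u = !r)

open Classical in
/-- The left (`e = false`) or right (`e = true`) end of the part `r` of the side `(i, k, u)`. -/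
noncomputable def partEnd (i k : Fin n) (u r e : Bool) : Point n :=
  if (i, k) ∈ K.corridors ∧ r ≠ e then .cut i k u r else sidePoint S i k u e

variable {S K}

open Classical in
theorem sidePart_eq (i k : Fin n) (u r : Bool) :
    sidePart S K i k u r = partEnd S K i k u r false ::
      ((if HasMid S K i k u r then [.mid i k u] else []) ++ [partEnd S K i k u r true]) := by
  unfold sidePart partEnd HasMid
  by_cases h : (i, k) ∈ K.corridors
  · cases r <;> simp [h, leftPart, rightPart, leftPoint_eq, rightPoint_eq]
  · simp [h, wholeSide, leftPoint_eq, rightPoint_eq]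

theorem mem_sidePart_iff {i k : Fin n} {u r : Bool} {x : Point n} :
    x ∈ sidePart S K i k u r ↔ (HasMid S K i k u r ∧ x = .mid i k u) ∨ ∃ e, x = partEnd S K i k u r e := by
  classical
  rw [sidePart_eq]
  by_cases h : HasMid S K i k u r <;> simp [h] <;> tauto

theorem pair_infix_pair {α : Type*} {x y a b : α} : [x, y] <:+: [a, b] ↔ x = a ∧ y = b := by
  constructor
  · rintro ⟨s, t, h⟩
    rcases s with _ | ⟨s, _ | ⟨s', s''⟩⟩ <;> simp_all
  · rintro ⟨rfl, rfl⟩; exact List.infix_rfl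

theorem pair_infix_triple {α : Type*} {x y a b c : α} :
    [x, y] <:+: [a, b, c] ↔ (x = a ∧ y = b) ∨ (x = b ∧ y = c) := by
  constructor
  · rintro ⟨s, t, h⟩
    rcases s with _ | ⟨s, _ | ⟨s', _ | ⟨s'', s3⟩⟩⟩ <;> simp_all
  · rintro (⟨rfl, rfl⟩ | ⟨rfl, rfl⟩)
    · exact ⟨[], [c], rfl⟩
    · exact ⟨[a], [], rfl⟩

/-- The boundary runs along each part of a side from its end `u` to its end `!u`, and across a corridor
along the cut edges. -/
theorem boundaryStep_iff {x y : Point n} : BoundaryStep S K x y ↔ ∃ i k,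
    (∃ u r, HasMid S K i k u r ∧
      ((x = partEnd S K i k u r u ∧ y = .mid i k u) ∨
        (x = .mid i k u ∧ y = partEnd S K i k u r (!u)))) ∨
    (∃ u r, ¬ HasMid S K i k u r ∧ x = partEnd S K i k u r u ∧ y = partEnd S K i k u r (!u)) ∨
    (∃ r, (i, k) ∈ K.corridors ∧ x = .cut i k r r ∧ y = .cut i k (!r) r) := by
  constructor
  · intro h
    cases h with
    | lower i k L x y hL hxy =>
      obtain ⟨r, rfl⟩ := (mem_sideParts_iff S K).1 hL
      rw [sidePart_eq] at hxy
      by_cases h : HasMid S K i k false r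
      · simp only [if_pos h, List.cons_append, List.nil_append, pair_infix_triple] at hxy
        exact ⟨i, k, Or.inl ⟨false, r, h, hxy⟩⟩
      · simp only [if_neg h, List.nil_append, pair_infix_pair] at hxy
        exact ⟨i, k, Or.inr (Or.inl ⟨false, r, h, hxy⟩)⟩
    | upper i k L x y hL hxy =>
      obtain ⟨r, rfl⟩ := (mem_sideParts_iff S K).1 hL
      rw [sidePart_eq] at hxy
      by_cases h : HasMid S K i k true r
      · simp only [if_pos h, List.cons_append, List.nil_append, pair_infix_triple] at hxy
        exact ⟨i, k, Or.inl ⟨true, r, h, by rw [Bool.not_true]; tauto⟩⟩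
      · simp only [if_neg h, List.nil_append, pair_infix_pair] at hxy
        exact ⟨i, k, Or.inr (Or.inl ⟨true, r, h, hxy.2, hxy.1⟩)⟩
    | cutLeft i k h => exact ⟨i, k, Or.inr (Or.inr ⟨false, h, rfl, rfl⟩)⟩
    | cutRight i k h => exact ⟨i, k, Or.inr (Or.inr ⟨true, h, rfl, rfl⟩)⟩
  · rintro ⟨i, k, ⟨u, r, h, hxy⟩ | ⟨u, r, h, hx, hy⟩ | ⟨r, h, rfl, rfl⟩⟩
    · cases u
      · refine .lower i k _ x y ((mem_sideParts_iff S K).2 ⟨r, rfl⟩) ?_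
        rw [sidePart_eq]
        simp only [if_pos h, List.cons_append, List.nil_append, pair_infix_triple]
        exact hxy
      · refine .upper i k _ x y ((mem_sideParts_iff S K).2 ⟨r, rfl⟩) ?_
        rw [sidePart_eq]
        simp only [if_pos h, List.cons_append, List.nil_append, pair_infix_triple]
        rw [Bool.not_true] at hxy; tauto
    · cases u
      · refine .lower i k _ x y ((mem_sideParts_iff S K).2 ⟨r, rfl⟩) ?_
        rw [sidePart_eq]
        simp only [if_neg h, List.nil_append, pair_infix_pair]
        exact ⟨hx, hy⟩
      · refine .upper i k _ x y ((mem_sideParts_iff S K).2 ⟨r, rfl⟩) ?_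
        rw [sidePart_eq]
        simp only [if_neg h, List.nil_append, pair_infix_pair]
        exact ⟨hy, hx⟩
    · cases r
      · exact .cutLeft i k h
      · exact .cutRight i k h

/-- `x` is a vertex of the simple polygon. -/
def IsVertex (S : Fin n → List (Fin n)) (K : Cuts n) (x : Point n) : Prop :=
  ∃ i k u, ∃ L ∈ sideParts S K i k u, x ∈ L

theorem isVertex_iff {x : Point n} :
    IsVertex S K x ↔ ∃ i k u r, x ∈ sidePart S K i k u r := by
  simp only [IsVertex, mem_sideParts_iff]
  constructor
  · rintro ⟨i, k, u, L, ⟨r, rfl⟩, hx⟩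
    exact ⟨i, k, u, r, hx⟩
  · rintro ⟨i, k, u, r, hx⟩
    exact ⟨i, k, u, _, ⟨r, rfl⟩, hx⟩

theorem isVertex_partEnd (i k : Fin n) (u r e : Bool) : IsVertex S K (partEnd S K i k u r e) :=
  isVertex_iff.2 ⟨i, k, u, r, mem_sidePart_iff.2 (Or.inr ⟨e, rfl⟩)⟩

theorem isVertex_mid {i k : Fin n} {u r : Bool} (h : HasMid S K i k u r) : IsVertex S K (.mid i k u) :=
  isVertex_iff.2 ⟨i, k, u, r, mem_sidePart_iff.2 (Or.inl ⟨h, rfl⟩)⟩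

theorem isVertex_cut {i k : Fin n} (u r : Bool) (h : (i, k) ∈ K.corridors) :
    IsVertex S K (.cut i k u r) := by
  have := isVertex_partEnd (S := S) (K := K) i k u r (!r)
  rwa [partEnd, if_pos ⟨h, by simp⟩] at this

theorem BoundaryStep.isVertex {x y : Point n} (h : BoundaryStep S K x y) :
    IsVertex S K x ∧ IsVertex S K y := by
  obtain ⟨i, k, ⟨u, r, h', ⟨rfl, rfl⟩ | ⟨rfl, rfl⟩⟩ | ⟨u, r, h', rfl, rfl⟩ | ⟨r, h', rfl, rfl⟩⟩ :=
    boundaryStep_iff.1 h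
  · exact ⟨isVertex_partEnd _ _ _ _ _, isVertex_mid h'⟩
  · exact ⟨isVertex_mid h', isVertex_partEnd _ _ _ _ _⟩
  · exact ⟨isVertex_partEnd _ _ _ _ _, isVertex_partEnd _ _ _ _ _⟩
  · exact ⟨isVertex_cut _ _ h', isVertex_cut _ _ h'⟩

theorem partEnd_self (i k : Fin n) (u r : Bool) : partEnd S K i k u r r = sidePoint S i k u r := by
  simp [partEnd]

theorem boundaryStep_cut {i k : Fin n} (h : (i, k) ∈ K.corridors) (r : Bool) :
    BoundaryStep S K (.cut i k r r) (.cut i k (!r) r) :=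
  boundaryStep_iff.2 ⟨i, k, Or.inr (Or.inr ⟨r, h, rfl, rfl⟩)⟩

theorem exists_step_of_start (i k : Fin n) (u r : Bool) :
    ∃ y ∈ sidePart S K i k u r, BoundaryStep S K (partEnd S K i k u r u) y := by
  by_cases h : HasMid S K i k u r
  · exact ⟨_, mem_sidePart_iff.2 (Or.inl ⟨h, rfl⟩),
      boundaryStep_iff.2 ⟨i, k, Or.inl ⟨u, r, h, Or.inl ⟨rfl, rfl⟩⟩⟩⟩
  · exact ⟨_, mem_sidePart_iff.2 (Or.inr ⟨_, rfl⟩),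
      boundaryStep_iff.2 ⟨i, k, Or.inr (Or.inl ⟨u, r, h, rfl, rfl⟩)⟩⟩

theorem exists_step_of_end (i k : Fin n) (u r : Bool) :
    ∃ y ∈ sidePart S K i k u r, BoundaryStep S K y (partEnd S K i k u r (!u)) := by
  by_cases h : HasMid S K i k u r
  · exact ⟨_, mem_sidePart_iff.2 (Or.inl ⟨h, rfl⟩),
      boundaryStep_iff.2 ⟨i, k, Or.inl ⟨u, r, h, Or.inr ⟨rfl, rfl⟩⟩⟩⟩
  · exact ⟨_, mem_sidePart_iff.2 (Or.inr ⟨_, rfl⟩),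
      boundaryStep_iff.2 ⟨i, k, Or.inr (Or.inl ⟨u, r, h, rfl, rfl⟩)⟩⟩

/-- An end of a part is either produced by the cut, and then lies on the side of the corridor
opposite to `r`, or is a genuine end of the side. -/
theorem partEnd_eq (i k : Fin n) (u r e : Bool) :
    ((i, k) ∈ K.corridors ∧ r = !e ∧ partEnd S K i k u r e = .cut i k u (!e)) ∨
      (((i, k) ∈ K.corridors → r = e) ∧ partEnd S K i k u r e = sidePoint S i k u e) := by
  unfold partEnd
  split_ifs with h
  · exact Or.inl ⟨h.1, by have := h.2; cases r <;> cases e <;> simp_all, by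
      have := h.2; cases r <;> cases e <;> simp_all⟩
  · exact Or.inr ⟨fun h' => by by_contra hc; exact h ⟨h', hc⟩, rfl⟩

end Steps

/-! ### Each vertex has exactly one successor and a predecessor on the boundary -/

namespace CrossingTimes

variable {n : ℕ} {S : Fin n → List (Fin n)} {X : Fin n → Fin n → ℕ} {K : Cuts n}

theorem sidePoint_ne_mid (A : CrossingTimes S X) {i a b : Fin n} {k : ℕ} (hk : k < n) (u r v : Bool) :
    sidePoint S i k u r ≠ .mid a b v := by
  rcases A.sidePoint_cases (i := i) hk u r with ⟨_, _, h⟩ | ⟨_, _, h⟩ | ⟨_, _, _, _, _, h⟩ |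
    ⟨_, _, _, _, _, h⟩ <;> rw [h] <;> simp

theorem sidePoint_ne_cut (A : CrossingTimes S X) {i a b : Fin n} {k : ℕ} (hk : k < n) (u r v s : Bool) :
    sidePoint S i k u r ≠ .cut a b v s := by
  rcases A.sidePoint_cases (i := i) hk u r with ⟨_, _, h⟩ | ⟨_, _, h⟩ | ⟨_, _, _, _, _, h⟩ |
    ⟨_, _, _, _, _, h⟩ <;> rw [h] <;> simp

theorem partEnd_ne_mid (A : CrossingTimes S X) {i k a b : Fin n} (u r e v : Bool) :
    partEnd S K i k u r e ≠ .mid a b v := by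
  rcases partEnd_eq (S := S) (K := K) i k u r e with ⟨_, _, h⟩ | ⟨_, h⟩ <;> rw [h]
  · simp
  · exact A.sidePoint_ne_mid k.2 _ _ _

/-- If two parts of sides begin at the same point, they are the same. -/
theorem partEnd_start_inj (A : CrossingTimes S X) {i j k l : Fin n} {u r v s : Bool}
    (h : partEnd S K i k u r u = partEnd S K j l v s v) :
    i = j ∧ k = l ∧ u = v ∧ ((i, k) ∈ K.corridors → r = s) := by
  rcases partEnd_eq (S := S) (K := K) i k u r u with ⟨h1, h2, h3⟩ | ⟨h1, h3⟩ <;>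
    rcases partEnd_eq (S := S) (K := K) j l v s v with ⟨h4, h5, h6⟩ | ⟨h4, h6⟩ <;>
    rw [h3, h6] at h
  · simp only [Point.cut.injEq] at h
    obtain ⟨rfl, rfl, rfl, -⟩ := h
    exact ⟨rfl, rfl, rfl, fun _ => h2.trans h5.symm⟩
  · exact absurd h.symm (A.sidePoint_ne_cut l.2 _ _ _ _)
  · exact absurd h (A.sidePoint_ne_cut k.2 _ _ _ _)
  · obtain ⟨rfl, h7, rfl, -⟩ := A.sidePoint_inj k.2 l.2 h (by simp)
    obtain rfl := Fin.ext h7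
    exact ⟨rfl, rfl, rfl, fun hc => (h1 hc).trans (h4 hc).symm⟩

theorem partEnd_congr {i k : Fin n} {u r s e : Bool} (h : (i, k) ∈ K.corridors → r = s) :
    partEnd S K i k u r e = partEnd S K i k u s e := by
  by_cases hc : (i, k) ∈ K.corridors
  · rw [h hc]
  · simp [partEnd, hc]

theorem hasMid_congr {i k : Fin n} {u r s : Bool} (h : (i, k) ∈ K.corridors → r = s) :
    HasMid S K i k u r ↔ HasMid S K i k u s := by
  by_cases hc : (i, k) ∈ K.corridors
  · rw [h hc]
  · simp [HasMid, hc]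

/-- A cut edge departs from the points with equal chain and part labels, whereas a part of a side
that begins at a cut begins at a point with different labels. -/
theorem partEnd_start_ne_cut (A : CrossingTimes S X) {i k a b : Fin n} (u r s : Bool) :
    partEnd S K i k u r u ≠ .cut a b s s := by
  rcases partEnd_eq (S := S) (K := K) i k u r u with ⟨h1, h2, h3⟩ | ⟨h1, h3⟩ <;> rw [h3]
  · rintro h
    simp only [Point.cut.injEq] at h
    obtain ⟨-, -, rfl, h⟩ := h
    revert h; cases u <;> simp
  · exact A.sidePoint_ne_cut k.2 _ _ _ _

/-- Every vertex has at most one successor on the boundary. -/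
theorem boundaryStep_unique (A : CrossingTimes S X) {x y z : Point n} (hy : BoundaryStep S K x y)
    (hz : BoundaryStep S K x z) : y = z := by
  obtain ⟨i, k, h1⟩ := boundaryStep_iff.1 hy
  obtain ⟨j, l, h2⟩ := boundaryStep_iff.1 hz
  rcases h1 with ⟨u, r, h, ⟨rfl, rfl⟩ | ⟨rfl, rfl⟩⟩ | ⟨u, r, h, rfl, rfl⟩ | ⟨r, h, rfl, rfl⟩ <;>
    rcases h2 with ⟨v, s, h', ⟨h3, rfl⟩ | ⟨h3, rfl⟩⟩ | ⟨v, s, h', h3, rfl⟩ | ⟨s, h', h3, rfl⟩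
  · obtain ⟨rfl, rfl, rfl, -⟩ := A.partEnd_start_inj h3; rfl
  · exact absurd h3 (A.partEnd_ne_mid _ _ _ _)
  · obtain ⟨rfl, rfl, rfl, h4⟩ := A.partEnd_start_inj h3
    exact absurd ((hasMid_congr h4).1 h) h'
  · exact absurd h3 (A.partEnd_start_ne_cut _ _ _)
  · exact absurd h3.symm (A.partEnd_ne_mid _ _ _ _)
  · simp only [Point.mid.injEq] at h3
    obtain ⟨rfl, rfl, rfl⟩ := h3
    refine partEnd_congr fun hc => ?_
    have := (h.2 hc).symm.trans (h'.2 hc)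
    revert this; cases r <;> cases s <;> simp
  · exact absurd h3.symm (A.partEnd_ne_mid _ _ _ _)
  · simp at h3
  · obtain ⟨rfl, rfl, rfl, h4⟩ := A.partEnd_start_inj h3
    exact absurd ((hasMid_congr h4).2 h') h
  · exact absurd h3 (A.partEnd_ne_mid _ _ _ _)
  · obtain ⟨rfl, rfl, rfl, h4⟩ := A.partEnd_start_inj h3
    exact partEnd_congr h4
  · exact absurd h3 (A.partEnd_start_ne_cut _ _ _)
  · exact absurd h3.symm (A.partEnd_start_ne_cut _ _ _)
  · simp at h3
  · exact absurd h3.symm (A.partEnd_start_ne_cut _ _ _)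
  · simp only [Point.cut.injEq] at h3
    obtain ⟨rfl, rfl, rfl, -⟩ := h3
    rfl

theorem exists_succ (A : CrossingTimes S X) {x : Point n} (hx : IsVertex S K x) :
    ∃ y, BoundaryStep S K x y := by
  obtain ⟨i, k, u, r, hx⟩ := isVertex_iff.1 hx
  rcases mem_sidePart_iff.1 hx with ⟨h, rfl⟩ | ⟨e, rfl⟩
  · exact ⟨_, boundaryStep_iff.2 ⟨i, k, Or.inl ⟨u, r, h, Or.inr ⟨rfl, rfl⟩⟩⟩⟩
  · by_cases heu : e = u
    · subst heu
      obtain ⟨y, -, hy⟩ := exists_step_of_start (S := S) (K := K) i k e r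
      exact ⟨y, hy⟩
    · obtain rfl : e = !u := by revert heu; cases e <;> cases u <;> simp
      rcases partEnd_eq (S := S) (K := K) i k u r (!u) with ⟨h1, h2, h3⟩ | ⟨h1, h3⟩
      · rw [h3, Bool.not_not]
        exact ⟨_, boundaryStep_cut h1 u⟩
      -- The part ends at a genuine end of the side, so another side begins there.
      · obtain ⟨j, l, v, s, hl, h4, h5⟩ := A.exists_sidePoint_eq (i := i) k.2 u (!u)
        obtain rfl : v = s := by revert h5; cases u <;> simp
        obtain ⟨y, -, hy⟩ := exists_step_of_start (S := S) (K := K) j ⟨l, hl⟩ v v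
        rw [partEnd_self] at hy
        exact ⟨y, by rw [h3, ← h4]; exact hy⟩

theorem exists_pred (A : CrossingTimes S X) {x : Point n} (hx : IsVertex S K x) :
    ∃ y, BoundaryStep S K y x := by
  obtain ⟨i, k, u, r, hx⟩ := isVertex_iff.1 hx
  rcases mem_sidePart_iff.1 hx with ⟨h, rfl⟩ | ⟨e, rfl⟩
  · exact ⟨_, boundaryStep_iff.2 ⟨i, k, Or.inl ⟨u, r, h, Or.inl ⟨rfl, rfl⟩⟩⟩⟩
  · by_cases heu : e = u
    · subst heu
      rcases partEnd_eq (S := S) (K := K) i k e r e with ⟨h1, h2, h3⟩ | ⟨h1, h3⟩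
      · rw [h3]
        have := boundaryStep_cut (S := S) h1 (!e)
        rw [Bool.not_not] at this
        exact ⟨_, this⟩
      · obtain ⟨j, l, v, s, hl, h4, h5⟩ := A.exists_sidePoint_eq (i := i) k.2 e e
        obtain rfl : s = !v := by revert h5; cases s <;> cases v <;> simp
        obtain ⟨y, -, hy⟩ := exists_step_of_end (S := S) (K := K) j ⟨l, hl⟩ v (!v)
        rw [partEnd_self] at hy
        exact ⟨y, by rw [h3, ← h4]; exact hy⟩
    · obtain rfl : e = !u := by revert heu; cases e <;> cases u <;> simp
      obtain ⟨y, -, hy⟩ := exists_step_of_end (S := S) (K := K) i k u r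
      exact ⟨y, hy⟩

end CrossingTimes

/-! ## Colorings of the boundary -/

/-- A coloring of the edges of the boundary, given by the color `E x` of the edge that leaves the
vertex `x` and the color `F x` of the edge that enters it. The color changes at crossings only. -/
structure BoundaryColoring {n : ℕ} (S : Fin n → List (Fin n)) (K : Cuts n) (E F : Point n → Prop) :
    Prop where
  step : ∀ x y, BoundaryStep S K x y → (E x ↔ F y)
  mid : ∀ i k u, E (.mid i k u) ↔ F (.mid i k u)
  cut : ∀ i k u r, E (.cut i k u r) ↔ F (.cut i k u r)
  leftEnd : ∀ i, E (.leftEnd i) ↔ F (.leftEnd i)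
  rightEnd : ∀ i, E (.rightEnd i) ↔ F (.rightEnd i)

/-- The color of the side `(i, k, u)` near its end `r`. -/
def endColor {n : ℕ} (S : Fin n → List (Fin n)) (E F : Point n → Prop) (i : Fin n) (k : ℕ)
    (u r : Bool) : Prop :=
  if u = r then E (sidePoint S i k u r) else F (sidePoint S i k u r)

namespace BoundaryColoring

variable {n : ℕ} {S : Fin n → List (Fin n)} {X : Fin n → Fin n → ℕ} {K : Cuts n} {E F : Point n → Prop}

/-- The additional point on a side does not change the color, so each part of a side carries a
single color. -/
theorem along (C : BoundaryColoring S K E F) (i k : Fin n) (u r : Bool) :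
    E (partEnd S K i k u r u) ↔ F (partEnd S K i k u r (!u)) := by
  by_cases h : HasMid S K i k u r
  · rw [C.step _ _ (boundaryStep_iff.2 ⟨i, k, Or.inl ⟨u, r, h, Or.inl ⟨rfl, rfl⟩⟩⟩), ← C.mid,
      C.step _ _ (boundaryStep_iff.2 ⟨i, k, Or.inl ⟨u, r, h, Or.inr ⟨rfl, rfl⟩⟩⟩)]
  · exact C.step _ _ (boundaryStep_iff.2 ⟨i, k, Or.inr (Or.inl ⟨u, r, h, rfl, rfl⟩)⟩)

theorem endColor_iff (C : BoundaryColoring S K E F) (i k : Fin n) (u r : Bool) :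
    endColor S E F i k u r ↔ E (partEnd S K i k u r u) := by
  unfold endColor
  split_ifs with h
  · subst h; rw [partEnd_self]
  · obtain rfl : r = !u := by revert h; cases r <;> cases u <;> simp
    rw [C.along, partEnd_self]

/-- The color of a vertex at which the color does not change. -/
theorem iff_endColor (C : BoundaryColoring S K E F) {i k : Fin n} {u r : Bool} {x : Point n}
    (hx : x ∈ sidePart S K i k u r) (hEF : E x ↔ F x) : E x ↔ endColor S E F i k u r := by
  rw [C.endColor_iff]
  rcases mem_sidePart_iff.1 hx with ⟨h, rfl⟩ | ⟨e, rfl⟩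
  · rw [C.mid, C.step _ _ (boundaryStep_iff.2 ⟨i, k, Or.inl ⟨u, r, h, Or.inl ⟨rfl, rfl⟩⟩⟩)]
  · by_cases heu : e = u
    · rw [heu]
    · obtain rfl : e = !u := by revert heu; cases e <;> cases u <;> simp
      rw [C.along, hEF]

theorem endColor_uncut (C : BoundaryColoring S K E F) {i k : Fin n} (h : (i, k) ∉ K.corridors)
    (u r s : Bool) : endColor S E F i k u r ↔ endColor S E F i k u s := by
  rw [C.endColor_iff, C.endColor_iff, CrossingTimes.partEnd_congr fun h' => absurd h' h]

/-- The boundary crosses the corridor along the cut edge and keeps its color at both ends of that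
edge. -/
theorem endColor_cut (C : BoundaryColoring S K E F) {i k : Fin n} (h : (i, k) ∈ K.corridors)
    (r : Bool) : endColor S E F i k false r ↔ endColor S E F i k true r := by
  have key : endColor S E F i k r r ↔ endColor S E F i k (!r) r := by
    rw [C.endColor_iff, C.along, C.endColor_iff]
    have h1 : partEnd S K i k r r (!r) = .cut i k r r := by simp [partEnd, h]
    have h2 : partEnd S K i k (!r) r (!r) = .cut i k (!r) r := by simp [partEnd, h]
    rw [h1, h2, ← C.cut, C.step _ _ (boundaryStep_cut h r), C.cut]
  cases r
  · exact key
  · exact key.symm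

/-- `1` if the color changes at `x`. -/
noncomputable def change (E F : Point n → Prop) (x : Point n) : ZMod 2 := by
  classical exact if E x ↔ F x then 0 else 1

/-- If the color changes at an even number of corners of each crossing, then both sides of each
corridor have the same color. -/
theorem endColor_lower_iff_upper (A : CrossingTimes S X) (C : BoundaryColoring S K E F)
    (hK : K.OpenAllHoles S)
    (heven : ∀ a b, a < b → ∑ p, ∑ q, change E F (.cross a p b q) = 0) (i k : Fin n) (r : Bool) :
    endColor S E F i k false r ↔ endColor S E F i k true r := by
  classical
  have two : (1 : ZMod 2) + 1 = 0 := by decide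
  set col : Fin n → ℕ → Bool → Bool → ZMod 2 := fun i k u r => if endColor S E F i k u r then 1 else 0
    with hcol
  have hcolE : ∀ i k u r (j l : _) v s, (endColor S E F i k u r ↔ endColor S E F j l v s) →
      col i k u r = col j l v s := by
    intro i k u r j l v s h
    simp only [hcol, h]
  -- The color difference of the two sides, read at the left end of the corridor; `hr` shows that
  -- either end gives the same value, also when the corridor is cut.
  set h : Fin n → ℕ → ZMod 2 := fun i k => col i k false false + col i k true false with hh
  have hr : ∀ (i k : Fin n) r, h i k = col i k false r + col i k true r := by
    intro i k r
    by_cases hc : (i, k) ∈ K.corridors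
    · have : ∀ r, col i k false r + col i k true r = 0 := by
        intro r
        rw [hcolE _ _ _ _ _ _ _ _ (C.endColor_cut hc r), CharTwo.add_self_eq_zero]
      simp only [hh, this]
    · simp only [hh]
      rw [hcolE _ _ _ _ _ _ _ _ (C.endColor_uncut hc false false r),
        hcolE _ _ _ _ _ _ _ _ (C.endColor_uncut hc true false r)]
  have hr' : ∀ (i : Fin n) (k : ℕ) (hk : k < n) r, h i k = ∑ u, col i k u r := by
    intro i k hk r
    rw [Fintype.sum_bool, add_comm]
    exact hr i ⟨k, hk⟩ r
  -- The difference is read at the ends next to the crossing. At every corner one of the two sides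
  -- begins and the other ends, so they contribute the colors `E` and `F` of the corner, whose sum
  -- is `change`. The total over the four corners is even by assumption.
  have hflow' : ∀ a b, a < b → h a (corridorAt S X a (X a b)) + h a (corridorAt S X a (X a b) + 1) +
      (h b (corridorAt S X b (X a b)) + h b (corridorAt S X b (X a b) + 1)) = 0 := by
    intro a b hab
    have h1 : h a (corridorAt S X a (X a b)) + h a (corridorAt S X a (X a b) + 1) =
        ∑ p, ∑ q, col a (corridorAt S X a (X a b) + q.toNat) p (!q) := by
      rw [Finset.sum_comm, Fintype.sum_bool (fun q => ∑ p, _), add_comm]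
      exact congrArg₂ (· + ·) (hr' _ _ (A.corridorAt_fst_lt hab true) false)
        (hr' _ _ (A.corridorAt_fst_lt hab false) true)
    have h2 : h b (corridorAt S X b (X a b)) + h b (corridorAt S X b (X a b) + 1) =
        ∑ p, ∑ q, col b (corridorAt S X b (X a b) + (!p).toNat) q p := by
      rw [Fintype.sum_bool (fun p => ∑ q, _)]
      exact congrArg₂ (· + ·) (hr' _ _ (A.corridorAt_snd_lt hab true) true)
        (hr' _ _ (A.corridorAt_snd_lt hab false) false)
    rw [h1, h2, ← Finset.sum_add_distrib, ← heven a b hab]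
    refine Finset.sum_congr rfl fun p _ => ?_
    rw [← Finset.sum_add_distrib]
    refine Finset.sum_congr rfl fun q _ => ?_
    simp only [hcol, endColor, A.sidePoint_fst hab, A.sidePoint_snd hab, change]
    by_cases hE : E (.cross a p b q) <;> by_cases hF : F (.cross a p b q) <;> cases p <;> cases q <;>
      simp [hE, hF, two]
  have hflow : CrossingTimes.IsFlow S X h := by
    intro i j hij
    rcases lt_or_gt_of_ne hij with hlt | hlt
    · exact hflow' i j hlt
    · have := hflow' j i hlt
      rw [A.symm j i, add_comm] at this
      exact this
  have hn := i.pos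
  -- Both chains meet in the endpoint of the channel, where the color does not change.
  have h0 : ∀ i, h i 0 = 0 := by
    intro i
    rw [hr' i 0 hn false, Fintype.sum_bool]
    have hE := C.leftEnd i
    by_cases hF : F (.leftEnd i) <;> simp [hcol, endColor, sidePoint, hE, hF, two]
  have h1 : ∀ i, h i (n - 1) = 0 := by
    intro i
    rw [hr' i (n - 1) (by omega) true, Fintype.sum_bool]
    have : (S i)[n - 1]? = none := List.getElem?_eq_none_iff.2 (by rw [A.length])
    have hE := C.rightEnd i
    by_cases hF : F (.rightEnd i) <;> simp [hcol, endColor, sidePoint, this, hE, hF, two]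
  have h2 : ∀ i k : Fin n, (i, k) ∈ K.corridors → h i k = 0 := by
    intro i k hc
    simp only [hh]
    rw [hcolE _ _ _ _ _ _ _ _ (C.endColor_cut hc false), CharTwo.add_self_eq_zero]
  have key := A.flow_eq_zero hflow h0 h1 hK h2 i k
  rw [hr i k r] at key
  simp only [hcol] at key
  by_cases e1 : endColor S E F i k false r <;> by_cases e2 : endColor S E F i k true r <;>
    simp [e1, e2] at key ⊢

end BoundaryColoring

/-! ## The boundary is a single cycle -/

namespace CrossingTimes

variable {n : ℕ} {S : Fin n → List (Fin n)} {X : Fin n → Fin n → ℕ} {K : Cuts n}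

theorem sameBoundary_symm {s t : Side n} (h : SameBoundary S s t) : SameBoundary S t s := by
  unfold SameBoundary at h ⊢
  have hs : Std.Symm (fun a b : Side n => ∃ x, IsEndOf S x a ∧ IsEndOf S x b) :=
    ⟨fun a b ⟨x, h1, h2⟩ => ⟨x, h2, h1⟩⟩
  exact (Relation.ReflTransGen.stdSymm (r := _)).symm _ _ h

theorem mem_of_sameBoundary {l : List (Fin n × Fin n)} {O : Set (Side n)} (hO : CutsReach S l O)
    {s t : Side n} (hs : s ∈ O) (hst : SameBoundary S s t) : t ∈ O := by
  induction hO with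
  | start =>
    simp only [Set.mem_ofPred_eq, OnHole] at hs ⊢
    exact fun h => hs fun r hr => h r ((sameBoundary_symm hst).trans hr)
  | step l O i k u _ _ _ ih =>
    rcases hs with hs | hs
    · exact Or.inl (ih hs)
    · exact Or.inr (Relation.ReflTransGen.trans hs hst)

theorem mem_of_mem_cuts {l : List (Fin n × Fin n)} {O : Set (Side n)} (hO : CutsReach S l O)
    {i k : Fin n} (h : (i, k) ∈ l) (u : Bool) : (i, k, u) ∈ O := by
  induction hO with
  | start => simp at h
  | step l O j m v _ hv _ ih =>
    rcases List.mem_cons.1 h with h | h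
    · simp only [Prod.mk.injEq] at h
      obtain ⟨rfl, rfl⟩ := h
      by_cases huv : u = v
      · subst huv; exact Or.inl hv
      · obtain rfl : u = !v := by revert huv; cases u <;> cases v <;> simp
        exact Or.inr Relation.ReflTransGen.refl
    · exact Or.inl (ih h)

open Classical in
/-- On each boundary cycle, the colors of the ends of the sides sum up to zero. -/
theorem sum_boundary_eq_zero (A : CrossingTimes S X) (c : Side n → Bool → ZMod 2)
    (hc : ∀ s t r r', sidePoint S s.1 s.2.1 s.2.2 r = sidePoint S t.1 t.2.1 t.2.2 r' → c s r = c t r')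
    (s₀ : Side n) : ∑ s with SameBoundary S s₀ s, (c s false + c s true) = 0 := by
  have h1 : ∀ s : Side n, c s false + c s true = ∑ r, c s r := fun s => by
    rw [Fintype.sum_bool, add_comm]
  simp only [h1]
  rw [← Finset.sum_product']
  have hex : ∀ x : Side n × Bool, ∃ y : Side n × Bool,
      sidePoint S y.1.1 y.1.2.1 y.1.2.2 y.2 = sidePoint S x.1.1 x.1.2.1 x.1.2.2 x.2 ∧
        (y.1.2.2 == y.2) = !(x.1.2.2 == x.2) := by
    rintro ⟨⟨i, k, u⟩, r⟩
    obtain ⟨j, l, v, s, hl, h⟩ := A.exists_sidePoint_eq (i := i) k.2 u r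
    exact ⟨⟨⟨j, ⟨l, hl⟩, v⟩, s⟩, h⟩
  -- The involution swaps the two side ends that lie at the same point. It stays on the boundary
  -- cycle, has no fixed points, and preserves the color.
  choose g hg1 hg2 using hex
  refine Finset.sum_involution (fun x _ => g x) ?_ ?_ ?_ ?_
  · intro x _
    rw [hc (g x).1 x.1 (g x).2 x.2 (hg1 x), CharTwo.add_self_eq_zero]
  · intro x _ _ he
    have := hg2 x
    rw [he] at this
    revert this; cases (x.1.2.2 == x.2) <;> simp
  · intro x hx
    simp only [Finset.mem_product, Finset.mem_filter, Finset.mem_univ, true_and, and_true] at hx ⊢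
    refine hx.tail ⟨sidePoint S x.1.1 x.1.2.1 x.1.2.2 x.2, ?_, ?_⟩
    · rw [isEndOf_iff]; exact ⟨_, rfl⟩
    · rw [isEndOf_iff]; exact ⟨_, (hg1 x).symm⟩
  · intro x _
    obtain ⟨h2, h3, h4, h5⟩ := A.sidePoint_inj (g (g x)).1.2.1.2 x.1.2.1.2 ((hg1 (g x)).trans (hg1 x))
      (by rw [hg2, hg2, Bool.not_not])
    exact Prod.ext (Prod.ext h2 (Prod.ext (Fin.ext h3) h4)) h5

/-- Cuts are removed in reverse order. The hole opened by the last remaining cut meets no other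
remaining cut: the sides of all earlier cuts lie on the outer boundary reached by then. So its sides
other than the one just cut keep their color, and as the changes around a cycle sum to zero, that
side keeps it too. -/
theorem color_across_cuts (A : CrossingTimes S X) {l : List (Fin n × Fin n)} {O : Set (Side n)}
    (hO : CutsReach S l O) (c : Side n → Bool → ZMod 2)
    (hc : ∀ s t r r', sidePoint S s.1 s.2.1 s.2.2 r = sidePoint S t.1 t.2.1 t.2.2 r' → c s r = c t r')
    (hu : ∀ i k u v r, c (i, k, u) r = c (i, k, v) r)
    (hl : ∀ i k u, (i, k) ∉ l → c (i, k, u) false = c (i, k, u) true) (s : Side n) :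
    c s false = c s true := by
  classical
  induction hO with
  | start => exact hl _ _ _ (by simp)
  | step l O i k u hO hmem hnot ih =>
    refine ih fun j m v hjm => ?_
    by_cases he : (j, m) = (i, k)
    · simp only [Prod.mk.injEq] at he
      obtain ⟨rfl, rfl⟩ := he
      rw [hu j m v (!u), hu j m v (!u)]
      have h := A.sum_boundary_eq_zero c hc (j, m, !u)
      rw [Finset.sum_eq_single (j, m, !u)] at h
      · exact (CharTwo.add_eq_zero).1 h
      · rintro ⟨i', k', v'⟩ ht hne
        simp only [Finset.mem_filter, Finset.mem_univ, true_and] at ht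
        -- The set `O` is a union of boundary cycles, so no side of this hole belongs to it.
        have hnO : (i', k', v') ∉ O := fun hO' =>
          hnot (mem_of_sameBoundary hO hO' (sameBoundary_symm ht))
        rw [hl i' k' v', CharTwo.add_self_eq_zero]
        intro hcut
        rcases List.mem_cons.1 hcut with h' | h'
        · simp only [Prod.mk.injEq] at h'
          obtain ⟨rfl, rfl⟩ := h'
          by_cases hv : v' = u
          · subst hv; exact hnO hmem
          · apply hne
            have : v' = !u := by revert hv; cases v' <;> cases u <;> simp
            rw [this]
        · exact hnO (mem_of_mem_cuts hO h' v')
      · intro h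
        exact absurd (Finset.mem_filter.2 ⟨Finset.mem_univ _, Relation.ReflTransGen.refl⟩) h
    · exact hl j m v fun h => (List.mem_cons.1 h).elim he hjm

end CrossingTimes

namespace BoundaryColoring

variable {n : ℕ} {S : Fin n → List (Fin n)} {X : Fin n → Fin n → ℕ} {K : Cuts n} {E : Point n → Prop}

/-- A coloring that changes nowhere is constant. -/
theorem iff_of_isVertex (A : CrossingTimes S X) (C : BoundaryColoring S K E E)
    (hK : K.OpenAllHoles S) {x y : Point n} (hx : IsVertex S K x) (hy : IsVertex S K y) :
    E x ↔ E y := by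
  classical
  have hev : ∀ i (k : ℕ) u r, endColor S E E i k u r ↔ E (sidePoint S i k u r) := by
    intro i k u r; simp [endColor]
  have hlu := fun i k r => C.endColor_lower_iff_upper A hK (fun a b _ => by simp [change]) i k r
  simp only [hev] at hlu
  set c : Side n → Bool → ZMod 2 := fun s r => if E (sidePoint S s.1 s.2.1 s.2.2 r) then 1 else 0 with hc
  have hcE : ∀ s t r r', c s r = c t r' ↔
      (E (sidePoint S s.1 s.2.1 s.2.2 r) ↔ E (sidePoint S t.1 t.2.1 t.2.2 r')) := by
    intro s t r r'
    by_cases h1 : E (sidePoint S s.1 s.2.1 s.2.2 r) <;>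
      by_cases h2 : E (sidePoint S t.1 t.2.1 t.2.2 r') <;> simp [hc, h1, h2]
  have hu : ∀ i k u v r, c (i, k, u) r = c (i, k, v) r := by
    intro i k u v r
    rw [hcE]
    have := hlu i k r
    cases u <;> cases v <;> simp [this]
  -- The left and the right end of each corridor now have the same color, whether it is cut or not;
  -- together with `hu` each corridor has just one color.
  have hac := A.color_across_cuts hK c
    (fun s t r r' h => by rw [hcE, h])
    hu
    (fun i k u h => by
      rw [hcE, ← hev, ← hev]
      exact C.endColor_uncut h u false true)
  have hcor : ∀ (i : Fin n) (k : Fin n) u r v s,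
      E (sidePoint S i k u r) ↔ E (sidePoint S i k v s) := by
    intro i k u r v s
    refine (hcE (i, k, u) (i, k, v) r s).1 ?_
    rw [hu i k u v]
    have := hac (i, k, v)
    cases r <;> cases s <;> simp [this]
  have hcor' : ∀ (i : Fin n) (k : ℕ) (hk : k < n) u r v s,
      E (sidePoint S i k u r) ↔ E (sidePoint S i k v s) := fun i k hk => hcor i ⟨k, hk⟩
  have hcross : ∀ a b, a < b → ∀ p q p' q', E (.cross a p b q) ↔ E (.cross a p' b q') := by
    intro a b hab p q p' q'
    rw [← A.sidePoint_fst hab p q, hcor' _ _ (A.corridorAt_fst_lt hab q) _ _ p' (!q),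
      A.sidePoint_fst hab, ← A.sidePoint_snd hab, ← A.sidePoint_snd hab,
      hcor' _ _ (A.corridorAt_snd_lt hab p')]
  -- All corners of a crossing agree, so the color is passed on from corridor to corridor along the
  -- line; as any two lines cross, it is then the same for all lines.
  have hline : ∀ (i : Fin n) (k : ℕ), k < n → ∀ u r,
      (E (sidePoint S i k u r) ↔ E (.leftEnd i)) := by
    intro i k hk
    induction k with
    | zero => intro u r; exact hcor' i 0 hk u r u false
    | succ m ih =>
      intro u r
      rw [hcor' i _ hk u r u false, ← ih (by omega) u true]
      have hm : m < (S i).length := by rw [A.length]; omega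
      obtain ⟨j, hj⟩ : ∃ j, (S i)[m]? = some j := ⟨_, List.getElem?_eq_getElem hm⟩
      have hji : j ≠ i := (A.mem i j).1 (List.mem_of_getElem? hj)
      simp only [sidePoint, hj, crossPoint]
      simp only [if_true, Bool.false_eq_true, if_false]
      split_ifs with h
      · exact hcross _ _ h _ _ _ _
      · exact hcross _ _ (lt_of_le_of_ne (not_lt.1 h) hji) _ _ _ _
  have hall : ∀ a b, E (.leftEnd a) ↔ E (.leftEnd b) := by
    have : ∀ a b, a < b → (E (.leftEnd a) ↔ E (.leftEnd b)) := by
      intro a b hab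
      rw [← hline a _ (A.corridorAt_fst_lt hab true) true (!true), A.sidePoint_fst hab,
        ← A.sidePoint_snd hab, hline b _ (A.corridorAt_snd_lt hab true)]
    intro a b
    rcases lt_trichotomy a b with h | h | h
    · exact this a b h
    · rw [h]
    · exact (this b a h).symm
  have hv : ∀ z, IsVertex S K z → ∃ i, E z ↔ E (.leftEnd i) := by
    intro z hz
    obtain ⟨i, k, u, r, hz⟩ := isVertex_iff.1 hz
    exact ⟨i, (C.iff_endColor hz Iff.rfl).trans ((hev _ _ _ _).trans (hline i k k.2 u r))⟩
  obtain ⟨i, hi⟩ := hv x hx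
  obtain ⟨j, hj⟩ := hv y hy
  rw [hi, hj]
  exact hall i j

end BoundaryColoring

instance {n : ℕ} : Finite (Point n) := by
  let f : Point n → (Fin n ⊕ Fin n) ⊕ (Fin n × Bool × Fin n × Bool) ⊕
      (Fin n × Fin n × Bool) ⊕ (Fin n × Fin n × Bool × Bool) := fun x =>
    match x with
    | .leftEnd i => .inl (.inl i)
    | .rightEnd i => .inl (.inr i)
    | .cross i u j v => .inr (.inl (i, u, j, v))
    | .mid i k u => .inr (.inr (.inl (i, k, u)))
    | .cut i k u r => .inr (.inr (.inr (i, k, u, r)))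
  refine Finite.of_injective f ?_
  rintro (_ | _ | _ | _ | _) (_ | _ | _ | _ | _) h <;> simp_all [f]

instance {n : ℕ} (S : Fin n → List (Fin n)) (K : Cuts n) : Finite (PolygonVertex S K) :=
  inferInstanceAs (Finite {_x : Point n // _})

/-- The successor map is a surjection of a finite set to itself, hence a permutation. The indicator
of one of its orbits is a coloring that changes nowhere, so it is constant and the orbit contains
every vertex. -/
theorem CrossingTimes.exists_isBoundaryCycle {n : ℕ} {S : Fin n → List (Fin n)}
    {X : Fin n → Fin n → ℕ} {K : Cuts n} (A : CrossingTimes S X) (hK : K.OpenAllHoles S) :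
    ∃ P : Cycle (PolygonVertex S K), IsBoundaryCycle S K P := by
  rcases isEmpty_or_nonempty (PolygonVertex S K) with hE | ⟨⟨x₀⟩⟩
  · exact ⟨Cycle.nil, by simp, fun v => (hE.false v).elim, by simp⟩
  have hex : ∀ x : PolygonVertex S K, ∃ y : PolygonVertex S K, BoundaryStep S K x.1 y.1 := by
    intro x
    obtain ⟨y, hy⟩ := A.exists_succ (K := K) x.2
    exact ⟨⟨y, hy.isVertex.2⟩, hy⟩
  choose f hf using hex
  have hsurj : Function.Surjective f := by
    intro x
    obtain ⟨y, hy⟩ := A.exists_pred (K := K) x.2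
    exact ⟨⟨y, hy.isVertex.1⟩, Subtype.ext (A.boundaryStep_unique (hf _) hy)⟩
  have hinj : Function.Injective f := Finite.injective_iff_surjective.2 hsurj
  have hper : x₀ ∈ Function.periodicPts f := hinj.mem_periodicPts x₀
  let E : Point n → Prop := fun p => ∃ v : PolygonVertex S K, v.1 = p ∧ v ∈ Function.periodicOrbit f x₀
  have hEf : ∀ v, v ∈ Function.periodicOrbit f x₀ ↔ f v ∈ Function.periodicOrbit f x₀ := by
    intro v
    rw [Function.mem_periodicOrbit_iff hper, Function.mem_periodicOrbit_iff hper]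
    constructor
    · rintro ⟨m, rfl⟩
      exact ⟨m + 1, Function.iterate_succ_apply' f m x₀⟩
    · rintro ⟨m, hm⟩
      cases m with
      | succ m => exact ⟨m, hinj (by rw [← Function.iterate_succ_apply' f m x₀]; exact hm)⟩
      | zero =>
        obtain ⟨N, hN, hN'⟩ := hper
        obtain ⟨N, rfl⟩ : ∃ M, N = M + 1 := ⟨N - 1, by omega⟩
        refine ⟨N, hinj ?_⟩
        rw [← Function.iterate_succ_apply' f N x₀, ← hm]
        exact hN'
  have C : BoundaryColoring S K E E := by
    refine ⟨fun x y hxy => ?_, fun _ _ _ => Iff.rfl, fun _ _ _ _ => Iff.rfl, fun _ => Iff.rfl,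
      fun _ => Iff.rfl⟩
    have hy : (f ⟨x, hxy.isVertex.1⟩).1 = y := A.boundaryStep_unique (hf _) hxy
    constructor
    · rintro ⟨v, rfl, hv⟩
      exact ⟨_, hy, (hEf _).1 hv⟩
    · rintro ⟨w, rfl, hw⟩
      exact ⟨⟨x, hxy.isVertex.1⟩, rfl, (hEf _).2 (by rwa [Subtype.ext hy])⟩
  refine ⟨Function.periodicOrbit f x₀, Function.nodup_periodicOrbit, fun v => ?_, ?_⟩
  · obtain ⟨w, hw, hw'⟩ := (C.iff_of_isVertex A hK x₀.2 v.2).1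
      ⟨x₀, rfl, Function.self_mem_periodicOrbit hper⟩
    rwa [Subtype.ext hw] at hw'
  · rw [Function.periodicOrbit_chain]
    intro m _
    rw [Function.iterate_succ_apply']
    exact hf _

/-! ## Pieces of channels -/

section Pieces

variable {n : ℕ} {S : Fin n → List (Fin n)} {X : Fin n → Fin n → ℕ} {K : Cuts n}

/-- `x` lies in the part `r` of the corridor `(i, k)`. -/
def OnPart (S : Fin n → List (Fin n)) (K : Cuts n) (i : Fin n) (k : ℕ) (r : Bool) (x : Point n) : Prop :=
  ∃ (k' : Fin n) (u : Bool), k'.val = k ∧ x ∈ sidePart S K i k' u r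

/-- The part `r` of the corridor `k` of a channel lies on the left of the corridor `m`, if the latter is
cut. -/
def PartLeftOf (k : ℕ) (r : Bool) (m : ℕ) : Prop := k < m ∨ k = m ∧ r = false

/-- No cut across the channel `i` separates two of its parts. -/
def Unseparated (K : Cuts n) (i : Fin n) (k : ℕ) (r : Bool) (l : ℕ) (s : Bool) : Prop :=
  ∀ m : Fin n, (i, m) ∈ K.corridors → (PartLeftOf k r m ↔ PartLeftOf l s m)

theorem Unseparated.symm {i : Fin n} {k l : ℕ} {r s : Bool} (h : Unseparated K i k r l s) :
    Unseparated K i l s k r := fun m hm => (h m hm).symm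

theorem Unseparated.trans {i : Fin n} {k l o : ℕ} {r s t : Bool} (h : Unseparated K i k r l s)
    (h' : Unseparated K i l s o t) : Unseparated K i k r o t :=
  fun m hm => (h m hm).trans (h' m hm)

/-- Cuts run across corridors only, so none of them separates the two corridors next to a crossing
at their common crossing. -/
theorem unseparated_crossing (i : Fin n) (k : ℕ) : Unseparated K i k true (k + 1) false := by
  intro m _
  simp [PartLeftOf]
  omega

/-- Two points lie on a common channel, and no cut separates them. -/
def CommonPiece (S : Fin n → List (Fin n)) (K : Cuts n) (i : Fin n) (x y : Point n) : Prop :=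
  ∃ k r l s, OnPart S K i k r x ∧ OnPart S K i l s y ∧ Unseparated K i k r l s

namespace CrossingTimes

theorem sidePoint_same (A : CrossingTimes S X) {i : Fin n} {k l : ℕ} (hk : k < n) (hl : l < n)
    {u r v s : Bool} (h : sidePoint S i k u r = sidePoint S i l v s) : k = l ∧ r = s := by
  rcases A.sidePoint_cases (i := i) hk u r with ⟨h1, h2, h3⟩ | ⟨h1, h2, h3⟩ | ⟨b, q, h1, h2, h3, h4⟩ |
    ⟨a, p, h1, h2, h3, h4⟩
  · obtain ⟨-, h5, h6⟩ := A.sidePoint_eq_leftEnd hl (h.symm.trans h3)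
    exact ⟨h2.trans h5.symm, h1.trans h6.symm⟩
  · obtain ⟨-, h5, h6⟩ := A.sidePoint_eq_rightEnd hl (h.symm.trans h3)
    exact ⟨h2.trans h5.symm, h1.trans h6.symm⟩
  · obtain ⟨-, ⟨-, -, h5, h6⟩ | ⟨h5, -⟩⟩ := A.sidePoint_eq_cross hl (h.symm.trans h4)
    · exact ⟨h3.trans h6.symm, h2.trans h5.symm⟩
    · exact absurd h5 h1.ne
  · obtain ⟨-, ⟨h5, -⟩ | ⟨-, -, h5, h6⟩⟩ := A.sidePoint_eq_cross hl (h.symm.trans h4)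
    · exact absurd h5 h1.ne'
    · exact ⟨h3.trans h6.symm, h2.trans h5.symm⟩

theorem onPart_cases (_ : CrossingTimes S X) {i : Fin n} {k : ℕ} {r : Bool} {x : Point n}
    (h : OnPart S K i k r x) :
    (∃ k' u, k'.val = k ∧ x = .mid i k' u ∧ ((i, k') ∈ K.corridors → K.rightOfMid i k' u = !r)) ∨
    (∃ k' u, k'.val = k ∧ (i, k') ∈ K.corridors ∧ x = .cut i k' u r) ∨
    (∃ (k' : Fin n) (u e : Bool), k'.val = k ∧ x = sidePoint S i k' u e ∧
      ((i, k') ∈ K.corridors → r = e)) := by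
  obtain ⟨k', u, hk', hx⟩ := h
  rcases mem_sidePart_iff.1 hx with ⟨h, rfl⟩ | ⟨e, rfl⟩
  · exact Or.inl ⟨k', u, hk', rfl, h.2⟩
  · rcases partEnd_eq (S := S) (K := K) i k' u r e with ⟨h1, h2, h3⟩ | ⟨h1, h2⟩
    · exact Or.inr (Or.inl ⟨k', u, hk', h1, by rw [h3, h2]⟩)
    · exact Or.inr (Or.inr ⟨k', u, e, hk', h2, h1⟩)

/-- A vertex lies in only one part of a channel. -/
theorem onPart_unique (A : CrossingTimes S X) {i : Fin n} {k l : ℕ} {r s : Bool} {x : Point n}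
    (h : OnPart S K i k r x) (h' : OnPart S K i l s x) :
    k = l ∧ Unseparated K i k r l s := by
  -- In an uncut corridor both values of `r` name the same part, so equality of `r` and `s` can be
  -- claimed for cut corridors only.
  have key : k = l ∧ ∀ m : Fin n, m.val = k → (i, m) ∈ K.corridors → r = s := by
    rcases A.onPart_cases h with ⟨k', u, rfl, rfl, h1⟩ | ⟨k', u, rfl, h1, rfl⟩ | ⟨k', u, e, rfl, rfl, h1⟩ <;>
      rcases A.onPart_cases h' with ⟨l', v, rfl, h3, h2⟩ | ⟨l', v, rfl, h2, h3⟩ |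
        ⟨l', v, e', rfl, h3, h2⟩
    · simp only [Point.mid.injEq] at h3
      obtain ⟨-, rfl, rfl⟩ := h3
      refine ⟨rfl, fun m hm hc => ?_⟩
      obtain rfl := Fin.ext hm
      have := (h1 hc).symm.trans (h2 hc)
      revert this; cases r <;> cases s <;> simp
    · simp at h3
    · exact absurd h3.symm (A.sidePoint_ne_mid l'.2 _ _ _)
    · simp at h3
    · simp only [Point.cut.injEq] at h3
      obtain ⟨-, rfl, rfl, rfl⟩ := h3
      exact ⟨rfl, fun _ _ _ => rfl⟩
    · exact absurd h3.symm (A.sidePoint_ne_cut l'.2 _ _ _ _)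
    · exact absurd h3 (A.sidePoint_ne_mid k'.2 _ _ _)
    · exact absurd h3 (A.sidePoint_ne_cut k'.2 _ _ _ _)
    · obtain ⟨h4, h5⟩ := A.sidePoint_same k'.2 l'.2 h3
      refine ⟨h4, fun m hm hc => ?_⟩
      obtain rfl := Fin.ext hm
      obtain rfl := Fin.ext h4
      exact (h1 hc).trans (h5.trans (h2 hc).symm)
  obtain ⟨rfl, h2⟩ := key
  refine ⟨rfl, fun m hm => ?_⟩
  unfold PartLeftOf
  by_cases hkm : m.val = k
  · rw [h2 m hkm hm]
  · constructor <;> rintro (h3 | ⟨h3, -⟩)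
    · exact Or.inl h3
    · exact absurd h3.symm hkm
    · exact Or.inl h3
    · exact absurd h3.symm hkm

theorem onChannel_iff {i : Fin n} {x : Point n} :
    OnChannel S K i x ↔ ∃ k r, OnPart S K i k r x := by
  simp only [OnChannel, mem_sideParts_iff]
  constructor
  · rintro ⟨k, u, L, ⟨r, rfl⟩, hx⟩
    exact ⟨k, r, k, u, rfl, hx⟩
  · rintro ⟨k, r, k', u, -, hx⟩
    exact ⟨k', u, _, ⟨r, rfl⟩, hx⟩

/-- As a vertex lies in only one part of the channel, the part in which it was found decides its
position relative to the cut. -/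
theorem leftOfCut_iff (A : CrossingTimes S X) {i m : Fin n} {k : ℕ} {r : Bool} {x : Point n}
    (hx : OnPart S K i k r x) (hm : (i, m) ∈ K.corridors) :
    LeftOfCut S K i m x ↔ PartLeftOf k r m := by
  have h : LeftOfCut S K i m x ↔ ∃ l s, OnPart S K i l s x ∧ PartLeftOf l s m := by
    simp only [LeftOfCut, mem_sideParts_iff]
    constructor
    · rintro (⟨k', u, hk, L, ⟨s, rfl⟩, hx⟩ | ⟨u, hx⟩)
      · exact ⟨k', s, ⟨k', u, rfl, hx⟩, Or.inl hk⟩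
      · exact ⟨m, false, ⟨m, u, rfl, by simpa [sidePart, hm] using hx⟩, Or.inr ⟨rfl, rfl⟩⟩
    · rintro ⟨l, s, ⟨k', u, rfl, hx⟩, hk | ⟨hk, rfl⟩⟩
      · exact Or.inl ⟨k', u, hk, _, ⟨s, rfl⟩, hx⟩
      · obtain rfl := Fin.ext hk
        exact Or.inr ⟨u, by simpa [sidePart, hm] using hx⟩
  rw [h]
  constructor
  · rintro ⟨l, s, h1, h2⟩
    exact ((A.onPart_unique h1 hx).2 m hm).1 h2
  · exact fun h => ⟨k, r, hx, h⟩

theorem internalVisibility_adj_iff (A : CrossingTimes S X) {x y : PolygonVertex S K} :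
    (internalVisibility S K).Adj x y ↔ x ≠ y ∧ ∃ i, CommonPiece S K i x.1 y.1 := by
  refine and_congr_right fun _ => exists_congr fun i => ?_
  rw [onChannel_iff, onChannel_iff]
  constructor
  · rintro ⟨⟨k, r, hx⟩, ⟨l, s, hy⟩, h⟩
    refine ⟨k, r, l, s, hx, hy, fun m hm => ?_⟩
    rw [← A.leftOfCut_iff hx hm, ← A.leftOfCut_iff hy hm]
    exact h m hm
  · rintro ⟨k, r, l, s, hx, hy, h⟩
    refine ⟨⟨k, r, hx⟩, ⟨l, s, hy⟩, fun m hm => ?_⟩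
    rw [A.leftOfCut_iff hx hm, A.leftOfCut_iff hy hm]
    exact h m hm

theorem onPart_of_step {x y : Point n} (h : BoundaryStep S K x y) :
    ∃ i k r, OnPart S K i k r x ∧ OnPart S K i k r y := by
  obtain ⟨i, k, ⟨u, r, h', ⟨rfl, rfl⟩ | ⟨rfl, rfl⟩⟩ | ⟨u, r, h', rfl, rfl⟩ | ⟨r, h', rfl, rfl⟩⟩ :=
    boundaryStep_iff.1 h
  · exact ⟨i, k, r, ⟨k, u, rfl, mem_sidePart_iff.2 (Or.inr ⟨_, rfl⟩)⟩,
      ⟨k, u, rfl, mem_sidePart_iff.2 (Or.inl ⟨h', rfl⟩)⟩⟩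
  · exact ⟨i, k, r, ⟨k, u, rfl, mem_sidePart_iff.2 (Or.inl ⟨h', rfl⟩)⟩,
      ⟨k, u, rfl, mem_sidePart_iff.2 (Or.inr ⟨_, rfl⟩)⟩⟩
  · exact ⟨i, k, r, ⟨k, u, rfl, mem_sidePart_iff.2 (Or.inr ⟨_, rfl⟩)⟩,
      ⟨k, u, rfl, mem_sidePart_iff.2 (Or.inr ⟨_, rfl⟩)⟩⟩
  · have key : ∀ u, OnPart S K i k r (.cut i k u r) := fun u =>
      ⟨k, u, rfl, mem_sidePart_iff.2 (Or.inr ⟨!r, by simp [partEnd, h']⟩)⟩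
    exact ⟨i, k, r, key _, key _⟩

theorem commonPiece_of_step {x y : Point n} (h : BoundaryStep S K x y) :
    ∃ i, CommonPiece S K i x y := by
  obtain ⟨i, k, r, h1, h2⟩ := onPart_of_step h
  exact ⟨i, k, r, k, r, h1, h2, fun _ _ => Iff.rfl⟩

theorem boundaryStep_ne (A : CrossingTimes S X) {x y : Point n} (h : BoundaryStep S K x y) : x ≠ y := by
  obtain ⟨i, k, ⟨u, r, h', ⟨rfl, rfl⟩ | ⟨rfl, rfl⟩⟩ | ⟨u, r, h', rfl, rfl⟩ | ⟨r, h', rfl, rfl⟩⟩ :=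
    boundaryStep_iff.1 h
  · exact A.partEnd_ne_mid _ _ _ _
  · exact (A.partEnd_ne_mid _ _ _ _).symm
  · intro he
    rcases partEnd_eq (S := S) (K := K) i k u r u with ⟨h1, h2, h3⟩ | ⟨h1, h3⟩ <;>
      rcases partEnd_eq (S := S) (K := K) i k u r (!u) with ⟨h4, h5, h6⟩ | ⟨h4, h6⟩ <;>
      rw [h3, h6] at he
    · rw [h2] at h5; simp at h5
    · exact A.sidePoint_ne_cut k.2 _ _ _ _ he.symm
    · exact A.sidePoint_ne_cut k.2 _ _ _ _ he
    · have := (A.sidePoint_same k.2 k.2 he).2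
      simp at this
  · simp

theorem isHamiltonianCycle (A : CrossingTimes S X) {P : Cycle (PolygonVertex S K)}
    (hP : IsBoundaryCycle S K P) : IsHamiltonianCycle (internalVisibility S K) P :=
  ⟨hP.1, hP.2.1, hP.2.2.imp fun _ _ h => A.internalVisibility_adj_iff.2
    ⟨fun he => A.boundaryStep_ne h (congrArg Subtype.val he), commonPiece_of_step h⟩⟩

/-! ### Crossings -/

/-- The corridor of `i` whose end `r` lies at the crossing with `j`. -/
def crossingCorridor (S : Fin n → List (Fin n)) (X : Fin n → Fin n → ℕ) (i j : Fin n) (r : Bool) : ℕ :=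
  corridorAt S X i (X i j) + (!r).toNat

theorem crossingCorridor_lt (A : CrossingTimes S X) {i j : Fin n} (h : i ≠ j) (r : Bool) :
    crossingCorridor S X i j r < n := by
  have := A.corridorAt_lt h.symm
  unfold crossingCorridor
  cases r <;> simp <;> omega

theorem sidePoint_crossing (A : CrossingTimes S X) {i j : Fin n} (h : i ≠ j) (u r : Bool) :
    sidePoint S i (crossingCorridor S X i j r) u r = crossPoint i u j (r == decide (j < i)) := by
  unfold crossingCorridor
  rcases lt_or_gt_of_ne h with h' | h'
  · have := A.sidePoint_fst h' u (!r)
    rw [Bool.not_not] at this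
    simp only [this, crossPoint, h', h'.not_gt]
    simp
  · have := A.sidePoint_snd h' r u
    rw [A.symm] at this
    simp only [this, crossPoint, h', h'.not_gt]
    simp

theorem crossPoint_comm {i j : Fin n} (h : i ≠ j) (u v : Bool) :
    crossPoint i u j v = crossPoint j v i u := by
  unfold crossPoint
  rcases lt_or_gt_of_ne h with h' | h' <;> simp [h', h'.not_gt]

theorem crossPoint_inj {i j : Fin n} {u v u' v' : Bool}
    (he : crossPoint i u j v = crossPoint i u' j v') : u = u' ∧ v = v' := by
  unfold crossPoint at he
  split_ifs at he <;> simp at he <;> tauto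

theorem decide_lt_comm {i j : Fin n} (h : i ≠ j) : decide (i < j) = !decide (j < i) := by
  rcases lt_or_gt_of_ne h with h' | h' <;> simp [h', h'.not_gt]

theorem isVertex_crossPoint (A : CrossingTimes S X) {i j : Fin n} (h : i ≠ j) (u v : Bool) :
    IsVertex S K (crossPoint i u j v) := by
  have h1 := A.sidePoint_crossing h u (v == decide (j < i))
  have h2 := isVertex_partEnd (S := S) (K := K) i ⟨_, A.crossingCorridor_lt h (v == decide (j < i))⟩ u
    (v == decide (j < i)) (v == decide (j < i))
  rw [partEnd_self] at h2
  simp only [h1] at h2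
  cases v <;> cases h3 : decide (j < i) <;> simpa [h3] using h2

/-- The vertex `x` lies in the piece of the channel `i` that contains the crossing with `j`. -/
def InPiece (S : Fin n → List (Fin n)) (X : Fin n → Fin n → ℕ) (K : Cuts n) (i j : Fin n)
    (x : Point n) : Prop :=
  ∃ k r, OnPart S K i k r x ∧ Unseparated K i k r (crossingCorridor S X i j true) true

/-- The piece of a channel at a crossing may thus be named by the corridor on either side of it. -/
theorem unseparated_crossingCorridor (i j : Fin n) (r s : Bool) :
    Unseparated K i (crossingCorridor S X i j r) r (crossingCorridor S X i j s) s := by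
  have := unseparated_crossing (K := K) i (corridorAt S X i (X i j))
  cases r <;> cases s
  · exact fun _ _ => Iff.rfl
  · exact this.symm
  · exact this
  · exact fun _ _ => Iff.rfl

theorem inPiece_of_onPart {i j : Fin n} {r : Bool} {x : Point n}
    (h : OnPart S K i (crossingCorridor S X i j r) r x) : InPiece S X K i j x :=
  ⟨_, _, h, unseparated_crossingCorridor i j r true⟩

theorem commonPiece_of_inPiece {i j : Fin n} {x y : Point n} (hx : InPiece S X K i j x)
    (hy : InPiece S X K i j y) : CommonPiece S K i x y := by
  obtain ⟨k, r, h1, h2⟩ := hx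
  obtain ⟨l, s, h3, h4⟩ := hy
  exact ⟨k, r, l, s, h1, h3, h2.trans h4.symm⟩

theorem inPiece_of_commonPiece (A : CrossingTimes S X) {i j : Fin n} {x y : Point n}
    (hx : InPiece S X K i j x) (h : CommonPiece S K i x y) : InPiece S X K i j y := by
  obtain ⟨k, r, h1, h2⟩ := hx
  obtain ⟨l, s, l', s', h3, h4, h5⟩ := h
  exact ⟨l', s', h4, h5.symm.trans ((A.onPart_unique h3 h1).2.trans h2)⟩

theorem onPart_crossPoint (A : CrossingTimes S X) {i j : Fin n} (h : i ≠ j) (u r : Bool) :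
    OnPart S K i (crossingCorridor S X i j r) r (crossPoint i u j (r == decide (j < i))) := by
  refine ⟨⟨_, A.crossingCorridor_lt h r⟩, u, rfl, mem_sidePart_iff.2 (Or.inr ⟨r, ?_⟩)⟩
  rw [partEnd_self, ← A.sidePoint_crossing h]

theorem inPiece_crossPoint (A : CrossingTimes S X) {i j : Fin n} (h : i ≠ j) (u v : Bool) :
    InPiece S X K i j (crossPoint i u j v) := by
  have := A.onPart_crossPoint (K := K) h u (v == decide (j < i))
  have h2 : ((v == decide (j < i)) == decide (j < i)) = v := by
    cases v <;> cases decide (j < i) <;> rfl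
  rw [h2] at this
  exact inPiece_of_onPart this

theorem inPiece_crossPoint' (A : CrossingTimes S X) {i j : Fin n} (h : i ≠ j) (u v : Bool) :
    InPiece S X K j i (crossPoint i u j v) := by
  rw [crossPoint_comm h]
  exact A.inPiece_crossPoint h.symm v u

/-- A vertex of two channels is a corner of their crossing. -/
theorem eq_crossPoint_of_onPart (A : CrossingTimes S X) {i j : Fin n} (hij : i ≠ j) {k l : ℕ}
    {r s : Bool} {x : Point n} (h : OnPart S K i k r x) (h' : OnPart S K j l s x) :
    ∃ u v, x = crossPoint i u j v := by
  rcases A.onPart_cases h with ⟨k', u, rfl, rfl, h1⟩ | ⟨k', u, rfl, h1, rfl⟩ | ⟨k', u, e, rfl, rfl, h1⟩ <;>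
    rcases A.onPart_cases h' with ⟨l', v, rfl, h3, h2⟩ | ⟨l', v, rfl, h2, h3⟩ |
      ⟨l', v, e', rfl, h3, h2⟩
  · exact absurd (by simpa using h3 : i = j ∧ _).1 hij
  · simp at h3
  · exact absurd h3.symm (A.sidePoint_ne_mid l'.2 _ _ _)
  · simp at h3
  · exact absurd (by simpa using h3 : i = j ∧ _).1 hij
  · exact absurd h3.symm (A.sidePoint_ne_cut l'.2 _ _ _ _)
  · exact absurd h3 (A.sidePoint_ne_mid k'.2 _ _ _)
  · exact absurd h3 (A.sidePoint_ne_cut k'.2 _ _ _ _)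
  · rcases A.sidePoint_cases (i := i) k'.2 u e with ⟨-, -, h5⟩ | ⟨-, -, h5⟩ | ⟨b, q, h6, -, -, h5⟩ |
      ⟨a, p, h6, -, -, h5⟩
    · exact absurd (A.sidePoint_eq_leftEnd l'.2 (h3.symm.trans h5)).1.symm hij
    · exact absurd (A.sidePoint_eq_rightEnd l'.2 (h3.symm.trans h5)).1.symm hij
    · obtain ⟨-, ⟨h7, -⟩ | ⟨rfl, -⟩⟩ := A.sidePoint_eq_cross l'.2 (h3.symm.trans h5)
      · exact absurd h7.symm hij
      · exact ⟨u, q, by rw [h5]; simp [crossPoint, h6]⟩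
    · obtain ⟨-, ⟨rfl, -⟩ | ⟨h7, -⟩⟩ := A.sidePoint_eq_cross l'.2 (h3.symm.trans h5)
      · exact ⟨u, p, by rw [h5]; simp [crossPoint, h6.not_gt]⟩
      · exact absurd h7.symm hij

end CrossingTimes

end Pieces

/-! ## Doors -/

theorem exists_succ_of_isChain {α : Type*} {R : α → α → Prop} {x y : α} {L : List α}
    (h : List.IsChain R (x :: (L ++ [y]))) : ∀ p ∈ x :: L, ∃ q ∈ L ++ [y], R p q := by
  induction L generalizing x with
  | nil =>
    intro p hp
    simp at hp h
    exact ⟨y, by simp, hp ▸ h⟩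
  | cons z L ih =>
    rw [List.cons_append, List.isChain_cons_cons] at h
    intro p hp
    rcases List.mem_cons.1 hp with rfl | hp
    · exact ⟨z, by simp, h.1⟩
    · obtain ⟨q, hq, hR⟩ := ih h.2 p hp
      exact ⟨q, List.mem_cons_of_mem _ hq, hR⟩

theorem Cycle.exists_succ_of_chain {α : Type*} {R : α → α → Prop} {x y : α} {L M : List α}
    (h : Cycle.Chain R ((x :: L ++ y :: M : List α) : Cycle α)) :
    (∀ p ∈ x :: L, ∃ q ∈ L ++ [y], R p q) ∧ (∀ p ∈ y :: M, ∃ q ∈ M ++ [x], R p q) := by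
  rw [List.cons_append, Cycle.chain_coe_cons] at h
  have h1 : x :: (L ++ y :: M ++ [x]) = (x :: (L ++ [y])) ++ (M ++ [x]) := by simp
  have h2 : x :: (L ++ y :: M ++ [x]) = (x :: L) ++ (y :: (M ++ [x])) := by simp
  constructor
  · rw [h1] at h
    exact exists_succ_of_isChain (List.isChain_append.1 h).1
  · rw [h2] at h
    exact exists_succ_of_isChain (List.isChain_append.1 h).2.1

section Doors

variable {n : ℕ} {S : Fin n → List (Fin n)} {X : Fin n → Fin n → ℕ} {K : Cuts n}

/-- Colors along a channel do not change where there is neither a cut nor a change at a crossing. -/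
theorem Unseparated.iff_of_le {i : Fin n} {κ : ℕ → Bool → Prop}
    (huncut : ∀ k : Fin n, (i, k) ∉ K.corridors → (κ k false ↔ κ k true)) {k l : ℕ} {r s : Bool}
    (hl : l < n) (hkl : k ≤ l) (h : Unseparated K i k r l s)
    (hcross : ∀ q, k ≤ q → q < l → (κ q true ↔ κ (q + 1) false)) : κ k r ↔ κ l s := by
  -- A corridor that lies between two unseparated parts cannot be cut, so the color passes through
  -- it.
  have hun : ∀ m : ℕ, ∀ hm : m < n, ((PartLeftOf k r m ↔ PartLeftOf l s m) → False) →
      (κ m false ↔ κ m true) := by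
    intro m hm hc
    exact huncut ⟨m, hm⟩ fun h' => hc (h ⟨m, hm⟩ h')
  rcases eq_or_lt_of_le hkl with rfl | hlt
  · have h1 := hun k hl
    unfold PartLeftOf at h1
    cases r <;> cases s <;> simp at h1 ⊢
    · exact h1
    · exact h1.symm
  · have h0 : κ k r ↔ κ k true := by
      cases r
      · refine hun k (by omega) ?_
        simp only [PartLeftOf]
        intro h'
        have := h'.1 (Or.inr ⟨trivial, trivial⟩)
        omega
      · exact Iff.rfl
    have h2 : κ l s ↔ κ l false := by
      cases s
      · exact Iff.rfl
      · refine (hun l hl ?_).symm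
        simp only [PartLeftOf]
        intro h'
        have := h'.1 (Or.inl hlt)
        simp at this
    rw [h0, h2]
    have h3 : ∀ m, k + 1 ≤ m → m ≤ l → (κ k true ↔ κ m false) := by
      intro m hm
      induction m, hm using Nat.le_induction with
      | base => intro _; exact hcross k le_rfl hlt
      | succ m hm ih =>
        intro hml
        rw [ih (by omega), ← hcross m (by omega) (by omega)]
        refine hun m (by omega) ?_
        simp only [PartLeftOf]
        omega
    exact h3 l hlt le_rfl

namespace CrossingTimes

theorem exists_crossing (A : CrossingTimes S X) (i : Fin n) {q : ℕ} (hq : q + 1 < n) :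
    ∃ j, i ≠ j ∧ crossingCorridor S X i j true = q ∧ crossingCorridor S X i j false = q + 1 := by
  have hm : q < (S i).length := by rw [A.length]; omega
  have hj : (S i)[q]? = some (S i)[q] := List.getElem?_eq_getElem hm
  have h := (A.corridorAt_getElem hj).1
  refine ⟨(S i)[q], ((A.mem i _).1 (List.mem_of_getElem? hj)).symm, ?_, ?_⟩
  · simp [crossingCorridor, h]
  · simp [crossingCorridor, h]

theorem endColor_crossing (A : CrossingTimes S X) (E F : Point n → Prop) {i j : Fin n} (h : i ≠ j)
    (u r : Bool) : endColor S E F i (crossingCorridor S X i j r) u r ↔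
      if u = r then E (crossPoint i u j (r == decide (j < i)))
        else F (crossPoint i u j (r == decide (j < i))) := by
  unfold endColor
  rw [A.sidePoint_crossing h]

/-- Two channels have the same color around a crossing at which no color changes. -/
theorem color_crossing (A : CrossingTimes S X) {E F : Point n → Prop} {κ : Fin n → ℕ → Bool → Prop}
    (hκ : ∀ i (k : ℕ), k < n → ∀ u r, endColor S E F i k u r ↔ κ i k r) {i j : Fin n} (h : i ≠ j)
    (hEF : ∀ u v, E (crossPoint i u j v) ↔ F (crossPoint i u j v)) (r s : Bool) :
    κ i (crossingCorridor S X i j r) r ↔ κ j (crossingCorridor S X j i s) s := by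
  have h1 : ∀ u, κ i (crossingCorridor S X i j r) r ↔ E (crossPoint i u j (r == decide (j < i))) := by
    intro u
    rw [← hκ _ _ (A.crossingCorridor_lt h r) u, A.endColor_crossing E F h]
    split_ifs
    · rfl
    · exact (hEF _ _).symm
  have h2 : ∀ v, κ j (crossingCorridor S X j i s) s ↔ E (crossPoint i (s == decide (i < j)) j v) := by
    intro v
    rw [← hκ _ _ (A.crossingCorridor_lt h.symm s) v, A.endColor_crossing E F h.symm, crossPoint_comm h.symm]
    split_ifs
    · rfl
    · exact (hEF _ _).symm
  rw [h1 (s == decide (i < j)), h2]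

/-- The boundary is cut in two at a door, the end `r` of a corridor of the channel `i` at its crossing
with the channel `j`. Along the channels, the two sides of the door are connected through the door
only. -/
theorem exists_door_coloring (A : CrossingTimes S X) (hK : K.OpenAllHoles S)
    {P : Cycle (PolygonVertex S K)} (hP : IsBoundaryCycle S K P) {x y : PolygonVertex S K}
    {L M : List (PolygonVertex S K)} (hPL : P = ((x :: L ++ y :: M : List _) : Cycle _))
    {i j : Fin n} (hij : i ≠ j) {r : Bool} (hx : x.1 = crossPoint i r j (r == decide (j < i)))
    (hy : y.1 = crossPoint i (!r) j (r == decide (j < i))) :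
    ∃ κ : Fin n → ℕ → Bool → Prop,
      (∀ w ∈ L, ∀ m k s, OnPart S K m k s w.1 → κ m k s) ∧
      (∀ w ∈ M, ∀ m k s, OnPart S K m k s w.1 → ¬ κ m k s) ∧
      ¬ κ j (crossingCorridor S X j i true) true ∧
      ∀ m k s l t, k < n → l < n → Unseparated K m k s l t → κ m k s → ¬ κ m l t →
        m = i ∧ Unseparated K i k s (crossingCorridor S X i j true) true := by
  classical
  obtain ⟨hnd, hall, hch⟩ := hP
  rw [hPL] at hnd hall hch
  rw [Cycle.nodup_coe_iff] at hnd
  simp only [Cycle.mem_coe_iff] at hall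
  obtain ⟨hs1, hs2⟩ := Cycle.exists_succ_of_chain hch
  -- The colored edges are those of the arc from `x` to `y`: an edge leaves a vertex of `x :: L` and
  -- enters one of `L ++ [y]`. So the color changes only at `x` and `y`.
  let E : Point n → Prop := fun p => ∃ w ∈ x :: L, w.1 = p
  let F : Point n → Prop := fun p => ∃ w ∈ L ++ [y], w.1 = p
  have hEw : ∀ w : PolygonVertex S K, E w.1 ↔ w ∈ x :: L :=
    fun w => ⟨fun ⟨v, hv, he⟩ => Subtype.ext he ▸ hv, fun h => ⟨w, h, rfl⟩⟩
  have hFw : ∀ w : PolygonVertex S K, F w.1 ↔ w ∈ L ++ [y] :=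
    fun w => ⟨fun ⟨v, hv, he⟩ => Subtype.ext he ▸ hv, fun h => ⟨w, h, rfl⟩⟩
  have hnd' := hnd
  rw [List.nodup_append] at hnd'
  simp only [List.nodup_cons, List.mem_cons] at hnd'
  obtain ⟨⟨hxL, hL⟩, ⟨hyM, hM⟩, hdisj⟩ := hnd'
  have hxy : x ≠ y := hdisj x (Or.inl rfl) y (Or.inl rfl)
  have hEF : ∀ p, p ≠ x.1 → p ≠ y.1 → (E p ↔ F p) := by
    intro p h1 h2
    constructor
    · rintro ⟨w, hw, rfl⟩
      rcases List.mem_cons.1 hw with rfl | hw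
      · exact absurd rfl h1
      · exact ⟨w, List.mem_append_left _ hw, rfl⟩
    · rintro ⟨w, hw, rfl⟩
      rcases List.mem_append.1 hw with hw | hw
      · exact ⟨w, List.mem_cons_of_mem _ hw, rfl⟩
      · rw [List.mem_singleton.1 hw] at h2
        exact absurd rfl h2
  have hEx : E x.1 := (hEw x).2 (by simp)
  have hFx : ¬ F x.1 := fun h => by
    have := (hFw x).1 h
    simp at this; tauto
  have hEy : ¬ E y.1 := fun h => by
    have := (hEw y).1 h
    rcases List.mem_cons.1 this with h | h
    · exact hxy h.symm
    · exact hdisj y (Or.inr h) y (Or.inl rfl) rfl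
  have hFy : F y.1 := (hFw y).2 (by simp)
  -- the coloring by the two parts of the boundary
  have hcp : ∀ (p : Point n), (∀ a u b v, p ≠ crossPoint a u b v) → (E p ↔ F p) := by
    intro p hp
    exact hEF p (hx ▸ hp _ _ _ _) (hy ▸ hp _ _ _ _)
  have C : BoundaryColoring S K E F := by
    refine ⟨fun p q hpq => ?_, fun _ _ _ => hcp _ ?_, fun _ _ _ _ => hcp _ ?_, fun _ => hcp _ ?_,
      fun _ => hcp _ ?_⟩
    · obtain ⟨w, rfl⟩ : ∃ w : PolygonVertex S K, w.1 = p := ⟨⟨p, hpq.isVertex.1⟩, rfl⟩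
      rw [hEw]
      by_cases hw : w ∈ x :: L
      · obtain ⟨v, hv, hwv⟩ := hs1 w hw
        obtain rfl := A.boundaryStep_unique hwv hpq
        exact iff_of_true hw ((hFw v).2 hv)
      · have hw' : w ∈ y :: M := (List.mem_append.1 (hall w)).resolve_left hw
        obtain ⟨v, hv, hwv⟩ := hs2 w hw'
        obtain rfl := A.boundaryStep_unique hwv hpq
        refine iff_of_false hw fun h => ?_
        rw [hFw] at h
        rcases List.mem_append.1 hv with hv | hv
        · rcases List.mem_append.1 h with h | h
          · exact hdisj v (Or.inr h) v (Or.inr hv) rfl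
          · rw [List.mem_singleton.1 h] at hv
            exact hyM hv
        · rw [List.mem_singleton.1 hv] at h
          exact hFx ((hFw x).2 h)
    all_goals
      intro a u b v h
      unfold crossPoint at h
      split_ifs at h
  -- The vertices `x` and `y` are two different corners of the same crossing, so every crossing has
  -- zero or two changes.
  have hchange : ∀ a b, a < b → ∑ p, ∑ q, BoundaryColoring.change E F (.cross a p b q) = 0 := by
    have h00 : ∀ p, p ≠ x.1 → p ≠ y.1 → BoundaryColoring.change E F p = 0 := by
      intro p h1 h2
      simp [BoundaryColoring.change, hEF p h1 h2]
    have h01 : BoundaryColoring.change E F x.1 = 1 := by simp [BoundaryColoring.change, hEx, hFx]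
    have h02 : BoundaryColoring.change E F y.1 = 1 := by simp [BoundaryColoring.change, hEy, hFy]
    have two : (1 : ZMod 2) + 1 = 0 := by decide
    intro a b hab
    rcases lt_or_gt_of_ne hij with h | h
    · simp only [crossPoint, h, h.not_gt, if_true, decide_false] at hx hy
      by_cases he : a = i ∧ b = j
      · obtain ⟨rfl, rfl⟩ := he
        rw [hx] at h01 h00
        rw [hy] at h02 h00
        cases r <;> simp at h00 h01 h02 <;> simp [h00, h01, h02, two]
      · refine Finset.sum_eq_zero fun p _ => Finset.sum_eq_zero fun q _ => h00 _ ?_ ?_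
        · rw [hx]; intro h'; simp at h'; tauto
        · rw [hy]; intro h'; simp at h'; tauto
    · simp only [crossPoint, h, h.not_gt, if_false, decide_true] at hx hy
      by_cases he : a = j ∧ b = i
      · obtain ⟨rfl, rfl⟩ := he
        rw [hx] at h01 h00
        rw [hy] at h02 h00
        cases r <;> simp at h00 h01 h02 <;> simp [h00, h01, h02, two]
      · refine Finset.sum_eq_zero fun p _ => Finset.sum_eq_zero fun q _ => h00 _ ?_ ?_
        · rw [hx]; intro h'; simp at h'; tauto
        · rw [hy]; intro h'; simp at h'; tauto
  have hlu := C.endColor_lower_iff_upper A hK hchange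
  let κ : Fin n → ℕ → Bool → Prop := fun i k r => endColor S E F i k true r
  have hκ : ∀ i (k : ℕ), k < n → ∀ u r, endColor S E F i k u r ↔ κ i k r := by
    intro i k hk u r
    cases u
    · exact hlu i ⟨k, hk⟩ r
    · exact Iff.rfl
  have hdj := decide_lt_comm hij
  -- The chain of `j` along the door contains both `x` and `y`. The side of `j` at `x` is entering,
  -- with color `F`, and the side of `j` at `y` is leaving, with color `E`; both are outside the
  -- arc.
  have hκj : ∀ s, ¬ κ j (crossingCorridor S X j i s) s := by
    intro s
    rw [← hκ _ _ (A.crossingCorridor_lt hij.symm s) (r == decide (j < i)),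
      A.endColor_crossing E F hij.symm, crossPoint_comm hij.symm, hdj]
    by_cases hsr : (s == !decide (j < i)) = r
    · rw [if_neg]
      · rw [hsr, ← hx]; exact hFx
      · revert hsr; cases s <;> cases r <;> cases decide (j < i) <;> simp
    · have hsr' : (s == !decide (j < i)) = !r  := Bool.eq_not.2 hsr
      rw [if_pos]
      · rw [hsr', ← hy]; exact hEy
      · revert hsr; cases s <;> cases r <;> cases decide (j < i) <;> simp
  have huncut : ∀ m (k : Fin n), (m, k) ∉ K.corridors → (κ m k false ↔ κ m k true) :=
    fun m k h => C.endColor_uncut h true false true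
  -- A color change needs a corner among `x` and `y`, so only the crossing of `i` and `j` matters.
  -- There the channel `j` is uncolored on both sides by `hκj`, which leaves the channel `i`.
  have hcross : ∀ m q, q + 1 < n → (m = i → q ≠ crossingCorridor S X i j true) →
      (κ m q true ↔ κ m (q + 1) false) := by
    intro m q hq hmq
    obtain ⟨j', hj', h1, h2⟩ := A.exists_crossing m hq
    by_cases he : ∀ u v, E (crossPoint m u j' v) ↔ F (crossPoint m u j' v)
    · have h3 := A.color_crossing hκ hj' he true true
      have h4 := A.color_crossing hκ hj' he false true
      rw [h1] at h3
      rw [h2] at h4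
      exact h3.trans h4.symm
    · simp only [not_forall] at he
      obtain ⟨u, v, he⟩ := he
      have h5 : ∃ u' v', crossPoint m u j' v = crossPoint i u' j v' := by
        by_contra hc
        simp only [not_exists] at hc
        exact he (hEF _ (hx ▸ hc _ _) (hy ▸ hc _ _))
      have h6 : (m = i ∧ j' = j) ∨ (m = j ∧ j' = i) := by
        obtain ⟨u', v', h5⟩ := h5
        unfold crossPoint at h5
        split_ifs at h5 <;> simp at h5 <;> tauto
      rcases h6 with ⟨rfl, rfl⟩ | ⟨rfl, rfl⟩
      · exact absurd h1.symm (hmq rfl)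
      · have h7 := hκj true
        have h8 := hκj false
        rw [h1] at h7
        rw [h2] at h8
        exact iff_of_false h7 h8
  refine ⟨κ, ?_, ?_, hκj true, ?_⟩
  · rintro w hw m k s ⟨k', u, rfl, hk'⟩
    have hwx : w.1 ≠ x.1 := fun h => hxL (Subtype.ext h ▸ hw)
    have hwy : w.1 ≠ y.1 := fun h => hdisj y (Or.inr (Subtype.ext h ▸ hw)) y (Or.inl rfl) rfl
    rw [← hκ m k' k'.2 u, ← C.iff_endColor hk' (hEF _ hwx hwy)]
    exact (hEw w).2 (List.mem_cons_of_mem _ hw)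
  · rintro w hw m k s ⟨k', u, rfl, hk'⟩
    have hwx : w.1 ≠ x.1 := fun h => hdisj x (Or.inl rfl) x (Or.inr (Subtype.ext h ▸ hw)) rfl
    have hwy : w.1 ≠ y.1 := fun h => hyM (Subtype.ext h ▸ hw)
    rw [← hκ m k' k'.2 u, ← C.iff_endColor hk' (hEF _ hwx hwy), hEw]
    exact fun h => hdisj w (List.mem_cons.1 h) w (Or.inr hw) rfl
  · intro m k s l t hk hl hun h1 h2
    by_contra hc
    -- If the crossing with `j` lay between the two unseparated parts of `i`, their piece would
    -- contain it, contrary to `hc`.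
    have hne : ∀ q, (k ≤ q ∧ q < l ∨ l ≤ q ∧ q < k) → m = i → q ≠ crossingCorridor S X i j true := by
      rintro q hq rfl rfl
      refine hc ⟨rfl, fun p hp => ?_⟩
      have := hun p hp
      simp only [PartLeftOf, Bool.true_eq_false, and_false, or_false] at this ⊢
      rcases hq with hq | hq
      · constructor
        · intro h
          have := this.1 h
          omega
        · omega
      · constructor
        · omega
        · intro h
          have := this.2 (by omega)
          omega
    rcases le_total k l with hkl | hkl
    · exact h2 ((hun.iff_of_le (huncut m) hl hkl fun q h3 h4 =>
        hcross m q (by omega) (hne q (Or.inl ⟨h3, h4⟩))).1 h1)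
    · exact h2 ((hun.symm.iff_of_le (huncut m) hk hkl fun q h3 h4 =>
        hcross m q (by omega) (hne q (Or.inr ⟨h3, h4⟩))).2 h1)

end CrossingTimes

end Doors

/-! ## Blocking vertices -/

/-- A nontrivial rotation would put a second occurrence of `a` at the head. -/
theorem List.eq_of_isRotated_cons {α : Type*} {a : α} {l l' : List α} (hnd : (a :: l).Nodup)
    (h : (a :: l) ~r (a :: l')) : l = l' := by
  obtain ⟨k, hk⟩ := h
  rw [← List.rotate_mod] at hk
  set m := k % (a :: l).length with hm
  have hlt : m < (a :: l).length := Nat.mod_lt _ (by simp)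
  rcases Nat.eq_zero_or_pos m with h0 | hpos
  · rw [h0, List.rotate_zero] at hk
    exact (List.cons.inj hk).2
  · exfalso
    obtain ⟨p, hp⟩ : ∃ p, m = p + 1 := ⟨m - 1, by omega⟩
    rw [hp] at hk hlt
    rw [List.rotate_eq_drop_append_take hlt.le, List.drop_succ_cons] at hk
    have hp' : p < l.length := by simpa using hlt
    rw [List.drop_eq_getElem_cons hp', List.cons_append] at hk
    have : a ∈ l := (List.cons.inj hk).1 ▸ List.getElem_mem hp'
    exact (List.nodup_cons.1 hnd).1 this

theorem Cycle.eq_of_coe_cons_eq {α : Type*} {a : α} {l l' : List α} (hnd : (a :: l).Nodup)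
    (h : ((a :: l : List α) : Cycle α) = ((a :: l' : List α) : Cycle α)) : l = l' :=
  List.eq_of_isRotated_cons hnd (Cycle.coe_eq_coe.1 h)

theorem Cycle.exists_eq_cons_of_mem {α : Type*} {a : α} {P : Cycle α} (h : a ∈ P) :
    ∃ L, P = ((a :: L : List α) : Cycle α) := by
  induction P using Quotient.inductionOn' with
  | h l =>
    rw [Cycle.mk''_eq_coe, Cycle.mem_coe_iff] at h
    obtain ⟨l₁, l₂, rfl⟩ := List.append_of_mem h
    exact ⟨l₂ ++ l₁, Cycle.coe_eq_coe.2 List.isRotated_append⟩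

theorem Cycle.coe_append_comm {α : Type*} (l l' : List α) :
    ((l ++ l' : List α) : Cycle α) = ((l' ++ l : List α) : Cycle α) :=
  Cycle.coe_eq_coe.2 List.isRotated_append

theorem List.append_cons_inj_of_nodup {α : Type*} {b : α} {l₁ l₂ r₁ r₂ : List α}
    (hnd : (l₁ ++ b :: r₁).Nodup) (h : l₁ ++ b :: r₁ = l₂ ++ b :: r₂) : l₁ = l₂ ∧ r₁ = r₂ := by
  have h1 : b ∉ l₁ := by
    rw [List.nodup_append] at hnd
    exact fun hb => hnd.2.2 b hb b (by simp) rfl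
  have h2 : b ∉ r₁ := by
    rw [List.nodup_append, List.nodup_cons] at hnd
    exact hnd.2.1.1
  have := (List.append_cons_inj_of_notMem h1 h2).1 h
  tauto

/-- Two marked positions in one list coincide or come in one of the two orders. It serves to compare
a candidate blocking vertex with a known vertex on the same walk. -/
theorem List.append_cons_eq_cases {α : Type*} {o x : α} {A B E N : List α}
    (h : A ++ o :: B = E ++ x :: N) : o = x ∨ x ∈ B ∨ o ∈ N := by
  rcases List.append_eq_append_iff.1 h with ⟨C, rfl, h2⟩ | ⟨C, rfl, h2⟩
  · cases C with
    | nil => exact Or.inl (List.cons.inj h2).1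
    | cons c C =>
      have := (List.cons.inj h2).2
      exact Or.inr (Or.inl (by rw [this]; simp))
  · cases C with
    | nil => exact Or.inl (List.cons.inj h2).1.symm
    | cons c C =>
      have := (List.cons.inj h2).2
      exact Or.inr (Or.inr (by rw [this]; simp))

theorem List.exists_last_satisfying {α : Type*} {p : α → Prop} {l : List α} (h : ∃ x ∈ l, p x) :
    ∃ A o B, l = A ++ o :: B ∧ p o ∧ ∀ y ∈ B, ¬ p y := by
  induction l with
  | nil => simp at h
  | cons a l ih =>
    by_cases hl : ∃ x ∈ l, p x
    · obtain ⟨A, o, B, rfl, ho, hB⟩ := ih hl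
      exact ⟨a :: A, o, B, rfl, ho, hB⟩
    · obtain ⟨x, hx, hpx⟩ := h
      rcases List.mem_cons.1 hx with rfl | hx
      · exact ⟨[], x, l, rfl, hpx, fun y hy hpy => hl ⟨y, hy, hpy⟩⟩
      · exact absurd ⟨x, hx, hpx⟩ hl

theorem isBlockingVertex_reverse {V : Type*} {G : SimpleGraph V} {P : Cycle V} {p q o : V} :
    IsBlockingVertex G P.reverse p q o ↔ IsBlockingVertex G P p q o := by
  unfold IsBlockingVertex
  rw [Cycle.reverse_reverse, or_comm]

/-- If `a` sees `x` and `y` but no vertex between them, if the part of the cycle between `x` and `y`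
does not see the part between `a` and `x`, but sees a vertex between `y` and `a` from between `b` and
`y`, then `x` is the only blocking vertex of `(a, b)` that `a` sees. -/
theorem blockingVertex_iff_eq {V : Type*} {G : SimpleGraph V} {P : Cycle V} (hnd : P.Nodup)
    {a b x y z w : V} {A N M T : List V}
    (hP : P = ((a :: (A ++ x :: (N ++ b :: (M ++ y :: T))) : List V) : Cycle V))
    (hax : G.Adj a x) (hay : G.Adj a y) (hNA : ∀ s ∈ N ++ b :: M, ∀ t ∈ a :: A, ¬ G.Adj s t)
    (hz : z ∈ T) (hw : w ∈ b :: M) (hzw : G.Adj z w) (o : V) :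
    (G.Adj a o ∧ IsBlockingVertex G P a b o) ↔ o = x := by
  constructor
  · rintro ⟨hao, ⟨A', B, C, hP', hB⟩ | ⟨A', B, C, hP', hB⟩⟩
    · rw [hP, Cycle.nodup_coe_iff] at hnd
      rw [hP] at hP'
      have h := Cycle.eq_of_coe_cons_eq hnd hP'
      have h1 : (A ++ x :: N) ++ b :: (M ++ y :: T) = (A' ++ o :: B) ++ b :: C := by simpa using h
      have h2 : (A ++ x :: N ++ b :: (M ++ y :: T)).Nodup := by
        have := (List.nodup_cons.1 hnd).2
        simpa using this
      have h3 := (List.append_cons_inj_of_nodup h2 h1).1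
      rcases List.append_cons_eq_cases h3.symm with h4 | h4 | h4
      · exact h4
      · exact absurd hax (hB a (by simp) x (by simp [h4]))
      · exact absurd hao.symm (hNA o (by simp [h4]) a (by simp))
    · rw [hP, Cycle.reverse_coe] at hP'
      have hr : ((a :: (A ++ x :: (N ++ b :: (M ++ y :: T))) : List V).reverse : Cycle V) =
          ((a :: (T.reverse ++ y :: (M.reverse ++ b :: (N.reverse ++ x :: A.reverse))) : List V) :
            Cycle V) := by
        rw [List.reverse_cons, Cycle.coe_append_comm]
        simp
      rw [hP, ← Cycle.nodup_reverse_iff, Cycle.reverse_coe, hr, Cycle.nodup_coe_iff] at hnd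
      rw [hr] at hP'
      have h := Cycle.eq_of_coe_cons_eq hnd hP'
      have h1 : (T.reverse ++ y :: M.reverse) ++ b :: (N.reverse ++ x :: A.reverse) =
          (A' ++ o :: B) ++ b :: C := by simpa using h
      have h2 : ((T.reverse ++ y :: M.reverse) ++ b :: (N.reverse ++ x :: A.reverse)).Nodup := by
        have := (List.nodup_cons.1 hnd).2
        simpa using this
      have h3 := (List.append_cons_inj_of_nodup h2 h1).1
      have h5 : (T.reverse ++ y :: M.reverse).Nodup := (List.nodup_append.1 h2).1
      rcases List.append_cons_eq_cases h3.symm with h4 | h4 | h4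
      -- The candidate is `y`. On this walk `z` comes before `y`, and `w` after it or at the end, so
      -- their visibility contradicts blocking.
      · subst h4
        obtain ⟨rfl, rfl⟩ := List.append_cons_inj_of_nodup h5 h3
        refine absurd hzw (hB z (by simp [hz]) w ?_)
        rcases List.mem_cons.1 hw with rfl | hw
        · simp
        · simp [hw]
      · exact absurd hay (hB a (by simp) y (by simp [h4]))
      · exact absurd hao.symm (hNA o (by simp [List.mem_reverse.1 h4]) a (by simp))
  · rintro rfl
    refine ⟨hax, Or.inl ⟨A, N, M ++ y :: T, hP, fun s hs t ht hst => hNA t ?_ s hs hst.symm⟩⟩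
    simp only [List.mem_append, List.mem_cons, List.not_mem_nil, or_false] at ht ⊢
    tauto

/-! ### Pockets behind doors and the uniqueness of blocking vertices -/

section Doors

variable {n : ℕ} {S : Fin n → List (Fin n)} {X : Fin n → Fin n → ℕ} {K : Cuts n}

/-- `x` and `y` are the two corners, in the order of the boundary, of the door at the end `r` of the
corridor of the channel `i` that leads to the crossing with the channel `j`. -/
def IsDoor (S : Fin n → List (Fin n)) (K : Cuts n) (i j : Fin n) (r : Bool)
    (x y : PolygonVertex S K) : Prop :=
  x.1 = crossPoint i r j (r == decide (j < i)) ∧ y.1 = crossPoint i (!r) j (r == decide (j < i))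

namespace CrossingTimes

theorem adj_of_inPiece (A : CrossingTimes S X) {i j : Fin n} {x y : PolygonVertex S K} (hne : x ≠ y)
    (hx : InPiece S X K i j x.1) (hy : InPiece S X K i j y.1) : (internalVisibility S K).Adj x y :=
  A.internalVisibility_adj_iff.2 ⟨hne, i, commonPiece_of_inPiece hx hy⟩

theorem OnPart.lt {i : Fin n} {k : ℕ} {r : Bool} {x : Point n} (h : OnPart S K i k r x) : k < n := by
  obtain ⟨k', -, rfl, -⟩ := h
  exact k'.2

/-- Only vertices in the piece of the channel of a door see each other through the door. -/
theorem inPiece_of_adj_through (A : CrossingTimes S X) (hK : K.OpenAllHoles S)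
    {P : Cycle (PolygonVertex S K)} (hP : IsBoundaryCycle S K P) {x y : PolygonVertex S K}
    {L M : List (PolygonVertex S K)} (hPL : P = ((x :: L ++ y :: M : List _) : Cycle _))
    {i j : Fin n} (hij : i ≠ j) {r : Bool} (hd : IsDoor S K i j r x y) {v w : PolygonVertex S K}
    (hv : v ∈ L) (hw : w ∈ M) (h : (internalVisibility S K).Adj v w) :
    InPiece S X K i j v.1 ∧ InPiece S X K i j w.1 := by
  obtain ⟨κ, h1, h2, -, h3⟩ := A.exists_door_coloring hK hP hPL hij hd.1 hd.2
  obtain ⟨-, m, k, s, l, t, h4, h5, h6⟩ := A.internalVisibility_adj_iff.1 h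
  obtain ⟨rfl, h7⟩ := h3 m k s l t (OnPart.lt h4) (OnPart.lt h5) h6 (h1 v hv _ _ _ h4) (h2 w hw _ _ _ h5)
  exact ⟨⟨k, s, h4, h7⟩, ⟨l, t, h5, h6.symm.trans h7⟩⟩

/-- The channel `j` is uncolored at the crossing, and color changes within a piece occur only in the
channel `i`; so the whole piece of `j` is uncolored, while the pocket is colored. -/
theorem not_inPiece_of_mem_pocket (A : CrossingTimes S X) (hK : K.OpenAllHoles S)
    {P : Cycle (PolygonVertex S K)} (hP : IsBoundaryCycle S K P) {x y : PolygonVertex S K}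
    {L M : List (PolygonVertex S K)} (hPL : P = ((x :: L ++ y :: M : List _) : Cycle _))
    {i j : Fin n} (hij : i ≠ j) {r : Bool} (hd : IsDoor S K i j r x y) {v : PolygonVertex S K}
    (hv : v ∈ L) : ¬ InPiece S X K j i v.1 := by
  obtain ⟨κ, h1, -, h2, h3⟩ := A.exists_door_coloring hK hP hPL hij hd.1 hd.2
  rintro ⟨k, s, h4, h5⟩
  exact hij (h3 j k s _ _ (OnPart.lt h4) (A.crossingCorridor_lt hij.symm true) h5
    (h1 v hv _ _ _ h4) h2).1.symm

theorem inPiece_of_step_door_start (A : CrossingTimes S X) {i j : Fin n} (hij : i ≠ j) {r : Bool}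
    {x y w : PolygonVertex S K} (hd : IsDoor S K i j r x y) (hw : BoundaryStep S K x.1 w.1) :
    InPiece S X K i j w.1 := by
  obtain ⟨z, hz, hxz⟩ := exists_step_of_start (S := S) (K := K) i ⟨_, A.crossingCorridor_lt hij r⟩ r r
  rw [partEnd_self, A.sidePoint_crossing hij, ← hd.1] at hxz
  rw [A.boundaryStep_unique hw hxz]
  exact inPiece_of_onPart (r := r) ⟨_, _, rfl, hz⟩

/-- The first vertex behind a door belongs to the piece of the door. -/
theorem inPiece_first (A : CrossingTimes S X) {P : Cycle (PolygonVertex S K)}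
    (hP : IsBoundaryCycle S K P) {x y w : PolygonVertex S K} {L M : List (PolygonVertex S K)}
    (hPL : P = ((x :: (w :: L) ++ y :: M : List _) : Cycle _)) {i j : Fin n} (hij : i ≠ j) {r : Bool}
    (hd : IsDoor S K i j r x y) : InPiece S X K i j w.1 := by
  have hch := hP.2.2
  rw [hPL, List.cons_append, List.cons_append, Cycle.chain_coe_cons, List.cons_append,
    List.isChain_cons_cons] at hch
  exact A.inPiece_of_step_door_start hij hd hch.1

/-- The last vertex behind a door belongs to the piece of the door. -/
theorem inPiece_last (A : CrossingTimes S X) {P : Cycle (PolygonVertex S K)}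
    (hP : IsBoundaryCycle S K P) {x y w : PolygonVertex S K} {L M : List (PolygonVertex S K)}
    (hPL : P = ((x :: (L ++ [w]) ++ y :: M : List _) : Cycle _)) {i j : Fin n} (hij : i ≠ j) {r : Bool}
    (hd : IsDoor S K i j r x y) : InPiece S X K i j w.1 := by
  obtain ⟨z, hz, hzy⟩ := exists_step_of_end (S := S) (K := K) i ⟨_, A.crossingCorridor_lt hij r⟩ (!r) r
  rw [Bool.not_not, partEnd_self, A.sidePoint_crossing hij, ← hd.2] at hzy
  have hz' : InPiece S X K i j z := inPiece_of_onPart (r := r) ⟨_, _, rfl, hz⟩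
  -- The vertex `z` precedes `y` by construction and `w` precedes it in the list. Every vertex other
  -- than `w` has its successor in a list from which `y` is absent.
  suffices h : z = w.1 by rwa [← h]
  obtain ⟨z, rfl⟩ : ∃ z' : PolygonVertex S K, z'.1 = z := ⟨⟨z, hzy.isVertex.1⟩, rfl⟩
  obtain ⟨hnd, hall, hch⟩ := hP
  rw [hPL] at hnd hall hch
  rw [Cycle.nodup_coe_iff] at hnd
  simp only [Cycle.mem_coe_iff] at hall
  have e1 : (x :: (L ++ [w]) ++ y :: M) = x :: L ++ w :: (y :: M) := by simp
  rw [e1] at hnd hall hch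
  obtain ⟨hs1, -⟩ := Cycle.exists_succ_of_chain hch
  have e2 : x :: L ++ w :: (y :: M) = x :: (L ++ [w]) ++ y :: M := by simp
  rw [e2] at hch
  obtain ⟨-, hs2⟩ := Cycle.exists_succ_of_chain hch
  have hyn : y ∉ L ++ [w] ∧ y ∉ M ++ [x] := by
    rw [e2, List.cons_append, List.nodup_cons, List.nodup_append, List.nodup_cons] at hnd
    obtain ⟨h1, h2, ⟨h3, h4⟩, h5⟩ := hnd
    refine ⟨fun h => h5 y h y (by simp) rfl, fun h => ?_⟩
    rcases List.mem_append.1 h with h | h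
    · exact h3 h
    · rw [List.mem_singleton.1 h] at h1
      simp at h1
  rcases List.mem_append.1 (hall z) with h | h
  · obtain ⟨q, hq, hzq⟩ := hs1 z h
    have := Subtype.ext (A.boundaryStep_unique hzq hzy)
    exact absurd (this ▸ hq) hyn.1
  · rcases List.mem_cons.1 h with rfl | h
    · rfl
    · obtain ⟨q, hq, hzq⟩ := hs2 z h
      have := Subtype.ext (A.boundaryStep_unique hzq hzy)
      exact absurd (this ▸ hq) hyn.2

/-- Around a crossing the end corner of one door is the start corner of the next, and the doors
alternate between the two channels. -/
theorem isDoor_next {i j : Fin n} (hij : i ≠ j) {r : Bool} {x y z : PolygonVertex S K}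
    (hd : IsDoor S K i j r x y) (hz : z.1 = crossPoint i (!r) j (!(r == decide (j < i)))) :
    IsDoor S K j i (r == decide (j < i)) y z := by
  unfold IsDoor at hd ⊢
  rw [decide_lt_comm hij]
  have e : ((r == decide (j < i)) == !decide (j < i)) = !r := by
    cases r <;> cases decide (j < i) <;> rfl
  rw [e, hd.2, hz]
  exact ⟨crossPoint_comm hij _ _, crossPoint_comm hij _ _⟩

/-- The four corners of a crossing in the order of the boundary. -/
theorem exists_four_pockets (A : CrossingTimes S X) (hK : K.OpenAllHoles S)
    {P : Cycle (PolygonVertex S K)} (hP : IsBoundaryCycle S K P) {i j : Fin n} (hij : i ≠ j) {r : Bool}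
    {x : PolygonVertex S K} (hx : x.1 = crossPoint i r j (r == decide (j < i))) :
    ∃ (y z t : PolygonVertex S K) (N W T E : List (PolygonVertex S K)),
      P = ((x :: N ++ y :: (W ++ z :: (T ++ t :: E)) : List _) : Cycle _) ∧
      IsDoor S K i j r x y ∧ IsDoor S K j i (r == decide (j < i)) y z ∧
      IsDoor S K i j (!r) z t ∧ IsDoor S K j i (!(r == decide (j < i))) t x := by
  set v := (r == decide (j < i)) with hv
  let c : Bool → Bool → PolygonVertex S K := fun u v =>
    ⟨crossPoint i u j v, A.isVertex_crossPoint hij u v⟩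
  have hc : ∀ u v u' v', c u v = c u' v' → u = u' ∧ v = v' := fun u v u' v' h =>
    crossPoint_inj (congrArg Subtype.val h)
  obtain rfl : x = c r v := Subtype.ext hx
  have d1 : IsDoor S K i j r (c r v) (c (!r) v) := ⟨rfl, rfl⟩
  have d2 : IsDoor S K j i v (c (!r) v) (c (!r) (!v)) := isDoor_next hij d1 rfl
  have hv' : ((!r) == decide (j < i)) = !v := by rw [hv]; cases r <;> cases decide (j < i) <;> rfl
  have d3 : IsDoor S K i j (!r) (c (!r) (!v)) (c r (!v)) := by
    unfold IsDoor
    rw [hv', Bool.not_not]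
    exact ⟨rfl, rfl⟩
  have d4 : IsDoor S K j i (!v) (c r (!v)) (c r v) := by
    have := isDoor_next (z := c r v) hij d3 (by rw [hv', Bool.not_not, Bool.not_not])
    rwa [hv'] at this
  have hmem := hP.2.1
  have p1 : ∀ u v, InPiece S X K i j (c u v).1 := fun u v => A.inPiece_crossPoint hij u v
  have p2 : ∀ u v, InPiece S X K j i (c u v).1 := fun u v => A.inPiece_crossPoint' hij u v
  -- a list that starts at the first corner
  obtain ⟨L, hL⟩ := Cycle.exists_eq_cons_of_mem (hmem (c r v))
  have hmL : ∀ w, w ≠ c r v → w ∈ L := by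
    intro w hw
    have := hmem w
    rw [hL, Cycle.mem_coe_iff] at this
    exact (List.mem_cons.1 this).resolve_left hw
  obtain ⟨N, R, rfl⟩ := List.append_of_mem (hmL (c (!r) v) fun h => by simpa using (hc _ _ _ _ h).1)
  -- Every corner lies in the pieces of both channels at the crossing, so no corner is inside a
  -- pocket. This forces the order of the corners along the boundary.
  have hN : ∀ u v, c u v ∉ N := fun u v h =>
    A.not_inPiece_of_mem_pocket hK hP hL hij d1 h (p2 u v)
  have hR : ∀ u u', u' = !v → c u u' ∈ R := by
    rintro u _ rfl
    have h := hmL (c u (!v)) fun h => by simpa using (hc _ _ _ _ h).2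
    rcases List.mem_append.1 h with h | h
    · exact absurd h (hN _ _)
    · exact (List.mem_cons.1 h).resolve_left fun h => by simpa using (hc _ _ _ _ h).2
  obtain ⟨W, R', rfl⟩ := List.append_of_mem (hR (!r) (!v) rfl)
  have hL2 : P = ((c (!r) v :: W ++ c (!r) (!v) :: (R' ++ c r v :: N) : List _) : Cycle _) := by
    rw [hL, ← List.cons_append, Cycle.coe_append_comm]
    simp
  have hW : ∀ u v, c u v ∉ W := fun u v h =>
    A.not_inPiece_of_mem_pocket hK hP hL2 hij.symm d2 h (p1 u v)
  have hR' : c r (!v) ∈ R' := by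
    rcases List.mem_append.1 (hR r (!v) rfl) with h | h
    · exact absurd h (hW _ _)
    · exact (List.mem_cons.1 h).resolve_left fun h => by simpa using (hc _ _ _ _ h).1
  obtain ⟨T, E, rfl⟩ := List.append_of_mem hR'
  exact ⟨_, _, _, N, W, T, E, hL, d1, d2, d3, d4⟩

/-- An invisible pair has exactly one blocking vertex that its first vertex sees. -/
theorem exists_blockingVertex_iff_eq (A : CrossingTimes S X) (hK : K.OpenAllHoles S)
    {P : Cycle (PolygonVertex S K)} (hP : IsBoundaryCycle S K P) {a b : PolygonVertex S K}
    (hab : a ≠ b) (hnadj : ¬ (internalVisibility S K).Adj a b) :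
    ∃ x, ∀ o, ((internalVisibility S K).Adj a o ∧
      IsBlockingVertex (internalVisibility S K) P a b o) ↔ o = x := by
  set G := internalVisibility S K with hG
  have hmem := hP.2.1
  obtain ⟨L, hL⟩ := Cycle.exists_eq_cons_of_mem (hmem a)
  have hbL : b ∈ L := by
    have := hmem b
    rw [hL, Cycle.mem_coe_iff] at this
    exact (List.mem_cons.1 this).resolve_left hab.symm
  obtain ⟨M, R, rfl⟩ := List.append_of_mem hbL
  have hham := A.isHamiltonianCycle hP
  have hMadj : ∃ x ∈ M, G.Adj a x := by
    have hch := hham.2.2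
    rw [hL, Cycle.chain_coe_cons] at hch
    cases M with
    | nil =>
      rw [List.nil_append, List.cons_append, List.isChain_cons_cons] at hch
      exact absurd hch.1 hnadj
    | cons m M =>
      rw [List.cons_append, List.cons_append, List.isChain_cons_cons] at hch
      exact ⟨m, by simp, hch.1⟩
  -- The last vertex before `b` that `a` sees; behind it the boundary turns out of the view of `a`.
  obtain ⟨C, o, B, rfl, hao, hB⟩ := List.exists_last_satisfying hMadj
  -- the vertex after `o`
  obtain ⟨y, hoy, hyB⟩ : ∃ y, BoundaryStep S K o.1 y.1 ∧ y ∈ B ++ [b] := by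
    have hch := hP.2.2
    have e : a :: (C ++ o :: B ++ b :: R) = (a :: C) ++ (o :: B ++ b :: R) := by simp
    rw [hL, e, Cycle.coe_append_comm, List.append_assoc, List.cons_append, ] at hch
    obtain ⟨y, hy, hoy⟩ := (Cycle.exists_succ_of_chain (x := o) (L := B) (y := b) (M := R ++ a :: C)
      (by simpa using hch)).1 o (by simp)
    exact ⟨y, hoy, hy⟩
  have hndL := hP.1
  rw [hL, Cycle.nodup_coe_iff] at hndL
  have hya : y ≠ a := by
    rintro rfl
    refine (List.nodup_cons.1 hndL).1 ?_
    rcases List.mem_append.1 hyB with h | h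
    · simp [h]
    · rw [List.mem_singleton.1 h]; simp
  have hayn : ¬ G.Adj a y := by
    rcases List.mem_append.1 hyB with h | h
    · exact hB y h
    · rwa [List.mem_singleton.1 h]
  -- the door behind which `b` lies
  obtain ⟨-, j, haoj⟩ := A.internalVisibility_adj_iff.1 hao
  obtain ⟨i, ki, ri, ho_i, hy_i⟩ := onPart_of_step hoy
  have hayj : ¬ CommonPiece S K j a.1 y.1 := fun h => hayn (A.internalVisibility_adj_iff.2 ⟨hya.symm, j, h⟩)
  -- If the boundary edge after `o` stayed in the channel along which `a` sees `o`, its other end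
  -- would be in the same piece and visible as well.
  have hij : i ≠ j := by
    rintro rfl
    obtain ⟨k, s, l, t, h1, h2, h3⟩ := haoj
    exact hayj ⟨k, s, ki, ri, h1, hy_i, h3.trans (A.onPart_unique h2 ho_i).2⟩
  obtain ⟨u, v, houv⟩ : ∃ u v, o.1 = crossPoint i u j v := by
    obtain ⟨k, s, l, t, h1, h2, h3⟩ := haoj
    exact A.eq_crossPoint_of_onPart hij ho_i h2
  have hoj : InPiece S X K j i o.1 := by rw [houv]; exact A.inPiece_crossPoint' hij u v
  have hoi : InPiece S X K i j o.1 := by rw [houv]; exact A.inPiece_crossPoint hij u v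
  have haj : InPiece S X K j i a.1 := by
    obtain ⟨k, s, l, t, h1, h2, h3⟩ := haoj
    exact A.inPiece_of_commonPiece hoj ⟨l, t, k, s, h2, h1, h3.symm⟩
  have hyi : InPiece S X K i j y.1 :=
    A.inPiece_of_commonPiece hoi ⟨ki, ri, ki, ri, ho_i, hy_i, fun _ _ => Iff.rfl⟩
  have hai : ¬ InPiece S X K i j a.1 := fun h => hayn (A.adj_of_inPiece hya.symm h hyi)
  have hyj : ¬ InPiece S X K j i y.1 := fun h => hayn (A.adj_of_inPiece hya.symm haj h)
  -- For the other parity the boundary would leave the corner `o` along `j`, and `y` would be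
  -- visible from `a`. So `o` is the start of a door of the channel `i`.
  have huv : v = (u == decide (j < i)) := by
    by_contra hne
    have hv : (v == !decide (j < i)) = u := by
      revert hne; cases u <;> cases v <;> cases decide (j < i) <;> simp
    refine hyj (A.inPiece_of_step_door_start (x := o) (y := ⟨_, A.isVertex_crossPoint hij.symm (!v) u⟩)
      (r := v) hij.symm ⟨?_, ?_⟩ hoy)
    · rw [houv, decide_lt_comm hij, hv, crossPoint_comm hij]
    · rw [decide_lt_comm hij, hv]
  obtain ⟨y', z, t, N, W, T, E, hP4, d1, d2, d3, d4⟩ := A.exists_four_pockets hK hP hij (huv ▸ houv)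
  have corner_i : ∀ {x : PolygonVertex S K} {u v}, x.1 = crossPoint i u j v → InPiece S X K i j x.1 :=
    fun h => h ▸ A.inPiece_crossPoint hij _ _
  have corner_j : ∀ {x : PolygonVertex S K} {u v}, x.1 = crossPoint i u j v → InPiece S X K j i x.1 :=
    fun h => h ▸ A.inPiece_crossPoint' hij _ _
  have hy'i := corner_i d1.2
  have hy'j := corner_j d1.2
  have hzi := corner_i d3.1
  have hti := corner_i d3.2
  have ne_a : ∀ {x : PolygonVertex S K}, InPiece S X K i j x.1 → a ≠ x := fun h he => hai (he ▸ h)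
  have hay' : G.Adj a y' := A.adj_of_inPiece (ne_a hy'i) haj hy'j
  -- rotations of the boundary
  have hP2 : P = ((y' :: W ++ z :: ((T ++ t :: E) ++ o :: N) : List _) : Cycle _) := by
    rw [hP4, Cycle.coe_append_comm]; simp
  have hP3 : P = ((z :: T ++ t :: (E ++ o :: N ++ y' :: W) : List _) : Cycle _) := by
    rw [hP2, Cycle.coe_append_comm]; simp
  have hP1 : P = ((t :: E ++ o :: (N ++ y' :: W ++ z :: T) : List _) : Cycle _) := by
    rw [hP3, Cycle.coe_append_comm]; simp
  have hnd4 := hP.1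
  rw [hP4, Cycle.nodup_coe_iff] at hnd4
  -- The vertex `a` lies in the piece of `j` but not in that of `i`. It is thus no corner, and it is
  -- not in the pockets `N` and `T` of `i`.
  have haEW : a ∈ E ∨ a ∈ W := by
    have := hmem a
    rw [hP4, Cycle.mem_coe_iff] at this
    simp only [List.cons_append, List.mem_cons, List.mem_append] at this
    rcases this with h | h | h | h | h | h | h | h
    · exact absurd h (ne_a hoi)
    · exact absurd haj (A.not_inPiece_of_mem_pocket hK hP hP4 hij d1 h)
    · exact absurd h (ne_a hy'i)
    · exact Or.inr h
    · exact absurd h (ne_a hzi)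
    · exact absurd haj (A.not_inPiece_of_mem_pocket hK hP hP3 hij d3 h)
    · exact absurd h (ne_a hti)
    · exact Or.inl h
  -- Between `o` and `b` there is no vertex that `a` sees, and `a` sees neither `b` nor fails to see
  -- the corner `y'`; so `b` comes before `y'`.
  have hbN : b ∈ N := by
    have e : ((o :: (N ++ y' :: (W ++ z :: (T ++ t :: E))) : List (PolygonVertex S K)) :
        Cycle (PolygonVertex S K)) =
        ((o :: (B ++ b :: (R ++ a :: C)) : List (PolygonVertex S K)) : Cycle (PolygonVertex S K)) := by
      rw [← List.cons_append (as := N), ← hP4, hL]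
      have e : a :: (C ++ o :: B ++ b :: R) = (a :: C) ++ (o :: B ++ b :: R) := by simp
      rw [e, Cycle.coe_append_comm]
      simp
    have h := Cycle.eq_of_coe_cons_eq (by simpa using hnd4) e
    rcases List.append_eq_append_iff.1 h with ⟨D, h1, h2⟩ | ⟨D, h1, h2⟩
    · cases D with
      | nil => exact absurd ((List.cons.inj h2).1 ▸ hay') hnadj
      | cons d D =>
        obtain ⟨rfl, -⟩ := List.cons.inj h2
        exact absurd hay' (hB _ (by simp [h1]))
    · cases D with
      | nil => exact absurd ((List.cons.inj h2).1 ▸ hay') hnadj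
      | cons d D =>
        obtain ⟨rfl, -⟩ := List.cons.inj h2
        simp [h1]
  have hzN : z ∉ N ∧ t ∉ N := by
    rw [List.nodup_append] at hnd4
    exact ⟨fun h => hnd4.2.2 z (List.mem_cons_of_mem _ h) z (by simp) rfl,
      fun h => hnd4.2.2 t (List.mem_cons_of_mem _ h) t (by simp) rfl⟩
  obtain ⟨N₁, N₂, rfl⟩ := List.append_of_mem hbN
  -- If `a` is in `E`, the walk forward meets `o` before the pocket of `b`, and `o` blocks; the
  -- corner `y'` fails since `z` sees the last vertex `w` of that pocket. If `a` is in `W`,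
  -- everything is mirrored: `y'` blocks, and `o` fails since `t` sees the first vertex of the
  -- pocket.
  rcases haEW with haE | haW
  · obtain ⟨E₁, E₂, rfl⟩ := List.append_of_mem haE
    obtain ⟨D, w, hw⟩ : ∃ D w, b :: N₂ = D ++ [w] :=
      ⟨_, _, (List.dropLast_append_getLast (List.cons_ne_nil b N₂)).symm⟩
    have hwi : InPiece S X K i j w.1 := by
      refine A.inPiece_last hP (L := N₁ ++ D) (M := W ++ z :: (T ++ t :: (E₁ ++ a :: E₂))) ?_ hij d1
      rw [hP4, hw]; simp
    have hwm : w ∈ b :: N₂ := hw ▸ by simp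
    refine ⟨o, blockingVertex_iff_eq (A := E₂) (N := N₁) (M := N₂) (T := W ++ z :: T ++ t :: E₁) (z := z)
      (w := w) hP.1 ?_ hao hay' ?_ (by simp) hwm ?_⟩
    · rw [hP1]
      have e : t :: (E₁ ++ a :: E₂) ++ o :: (N₁ ++ b :: N₂ ++ y' :: W ++ z :: T) =
        (t :: E₁) ++ (a :: E₂ ++ o :: (N₁ ++ b :: N₂ ++ y' :: W ++ z :: T)) := by simp
      rw [e, Cycle.coe_append_comm]
      simp
    -- Visibility out of the pocket `N` runs along `i`, but the pocket `E` of a door of `j` contains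
    -- no vertex of the piece of `i`.
    · intro s hs q hq hsq
      have hq' : q ∈ E₁ ++ a :: E₂ := List.mem_append_right _ hq
      exact A.not_inPiece_of_mem_pocket hK hP hP1 hij.symm d4 hq'
        (A.inPiece_of_adj_through hK hP hP4 hij d1 hs
          (List.mem_append_right _ (List.mem_cons_of_mem _ (List.mem_append_right _
            (List.mem_cons_of_mem _ hq')))) hsq).2
    · refine A.adj_of_inPiece (fun h => hzN.1 ?_) hzi hwi
      rw [h]; exact List.mem_append_right _ hwm
  · obtain ⟨W₁, W₂, rfl⟩ := List.append_of_mem haW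
    obtain ⟨w, D, hw⟩ : ∃ w D, N₁ ++ b :: N₂ = w :: D :=
      List.exists_cons_of_ne_nil (by simp)
    have hwi : InPiece S X K i j w.1 := by
      refine A.inPiece_first hP (L := D) (M := (W₁ ++ a :: W₂) ++ z :: (T ++ t :: E)) ?_ hij d1
      rw [hP4, hw]
    have hwm : w ∈ b :: N₁.reverse := by
      cases N₁ with
      | nil => simp at hw; simp [hw.1]
      | cons m N₁ => simp at hw; simp [hw.1]
    -- The mirrored case is the same lemma for the reversed boundary.
    simp only [← isBlockingVertex_reverse (P := P)]
    refine ⟨y', blockingVertex_iff_eq (A := W₁.reverse) (N := N₂.reverse) (M := N₁.reverse)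
      (T := E.reverse ++ t :: T.reverse ++ z :: W₂.reverse) (z := t)
      (w := w) (Cycle.nodup_reverse_iff.2 hP.1) ?_ hay' hao ?_ (by simp) hwm ?_⟩
    · rw [hP2, Cycle.reverse_coe]
      have e : (y' :: (W₁ ++ a :: W₂) ++ z :: (T ++ t :: E ++ o :: (N₁ ++ b :: N₂))).reverse =
        (N₂.reverse ++ b :: N₁.reverse ++ o :: E.reverse ++ t :: T.reverse ++ z :: W₂.reverse) ++
          (a :: W₁.reverse ++ [y']) := by simp
      rw [e, Cycle.coe_append_comm]
      simp
    · intro s hs q hq hsq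
      have hq' : q ∈ W₁ ++ a :: W₂ := by
        simp only [List.mem_append, List.mem_cons, List.mem_reverse] at hq ⊢
        tauto
      have hs' : s ∈ N₁ ++ b :: N₂ := by
        simp only [List.mem_append, List.mem_cons, List.mem_reverse] at hs ⊢
        tauto
      exact A.not_inPiece_of_mem_pocket hK hP hP2 hij.symm d2 hq'
        (A.inPiece_of_adj_through hK hP hP4 hij d1 hs' (List.mem_append_left _ hq') hsq).2
    · refine A.adj_of_inPiece (fun h => hzN.2 ?_) hti hwi
      rw [h, hw]; simp

/-- The internal visibility graph has exactly one blocking vertex assignment. -/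
theorem existsUnique_blockingVertexAssignment (A : CrossingTimes S X) (hK : K.OpenAllHoles S)
    {P : Cycle (PolygonVertex S K)} (hP : IsBoundaryCycle S K P) :
    ∃! β : InvisiblePair (internalVisibility S K) → PolygonVertex S K,
      IsBlockingVertexAssignment (internalVisibility S K) P β := by
  have h := fun p : InvisiblePair (internalVisibility S K) =>
    A.exists_blockingVertex_iff_eq hK hP p.2.1 p.2.2
  choose β hβ using h
  exact ⟨β, fun p => (hβ p _).2 rfl, fun γ hγ => funext fun p => (hβ p _).1 (hγ p)⟩

end CrossingTimes

end Doors

/-! ## Reasoning about programs -/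

namespace RamProgram

/-- Started in the state `s`, the program `Q` halts after at most `T` steps in a state that satisfies
`post`. -/
def Does (Q : RamProgram) (T : ℕ) (s : RamState) (post : RamState → Prop) : Prop :=
  ∃ t s', t ≤ T ∧ Q.Runs s t s' ∧ post s'

variable {p q : RamProgram} {s : RamState} {T T₁ T₂ : ℕ} {post mid : RamState → Prop}

theorem Does.weaken (h : Does p T₁ s mid) (hT : T₁ ≤ T) (hpost : ∀ s', mid s' → post s') :
    Does p T s post := by
  obtain ⟨t, s', ht, hr, hs⟩ := h
  exact ⟨t, s', ht.trans hT, hr, hpost _ hs⟩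

theorem Does.seq (h : Does p T₁ s mid) (h' : ∀ s', mid s' → Does q T₂ s' post) :
    Does (.seq p q) (T₁ + T₂) s post := by
  obtain ⟨t, s', ht, hr, hs⟩ := h
  obtain ⟨t', s'', ht', hr', hs'⟩ := h' s' hs
  exact ⟨t + t', s'', by omega, .seq _ _ _ _ _ _ _ hr hr', hs'⟩

theorem Does.const {r c : ℕ} (h : post { s with reg := Function.update s.reg r c }) :
    Does (.const r c) 1 s post :=
  ⟨1, _, le_rfl, .const _ _ _, h⟩

theorem Does.add {r a b : ℕ}
    (h : post { s with reg := Function.update s.reg r (s.reg a + s.reg b) }) :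
    Does (.add r a b) 1 s post :=
  ⟨1, _, le_rfl, .add _ _ _ _, h⟩

theorem Does.sub {r a b : ℕ}
    (h : post { s with reg := Function.update s.reg r (s.reg a - s.reg b) }) :
    Does (.sub r a b) 1 s post :=
  ⟨1, _, le_rfl, .sub _ _ _ _, h⟩

theorem Does.load {r a : ℕ}
    (h : post { s with reg := Function.update s.reg r (s.mem (s.reg a)) }) :
    Does (.load r a) 1 s post :=
  ⟨1, _, le_rfl, .load _ _ _, h⟩

theorem Does.store {a r : ℕ}
    (h : post { s with mem := Function.update s.mem (s.reg a) (s.reg r) }) :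
    Does (.store a r) 1 s post :=
  ⟨1, _, le_rfl, .store _ _ _, h⟩

theorem Does.ifPos {r : ℕ} (h : s.reg r ≠ 0 → Does p T s post) (h' : s.reg r = 0 → Does q T s post) :
    Does (.ifPos r p q) (T + 1) s post := by
  by_cases hr : s.reg r = 0
  · obtain ⟨t, s', ht, hs, hp⟩ := h' hr
    exact ⟨t + 1, s', by omega, .ifFalse _ _ _ _ _ _ hr hs, hp⟩
  · obtain ⟨t, s', ht, hs, hp⟩ := h hr
    exact ⟨t + 1, s', by omega, .ifTrue _ _ _ _ _ _ hr hs, hp⟩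

/-- A loop that counts the register `r` down. -/
theorem Does.whilePos {r : ℕ} (Inv : ℕ → RamState → Prop) (hr : ∀ m s, Inv m s → s.reg r = m)
    {M : ℕ} (hbody : ∀ m s, m < M → Inv (m + 1) s → Does p T s (Inv m)) :
    ∀ m s, m ≤ M → Inv m s → Does (.whilePos r p) (m * (T + 1) + 1) s (Inv 0) := by
  intro m
  induction m with
  | zero => exact fun s _ h => ⟨1, s, by omega, .whileStop _ _ _ (hr 0 s h), h⟩
  | succ m ih =>
    intro s hm h
    obtain ⟨t, s', ht, hs, hp⟩ := hbody m s (by omega) h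
    obtain ⟨t', s'', ht', hs', hp'⟩ := ih s' (by omega) hp
    refine ⟨t + t' + 1, s'', ?_, .whileStep _ _ _ _ _ _ _ ?_ hs hs', hp'⟩
    · rw [add_mul, one_mul]; omega
    · rw [hr _ _ h]; omega

/-- The registers `0`, …, `e - 1` agree. -/
def SameBelow (e : ℕ) (s s' : RamState) : Prop := ∀ r < e, s'.reg r = s.reg r

/-- `for reg v from reg b - 1 down to 0 do p`, where the register `1` holds `1`. -/
def countDown (v b : ℕ) (p : RamProgram) : RamProgram :=
  .seq (.const v 0) (.seq (.add v v b) (.whilePos v (.seq (.sub v v 1) p)))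

/-- The invariant has to tolerate changes of the counter (`hpre`), since the counter is decremented
before the body runs. The bound `T₂` on the number of rounds keeps the running time independent of
the state. -/
theorem Does.countDown {v b M : ℕ} (Inv : ℕ → RamState → Prop) (hbv : b ≠ v)
    (h1 : ∀ m s, Inv m s → s.reg 1 = 1) (hb : s.reg b = M)
    (hM : M ≤ T₂)
    (h0 : ∀ s', s'.mem = s.mem → (∀ r, r ≠ v → s'.reg r = s.reg r) → Inv M s')
    (hpre : ∀ m s s', Inv m s → s'.mem = s.mem → (∀ r, r ≠ v → s'.reg r = s.reg r) → Inv m s')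
    (hbody : ∀ m s, m < M → Inv (m + 1) s → s.reg v = m →
      Does p T s (fun s' => Inv m s' ∧ s'.reg v = m)) :
    Does (RamProgram.countDown v b p) (T₂ * (T + 2) + 3) s (Inv 0) := by
  have hw := Does.whilePos (r := v) (p := .seq (.sub v v 1) p) (T := 1 + T) (M := M)
    (fun m s => Inv m s ∧ s.reg v = m) (fun m s h => h.2) ?_ M
  · refine Does.weaken (T₁ := 1 + (1 + (M * (1 + T + 1) + 1))) (mid := Inv 0) ?_ ?_ fun _ h => h
    · refine Does.seq (Does.const (post := (· = _)) rfl) ?_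
      rintro _ rfl
      refine Does.seq (Does.add (post := (· = _)) rfl) ?_
      rintro _ rfl
      refine Does.weaken (hw _ le_rfl ?_) le_rfl fun _ h => h.1
      refine ⟨h0 _ rfl ?_, ?_⟩
      · intro r hr
        simp [Function.update_of_ne hr]
      · simp [Function.update_of_ne hbv, hb]
    · have := Nat.mul_le_mul_right (T + 2) hM
      have e : 1 + T + 1 = T + 2 := by omega
      rw [e]; omega
  · rintro m s hm ⟨hI, hs⟩
    refine Does.seq (Does.sub (post := (· = _)) rfl) ?_
    rintro _ rfl
    refine hbody m _ hm (hpre _ s _ hI rfl fun r hr => by simp [Function.update_of_ne hr]) ?_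
    simp [hs, h1 _ _ hI]

/-- `reg e := reg a + reg v + reg u * reg 0`, where the register `1` holds `1`. -/
def address (a u v e : ℕ) : RamProgram :=
  .seq (.add e a v) (.seq (.const (e + 1) 0) (.seq (.add (e + 1) (e + 1) u)
    (.whilePos (e + 1) (.seq (.add e e 0) (.sub (e + 1) (e + 1) 1)))))

/-- The product is a repeated addition: a copy of `reg u` in the register `e + 1` is counted down,
and `reg e + m * reg 0` is invariant. Only the registers `e` and `e + 1` are used. -/
theorem Does.address {a u v e N : ℕ} (hu : u < e) (he : 1 < e)
    (h1 : s.reg 1 = 1) (hN : s.reg u ≤ N) :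
    Does (RamProgram.address a u v e) (3 * N + 4) s fun s' => s'.mem = s.mem ∧ SameBelow e s s' ∧
      s'.reg e = s.reg a + s.reg v + s.reg u * s.reg 0 := by
  have hw := Does.whilePos (r := e + 1) (p := .seq (.add e e 0) (.sub (e + 1) (e + 1) 1)) (T := 2)
    (M := s.reg u)
    (fun m s' => s'.mem = s.mem ∧ SameBelow e s s' ∧ s'.reg (e + 1) = m ∧
      s'.reg e + m * s.reg 0 = s.reg a + s.reg v + s.reg u * s.reg 0) (fun m s h => h.2.2.1) ?_
      (s.reg u)
  · refine Does.weaken (T₁ := 1 + (1 + (1 + (s.reg u * (2 + 1) + 1)))) ?_ (by omega) fun _ h => h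
    refine Does.seq (Does.add (post := (· = _)) rfl) ?_
    rintro _ rfl
    refine Does.seq (Does.const (post := (· = _)) rfl) ?_
    rintro _ rfl
    refine Does.seq (Does.add (post := (· = _)) rfl) ?_
    rintro _ rfl
    refine Does.weaken (hw _ le_rfl ?_) le_rfl ?_
    on_goal 1 => refine ⟨rfl, fun r hr => ?_, ?_, ?_⟩
    · have h2 : r ≠ e := by omega
      have h3 : r ≠ e + 1 := by omega
      simp [Function.update_of_ne h2, Function.update_of_ne h3]
    · have h2 : u ≠ e := by omega
      have h3 : u ≠ e + 1 := by omega
      simp [Function.update_of_ne h2, Function.update_of_ne h3]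
    · simp
    · rintro s' ⟨h2, h3, -, h5⟩
      exact ⟨h2, h3, by simpa using h5⟩
  · rintro m s' hm ⟨h2, h3, h4, h5⟩
    refine Does.seq (T₁ := 1) (T₂ := 1) (Does.add (post := (· = _)) rfl) ?_
    rintro _ rfl
    refine Does.sub ⟨h2, fun r hr => ?_, ?_, ?_⟩
    · have h6 : r ≠ e := by omega
      have h7 : r ≠ e + 1 := by omega
      simp [Function.update_of_ne h6, Function.update_of_ne h7, h3 r hr]
    · have h6 : 1 ≠ e := by omega
      simp [Function.update_of_ne h6, h3 1 he, h1, h4]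
    · have h8 := h3 0 (by omega)
      simp [h8]
      rw [← h5]; ring

/-- The entry of the cyclic list in the cells `0`, …, `N - 1` at the position `t < 2 * N`. -/
def cyclicEntry (N : ℕ) (m : ℕ → ℕ) (t : ℕ) : ℕ := m (if t < N then t else t - N)

/-- `reg e` becomes the entry of the cyclic list at the position `reg i + reg j`. -/
def lookup (i j e : ℕ) : RamProgram :=
  .seq (.add e i j) (.seq (.add (e + 1) e 1) (.seq (.sub (e + 1) (e + 1) 0)
    (.seq (.ifPos (e + 1) (.sub e e 0) (.const (e + 1) 0)) (.load e e))))

theorem Does.lookup {i j e : ℕ} (he : 1 < e) (h1 : s.reg 1 = 1) :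
    Does (RamProgram.lookup i j e) 6 s fun s' => s'.mem = s.mem ∧ SameBelow e s s' ∧
      s'.reg e = cyclicEntry (s.reg 0) s.mem (s.reg i + s.reg j) := by
  refine Does.seq (T₁ := 1) (T₂ := 5) (Does.add (post := (· = _)) rfl) ?_
  rintro _ rfl
  refine Does.seq (T₁ := 1) (T₂ := 4) (Does.add (post := (· = _)) rfl) ?_
  rintro _ rfl
  -- With truncated subtraction, the position plus one minus `N` is nonzero exactly when the
  -- position has to be wrapped around.
  refine Does.seq (T₁ := 1) (T₂ := 3) (Does.sub (post := (· = _)) rfl) ?_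
  rintro _ rfl
  have e1 : (1 : ℕ) ≠ e := by omega
  have e0 : (0 : ℕ) ≠ e := by omega
  refine Does.seq (T₁ := 2) (T₂ := 1) (mid := fun s' => s'.mem = s.mem ∧ SameBelow e s s' ∧
      s'.reg e = if s.reg i + s.reg j < s.reg 0 then s.reg i + s.reg j
        else s.reg i + s.reg j - s.reg 0) (Does.ifPos (T := 1) (fun h => Does.sub ⟨rfl, fun r hr => ?_, ?_⟩)
        (fun h => Does.const ⟨rfl, fun r hr => ?_, ?_⟩)) ?_
  · have h2 : r ≠ e := by omega
    have h3 : r ≠ e + 1 := by omega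
    simp [Function.update_of_ne h2, Function.update_of_ne h3]
  · simp [Function.update_of_ne e1, Function.update_of_ne e0, h1] at h ⊢
    intro hc; omega
  · have h2 : r ≠ e := by omega
    have h3 : r ≠ e + 1 := by omega
    simp [Function.update_of_ne h2, Function.update_of_ne h3]
  · simp [Function.update_of_ne e1, Function.update_of_ne e0, h1] at h ⊢
    intro hc; omega
  · rintro s' ⟨h2, h3, h4⟩
    refine Does.load ⟨h2, fun r hr => ?_, ?_⟩
    · have h5 : r ≠ e := by omega
      simp [Function.update_of_ne h5, h3 r hr]
    · simp [h2, h4, cyclicEntry]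

end RamProgram

/-! ## The program -/

namespace RamProgram

/-- The entry `(a, b)` of the matrix in the memory is not zero. -/
def Sees (N : ℕ) (m : ℕ → ℕ) (a b : ℕ) : Prop := m (N + b + a * N) ≠ 0

/-- Clear the flag in register `6` if the entries of the cyclic list at the positions
`reg 3 + reg 8` and `reg 3 + reg 4 + reg 9 + 1` see each other. -/
def checkPair : RamProgram :=
  .seq (lookup 3 8 10) (.seq (.add 11 4 9) (.seq (.add 11 11 1) (.seq (lookup 3 11 12)
    (.seq (address 0 10 12 13) (.seq (.load 13 13) (.ifPos 13 (.const 6 0) (.const 14 0)))))))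

/-- Set the flag in register `6` if `reg 4 < reg 5` and no entry of the cyclic list at a position from
`reg 3` to `reg 3 + reg 4 - 1` sees an entry at a position from `reg 3 + reg 4 + 1` to `reg 3 + reg 5`. -/
def check : RamProgram :=
  .seq (.sub 6 5 4) (.seq (.sub 7 5 4) (countDown 8 4 (countDown 9 7 checkPair)))

/-- If `reg a` sees `reg 11`, write `reg 11` into the cell `(reg a, reg b)` of the output. -/
def recordOne (a b : ℕ) : RamProgram :=
  .seq (address 0 a 11 13) (.seq (.load 13 13)
    (.ifPos 13 (.seq (address 2 a b 14) (.store 14 11)) (.const 14 0)))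

/-- Write the blocking vertex that has been found into the output. -/
def record : RamProgram :=
  .seq (.load 10 3) (.seq (lookup 3 4 11) (.seq (lookup 3 5 12)
    (.seq (recordOne 10 12) (recordOne 12 10))))

/-- The treatment of one triple of positions. -/
def treat : RamProgram := .seq check (.ifPos 6 record (.const 14 0))

/-- The program that computes blocking vertices. -/
def blockingProgram : RamProgram :=
  .seq (.const 1 1) (.seq (address 0 0 3 2) (countDown 3 0 (countDown 4 0 (countDown 5 0 treat))))

variable {s : RamState} {N : ℕ} {T : ℕ}

theorem cyclicEntry_lt {m : ℕ → ℕ} (hm : ∀ p < N, m p < N) {t : ℕ} (ht : t < 2 * N) :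
    cyclicEntry N m t < N := by
  unfold cyclicEntry
  refine hm _ ?_
  split_ifs <;> omega

theorem Does.checkPair (h0 : s.reg 0 = N) (h1 : s.reg 1 = 1) (hm : ∀ p < N, s.mem p < N)
    (hx : s.reg 3 + s.reg 8 < 2 * N) :
    Does RamProgram.checkPair (3 * N + 22) s fun s' => s'.mem = s.mem ∧
      (∀ r < 10, r ≠ 6 → s'.reg r = s.reg r) ∧ (s'.reg 6 ≠ 0 ↔ s.reg 6 ≠ 0 ∧
        ¬ Sees N s.mem (cyclicEntry N s.mem (s.reg 3 + s.reg 8))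
          (cyclicEntry N s.mem (s.reg 3 + (s.reg 4 + s.reg 9 + 1)))) := by
  refine Does.weaken (T₁ := 6 + (1 + (1 + (6 + ((3 * N + 4) + (1 + 2)))))) ?_ (by omega) fun _ h => h
  refine Does.seq (Does.lookup (by norm_num) h1) ?_
  rintro s1 ⟨m1, b1, e1⟩
  refine Does.seq (Does.add (post := (· = _)) rfl) ?_
  rintro s2 rfl
  refine Does.seq (Does.add (post := (· = _)) rfl) ?_
  rintro s3 hs3
  have m3 : s3.mem = s.mem := by rw [hs3]; exact m1
  have b3 : ∀ r < 10, s3.reg r = s.reg r := by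
    intro r hr
    rw [hs3, ← b1 r hr]
    simp [Function.update_of_ne (show r ≠ 11 by omega)]
  have e10 : s3.reg 10 = cyclicEntry N s.mem (s.reg 3 + s.reg 8) := by
    rw [hs3]; simp [e1, h0]
  have e11 : s3.reg 11 = s.reg 4 + s.reg 9 + 1 := by
    rw [hs3]; simp [b1 4 (by norm_num), b1 9 (by norm_num), b1 1 (by norm_num), h1]
  clear hs3
  refine Does.seq (Does.lookup (by norm_num) (by rw [b3 1 (by norm_num), h1])) ?_
  rintro s4 ⟨m4, b4, e4⟩
  rw [b3 0 (by norm_num), b3 3 (by norm_num), h0, m3, e11] at e4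
  -- Only the row index governs the length of this loop, so only the first entry needs a bound.
  refine Does.seq (Does.address (N := N) (by norm_num) (by norm_num)
    (by rw [b4 1 (by norm_num), b3 1 (by norm_num), h1]) ?_) ?_
  · rw [b4 10 (by norm_num), e10]
    exact (cyclicEntry_lt hm hx).le
  rintro s5 ⟨m5, b5, e5⟩
  rw [b4 0 (by norm_num), b4 10 (by norm_num), b3 0 (by norm_num), h0, e10, e4] at e5
  have b5' : ∀ r < 10, s5.reg r = s.reg r := fun r hr => by
    rw [b5 r (by omega), b4 r (by omega), b3 r hr]
  have m5' : s5.mem = s.mem := by rw [m5, m4, m3]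
  refine Does.seq (Does.load (post := (· = _)) rfl) ?_
  rintro s6 rfl
  refine Does.ifPos (T := 1) (fun h => Does.const ⟨m5', fun r hr h6 => ?_, ?_⟩)
    (fun h => Does.const ⟨m5', fun r hr _ => ?_, ?_⟩)
  · simp [Function.update_of_ne h6, Function.update_of_ne (show r ≠ 13 by omega), b5' r hr]
  · simp [e5, m5'] at h
    simp [Sees, h]
  · simp [Function.update_of_ne (show r ≠ 14 by omega), Function.update_of_ne (show r ≠ 13 by omega),
      b5' r hr]
  · simp [e5, m5'] at h
    simp [Sees, h, b5' 6 (by norm_num)]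

/-- No entry at a position `s + x` with `x < k` sees an entry at a position from `s + k + 1` to
`s + l`. -/
def Blocked (N : ℕ) (m : ℕ → ℕ) (s k l : ℕ) : Prop :=
  k < l ∧ ∀ x < k, ∀ y < l - k,
    ¬ Sees N m (cyclicEntry N m (s + x)) (cyclicEntry N m (s + (k + y + 1)))

theorem Does.check (h0 : s.reg 0 = N) (h1 : s.reg 1 = 1) (hm : ∀ p < N, s.mem p < N)
    (h3 : s.reg 3 < N) (h4 : s.reg 4 < N) (h5 : s.reg 5 < N) :
    Does RamProgram.check (2 + (N * ((N * (3 * N + 24) + 3) + 2) + 3)) s fun s' => s'.mem = s.mem ∧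
      SameBelow 6 s s' ∧ (s'.reg 6 ≠ 0 ↔ Blocked N s.mem (s.reg 3) (s.reg 4) (s.reg 5)) := by
  refine Does.weaken (T₁ := 1 + (1 + (N * ((N * (3 * N + 24) + 3) + 2) + 3))) ?_ (by omega)
    fun _ h => h
  refine Does.seq (Does.sub (post := (· = _)) rfl) ?_
  rintro s1 rfl
  refine Does.seq (Does.sub (post := (· = _)) rfl) ?_
  rintro s2 hs2
  have m2 : s2.mem = s.mem := by rw [hs2]
  have b2 : ∀ r < 6, s2.reg r = s.reg r := by
    intro r hr
    rw [hs2]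
    simp [Function.update_of_ne (show r ≠ 6 by omega), Function.update_of_ne (show r ≠ 7 by omega)]
  have e6 : s2.reg 6 = s.reg 5 - s.reg 4 := by rw [hs2]; simp
  have e7 : s2.reg 7 = s.reg 5 - s.reg 4 := by rw [hs2]; simp
  clear hs2
  -- The flag starts as `reg 5 - reg 4`, nonzero exactly if the first condition of `Blocked` holds,
  -- and from then on it can only be cleared; the positions from `j` upwards have been checked.
  let Inv : ℕ → RamState → Prop := fun j s' => s'.mem = s2.mem ∧
    (∀ r < 8, r ≠ 6 → s'.reg r = s2.reg r) ∧ (s'.reg 6 ≠ 0 ↔ s2.reg 6 ≠ 0 ∧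
      ∀ x, j ≤ x → x < s2.reg 4 → ∀ y < s2.reg 7,
        ¬ Sees N s.mem (cyclicEntry N s.mem (s2.reg 3 + x))
          (cyclicEntry N s.mem (s2.reg 3 + (s2.reg 4 + y + 1))))
  have key := Does.countDown (s := s2) (v := 8) (b := 4) (T₂ := N) (T := N * (3 * N + 24) + 3)
    (p := RamProgram.countDown 9 7 RamProgram.checkPair) Inv (by norm_num) ?_ rfl
    (by rw [b2 4 (by norm_num)]; exact h4.le) ?_ ?_ ?_
  · refine key.weaken le_rfl ?_
    rintro s' ⟨h6, h7, h8⟩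
    refine ⟨h6.trans m2, fun r hr => by rw [h7 r (by omega) (by omega), b2 r hr], ?_⟩
    rw [h8, e6, e7, b2 4 (by norm_num), b2 3 (by norm_num)]
    unfold Blocked
    refine and_congr (by omega) ⟨fun h x => h x (Nat.zero_le _), fun h x _ => h x⟩
  · rintro j s' ⟨-, h7, -⟩
    rw [h7 1 (by norm_num) (by norm_num), b2 1 (by norm_num), h1]
  · intro s' h6 h7
    refine ⟨h6, fun r hr _ => h7 r (by omega), ?_⟩
    rw [h7 6 (by norm_num)]
    exact ⟨fun h => ⟨h, fun x hx hx' => by omega⟩, fun h => h.1⟩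
  · rintro j s' s'' ⟨h6, h7, h8⟩ h9 h10
    exact ⟨h9.trans h6, fun r hr hr' => by rw [h10 r (by omega), h7 r hr hr'], by
      rw [h10 6 (by norm_num), h8]⟩
  · rintro j s3 hj ⟨h6, h7, h8⟩ h9
    let Inv' : ℕ → RamState → Prop := fun i s' => s'.mem = s3.mem ∧
      (∀ r < 9, r ≠ 6 → s'.reg r = s3.reg r) ∧ (s'.reg 6 ≠ 0 ↔ s3.reg 6 ≠ 0 ∧
        ∀ y, i ≤ y → y < s2.reg 7 →
          ¬ Sees N s.mem (cyclicEntry N s.mem (s2.reg 3 + j))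
            (cyclicEntry N s.mem (s2.reg 3 + (s2.reg 4 + y + 1))))
    have key' := Does.countDown (s := s3) (v := 9) (b := 7) (T₂ := N) (T := 3 * N + 22)
      (p := RamProgram.checkPair) Inv' (by norm_num) ?_ (h7 7 (by norm_num) (by norm_num))
      (by rw [e7]; omega) ?_ ?_ ?_
    · refine key'.weaken le_rfl ?_
      rintro s' ⟨h10, h11, h12⟩
      refine ⟨⟨h10.trans h6, fun r hr hr' => by rw [h11 r (by omega) hr', h7 r hr hr'], ?_⟩, by
        rw [h11 8 (by norm_num) (by norm_num), h9]⟩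
      rw [h12, h8]
      constructor
      · rintro ⟨⟨h13, h14⟩, h15⟩
        refine ⟨h13, fun x hx hx' y hy => ?_⟩
        rcases eq_or_lt_of_le hx with rfl | hx
        · exact h15 y (Nat.zero_le _) hy
        · exact h14 x hx hx' y hy
      · rintro ⟨h13, h14⟩
        exact ⟨⟨h13, fun x hx => h14 x (by omega)⟩, fun y _ => h14 j le_rfl hj y⟩
    · rintro i s' ⟨-, h11, -⟩
      rw [h11 1 (by norm_num) (by norm_num), h7 1 (by norm_num) (by norm_num), b2 1 (by norm_num), h1]
    · intro s' h10 h11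
      refine ⟨h10, fun r hr _ => h11 r (by omega), ?_⟩
      rw [h11 6 (by norm_num)]
      exact ⟨fun h => ⟨h, fun x hx hx' => by omega⟩, fun h => h.1⟩
    · rintro i s' s'' ⟨h10, h11, h12⟩ h13 h14
      exact ⟨h13.trans h10, fun r hr hr' => by rw [h14 r (by omega), h11 r hr hr'], by
        rw [h14 6 (by norm_num), h12]⟩
    · rintro i s4 hi ⟨h10, h11, h12⟩ h13
      have hmem : s4.mem = s.mem := by rw [h10, h6, m2]
      have hr : ∀ r < 8, r ≠ 6 → s4.reg r = s2.reg r := fun r hr hr' => by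
        rw [h11 r (by omega) hr', h7 r hr hr']
      have hr8 : s4.reg 8 = j := by rw [h11 8 (by norm_num) (by norm_num), h9]
      have hr3 := hr 3 (by norm_num) (by norm_num)
      have hr4 := hr 4 (by norm_num) (by norm_num)
      have h23 := b2 3 (by norm_num)
      have h24 := b2 4 (by norm_num)
      refine (Does.checkPair (N := N) (by rw [hr 0 (by norm_num) (by norm_num), b2 0 (by norm_num), h0])
        (by rw [hr 1 (by norm_num) (by norm_num), b2 1 (by norm_num), h1]) (by rw [hmem]; exact hm)
        (by omega)).weaken le_rfl ?_
      rintro s' ⟨h14, h15, h16⟩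
      refine ⟨⟨h14.trans h10, fun r hr hr' => by rw [h15 r (by omega) hr', h11 r hr hr'], ?_⟩, by
        rw [h15 9 (by norm_num) (by norm_num), h13]⟩
      rw [h16, h12, hmem, hr3, hr4, hr8, h13]
      constructor
      · rintro ⟨⟨h17, h18⟩, h19⟩
        refine ⟨h17, fun y hy hy' => ?_⟩
        rcases eq_or_lt_of_le hy with rfl | hy
        · exact h19
        · exact h18 y hy hy'
      · rintro ⟨h17, h18⟩
        exact ⟨⟨h17, fun y hy => h18 y (by omega)⟩, h18 i le_rfl hi⟩

open Classical in
theorem Does.recordOne {a b : ℕ} (ha : a < 13) (hb : b < 13) (h0 : s.reg 0 = N) (h1 : s.reg 1 = 1)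
    (haN : s.reg a < N) :
    Does (RamProgram.recordOne a b) (6 * N + 12) s fun s' => SameBelow 13 s s' ∧
      s'.mem = if Sees N s.mem (s.reg a) (s.reg 11) then
        Function.update s.mem (s.reg 2 + s.reg b + s.reg a * N) (s.reg 11) else s.mem := by
  refine Does.weaken (T₁ := (3 * N + 4) + (1 + (((3 * N + 4) + 1) + 1))) ?_ (by omega) fun _ h => h
  refine Does.seq (Does.address (N := N) ha (by norm_num) h1 haN.le) ?_
  rintro s1 ⟨m1, b1, e1⟩
  refine Does.seq (Does.load (post := (· = _)) rfl) ?_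
  rintro s2 hs2
  have m2 : s2.mem = s.mem := by rw [hs2, m1]
  have b2 : ∀ r < 13, s2.reg r = s.reg r := by
    intro r hr
    rw [hs2, ← b1 r hr]
    simp [Function.update_of_ne (show r ≠ 13 by omega)]
  have e13 : s2.reg 13 = s.mem (N + s.reg 11 + s.reg a * N) := by
    rw [hs2]; simp [e1, m1, h0]
  clear hs2
  refine Does.ifPos (T := (3 * N + 4) + 1) (fun h => ?_) (fun h => ?_)
  · rw [e13] at h
    have hS : Sees N s.mem (s.reg a) (s.reg 11) := h
    simp only [if_pos hS]
    refine Does.seq (T₁ := 3 * N + 4) (Does.address (N := N) (a := 2) (u := a) (v := b) (e := 14) (by omega) (by norm_num)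
      (by rw [b2 1 (by norm_num), h1]) (by rw [b2 a ha]; exact haN.le)) ?_
    rintro s3 ⟨m3, b3, e3⟩
    refine Does.store ⟨fun r hr => ?_, ?_⟩
    · simp [b3 r (by omega), b2 r hr]
    · simp only [e3, m3, m2, b3 11 (by norm_num), b2 11 (by norm_num), b2 a ha, b2 b hb,
        b2 2 (by norm_num), b2 0 (by norm_num), h0]
  · rw [e13] at h
    have hS : ¬ Sees N s.mem (s.reg a) (s.reg 11) := by simp [Sees, h]
    simp only [if_neg hS]
    refine Does.weaken (T₁ := 1) (Does.const (post := (· = _)) rfl) (by omega) ?_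
    rintro _ rfl
    refine ⟨fun r hr => ?_, m2⟩
    simp [Function.update_of_ne (show r ≠ 14 by omega), b2 r hr]

/-- For the triple of positions `(s, k, l)`, the value `o` may be written into the cell `(a, b)`. -/
def MayWrite (N : ℕ) (m : ℕ → ℕ) (s k l a b o : ℕ) : Prop :=
  Blocked N m s k l ∧ o = cyclicEntry N m (s + k) ∧ Sees N m a o ∧
    ((a = m s ∧ b = cyclicEntry N m (s + l)) ∨ (a = cyclicEntry N m (s + l) ∧ b = m s))

/-- The value `o` may be written into the cell `(a, b)`, for some triple of positions. -/
def Valid (N : ℕ) (m : ℕ → ℕ) (a b o : ℕ) : Prop :=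
  ∃ i < N, ∃ k < N, ∃ l < N, MayWrite N m i k l a b o

/-- The state of the machine, with the initial memory `m`, when the cells `(a, b)` of the output with
`D a b` have been filled. -/
structure Progress (N : ℕ) (m : ℕ → ℕ) (D : ℕ → ℕ → Prop) (s : RamState) : Prop where
  reg0 : s.reg 0 = N
  reg1 : s.reg 1 = 1
  reg2 : s.reg 2 = N + N * N
  input : ∀ x < N + N * N, s.mem x = m x
  output : ∀ a < N, ∀ b < N, D a b → Valid N m a b (s.mem (N + N * N + b + a * N))

/-- Division with remainder by `N`. -/
theorem cell_inj {a b a' b' : ℕ} (hb : b < N) (hb' : b' < N)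
    (h : N + N * N + b + a * N = N + N * N + b' + a' * N) : a = a' ∧ b = b' := by
  have h1 : b + a * N = b' + a' * N := by omega
  have hN : 0 < N := by omega
  have h2 := congrArg (· % N) h1
  have h3 := congrArg (· / N) h1
  simp only [Nat.add_mul_mod_self_right, Nat.mod_eq_of_lt hb, Nat.mod_eq_of_lt hb',
    Nat.add_mul_div_right _ _ hN, Nat.div_eq_of_lt hb, Nat.div_eq_of_lt hb', zero_add] at h2 h3
  exact ⟨h3, h2⟩

variable {m : ℕ → ℕ} {D : ℕ → ℕ → Prop}

theorem Progress.congr {s' : RamState} (h : Progress N m D s)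
    (hmem : s'.mem = s.mem) (hreg : ∀ r < 3, s'.reg r = s.reg r) : Progress N m D s' :=
  ⟨by rw [hreg 0 (by norm_num), h.reg0], by rw [hreg 1 (by norm_num), h.reg1],
    by rw [hreg 2 (by norm_num), h.reg2], by rw [hmem]; exact h.input, by rw [hmem]; exact h.output⟩

theorem Progress.mono {D' : ℕ → ℕ → Prop} (h : Progress N m D s)
    (hD : ∀ a < N, ∀ b < N, D' a b → D a b) : Progress N m D' s :=
  ⟨h.reg0, h.reg1, h.reg2, h.input, fun a ha b hb hab => h.output a ha b hb (hD a ha b hb hab)⟩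

theorem Progress.sees_iff (h : Progress N m D s) {a b : ℕ} (ha : a < N) (hb : b < N) :
    Sees N s.mem a b ↔ Sees N m a b := by
  unfold Sees
  rw [h.input]
  have := Nat.mul_le_mul_right N (show a + 1 ≤ N from ha)
  rw [add_mul, one_mul] at this
  omega

theorem Progress.cyclicEntry_eq (h : Progress N m D s) {t : ℕ} (ht : t < 2 * N) :
    cyclicEntry N s.mem t = cyclicEntry N m t := by
  unfold cyclicEntry
  refine h.input _ ?_
  split_ifs <;> omega

theorem Progress.blocked_iff (h : Progress N m D s) (hm : ∀ p < N, m p < N) {i k l : ℕ} (hi : i < N)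
    (_ : k < N) (hl : l < N) : Blocked N s.mem i k l ↔ Blocked N m i k l := by
  unfold Blocked
  refine and_congr_right fun _ => forall₂_congr fun x hx => forall₂_congr fun y hy => not_congr ?_
  rw [h.cyclicEntry_eq (by omega), h.cyclicEntry_eq (by omega)]
  exact h.sees_iff (cyclicEntry_lt hm (by omega)) (cyclicEntry_lt hm (by omega))

/-- A cell may be overwritten, but only by another valid value, so cells filled earlier remain
valid. The output lies behind the input, which stays intact. -/
theorem Progress.recordOne (h : Progress N m D s) {a b : ℕ} (ha : a < 13) (hb : b < 13)
    (haN : s.reg a < N) (hbN : s.reg b < N) (h11 : s.reg 11 < N)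
    (hv : Sees N m (s.reg a) (s.reg 11) → Valid N m (s.reg a) (s.reg b) (s.reg 11)) :
    Does (RamProgram.recordOne a b) (6 * N + 12) s fun s' => SameBelow 13 s s' ∧
      Progress N m (fun x y => D x y ∨ (x = s.reg a ∧ y = s.reg b ∧ Sees N m x (s.reg 11))) s' := by
  refine (Does.recordOne ha hb h.reg0 h.reg1 haN).weaken le_rfl ?_
  rintro s' ⟨hr, hmem⟩
  refine ⟨hr, ?_⟩
  have hs := h.sees_iff haN h11
  split_ifs at hmem with hS
  · rw [hs] at hS
    rw [h.reg2] at hmem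
    refine ⟨by rw [hr 0 (by norm_num), h.reg0], by rw [hr 1 (by norm_num), h.reg1],
      by rw [hr 2 (by norm_num), h.reg2], fun x hx => ?_, fun x hx y hy hD => ?_⟩
    · rw [hmem, Function.update_of_ne (by omega), h.input x hx]
    · by_cases he : N + N * N + y + x * N = N + N * N + s.reg b + s.reg a * N
      · obtain ⟨rfl, rfl⟩ := cell_inj hy hbN he
        rw [hmem, Function.update_self]
        exact hv hS
      · rw [hmem, Function.update_of_ne he]
        refine h.output x hx y hy (hD.resolve_right ?_)
        rintro ⟨rfl, rfl, -⟩
        exact he rfl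
  · rw [hs] at hS
    refine (h.congr hmem fun r h3 => hr r (by omega)).mono ?_
    rintro x - y - (hD | ⟨rfl, rfl, hD⟩)
    · exact hD
    · exact absurd hD hS

/-- Blocking is symmetric under exchange of the pair together with reversal of the walk, so one
triple serves both orders of the pair; each is recorded only if its first vertex sees the candidate.
-/
theorem Progress.record (h : Progress N m D s) (hm : ∀ p < N, m p < N)
    (h3 : s.reg 3 < N) (h4 : s.reg 4 < N) (h5 : s.reg 5 < N)
    (hB : Blocked N m (s.reg 3) (s.reg 4) (s.reg 5)) :
    Does RamProgram.record (12 * N + 37) s fun s' => SameBelow 6 s s' ∧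
      Progress N m (fun x y => D x y ∨ ∃ o, MayWrite N m (s.reg 3) (s.reg 4) (s.reg 5) x y o) s' := by
  refine Does.weaken (T₁ := 1 + (6 + (6 + ((6 * N + 12) + (6 * N + 12))))) ?_ (by omega) fun _ h => h
  refine Does.seq (Does.load (post := (· = _)) rfl) ?_
  rintro s1 hs1
  have m1 : s1.mem = s.mem := by rw [hs1]
  have b1 : ∀ r < 10, s1.reg r = s.reg r := fun r hr => by
    rw [hs1]; simp [Function.update_of_ne (show r ≠ 10 by omega)]
  have e10 : s1.reg 10 = m (s.reg 3) := by
    rw [hs1]; simp [h.input (s.reg 3) (by omega)]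
  clear hs1
  refine Does.seq (Does.lookup (by norm_num) (by rw [b1 1 (by norm_num), h.reg1])) ?_
  rintro s2 ⟨m2, b2, e11⟩
  rw [b1 0 (by norm_num), b1 3 (by norm_num), b1 4 (by norm_num), m1, h.reg0,
    h.cyclicEntry_eq (by omega)] at e11
  refine Does.seq (Does.lookup (by norm_num) (by rw [b2 1 (by norm_num), b1 1 (by norm_num), h.reg1])) ?_
  rintro s3 ⟨m3', b3, e12⟩
  rw [b2 0 (by norm_num), b2 3 (by norm_num), b2 5 (by norm_num), b1 0 (by norm_num),
    b1 3 (by norm_num), b1 5 (by norm_num), m2, m1, h.reg0, h.cyclicEntry_eq (by omega)] at e12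
  have m3 : s3.mem = s.mem := by rw [m3', m2, m1]
  have b3' : ∀ r < 10, s3.reg r = s.reg r := fun r hr => by
    rw [b3 r (by omega), b2 r (by omega), b1 r hr]
  have e10' : s3.reg 10 = m (s.reg 3) := by rw [b3 10 (by norm_num), b2 10 (by norm_num), e10]
  have e11' : s3.reg 11 = cyclicEntry N m (s.reg 3 + s.reg 4) := by rw [b3 11 (by norm_num), e11]
  have l10 := hm _ h3
  have l11 := cyclicEntry_lt hm (show s.reg 3 + s.reg 4 < 2 * N by omega)
  have l12 := cyclicEntry_lt hm (show s.reg 3 + s.reg 5 < 2 * N by omega)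
  refine Does.seq (Progress.recordOne (h.congr m3 fun r hr => b3' r (by omega)) (by norm_num) (by norm_num)
    (by rwa [e10']) (by rwa [e12]) (by rwa [e11']) fun hS => ?_) ?_
  · rw [e10', e11'] at hS
    rw [e10', e11', e12]
    exact ⟨_, h3, _, h4, _, h5, hB, rfl, hS, Or.inl ⟨rfl, rfl⟩⟩
  rintro s4 ⟨b4, h'⟩
  have e10'' := (b4 10 (by norm_num)).trans e10'
  have e11'' := (b4 11 (by norm_num)).trans e11'
  have e12'' := (b4 12 (by norm_num)).trans e12
  refine (Progress.recordOne h' (by norm_num) (by norm_num)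
    (by rwa [e12'']) (by rwa [e10'']) (by rwa [e11'']) fun hS => ?_).weaken le_rfl ?_
  · rw [e12'', e11''] at hS
    rw [e10'', e11'', e12'']
    exact ⟨_, h3, _, h4, _, h5, hB, rfl, hS, Or.inr ⟨rfl, rfl⟩⟩
  · rintro s5 ⟨b5, h''⟩
    refine ⟨fun r hr => by rw [b5 r (by omega), b4 r (by omega), b3' r (by omega)], h''.mono ?_⟩
    rintro x - y - (hD | ⟨o, -, rfl, hS, ⟨rfl, rfl⟩ | ⟨rfl, rfl⟩⟩)
    · exact Or.inl (Or.inl hD)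
    · exact Or.inl (Or.inr ⟨e10'.symm, e12.symm, by rwa [e11']⟩)
    · exact Or.inr ⟨e12''.symm, e10''.symm, by rwa [e11'']⟩

theorem Progress.treat (h : Progress N m D s) (hm : ∀ p < N, m p < N)
    (h3 : s.reg 3 < N) (h4 : s.reg 4 < N) (h5 : s.reg 5 < N) :
    Does RamProgram.treat (2 + (N * ((N * (3 * N + 24) + 3) + 2) + 3) + (12 * N + 37 + 1)) s fun s' =>
      Progress N m (fun x y => D x y ∨ ∃ o, MayWrite N m (s.reg 3) (s.reg 4) (s.reg 5) x y o) s' ∧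
        SameBelow 6 s s' := by
  refine Does.seq (Does.check h.reg0 h.reg1 (fun p hp => by rw [h.input p (by omega)]; exact hm p hp)
    h3 h4 h5) ?_
  rintro s1 ⟨m1, b1, e1⟩
  rw [h.blocked_iff hm h3 h4 h5] at e1
  have h' := h.congr m1 fun r hr => b1 r (by omega)
  refine Does.ifPos (fun h6 => ?_) fun h6 => ?_
  · have := Progress.record h' hm
    rw [b1 3 (by norm_num), b1 4 (by norm_num), b1 5 (by norm_num)] at this
    refine (this h3 h4 h5 (e1.1 h6)).weaken le_rfl ?_
    rintro s2 ⟨b2, h2⟩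
    exact ⟨h2, fun r hr => by rw [b2 r hr, b1 r hr]⟩
  · refine Does.weaken (T₁ := 1) (Does.const (post := (· = _)) rfl) (by omega) ?_
    rintro _ rfl
    have h'' : Progress N m D { s1 with reg := Function.update s1.reg 14 0 } :=
      h'.congr rfl fun r hr => by simp [Function.update_of_ne (show r ≠ 14 by omega)]
    refine ⟨h''.mono ?_, fun r hr => ?_⟩
    · rintro x - y - (hD | ⟨o, hB, -⟩)
      · exact hD
      · exact absurd h6 (e1.2 hB)
    · simp [Function.update_of_ne (show r ≠ 14 by omega), b1 r hr]

/-- A loop over all positions. -/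
theorem Progress.countDown {v : ℕ} {p : RamProgram} (hv : 3 ≤ v) (E : ℕ → ℕ → ℕ → Prop)
    (h : Progress N m D s)
    (hbody : ∀ j < N, ∀ D s', Progress N m D s' → SameBelow v s s' → s'.reg v = j →
      Does p T s' fun s'' => Progress N m (fun x y => D x y ∨ E j x y) s'' ∧ SameBelow (v + 1) s' s'') :
    Does (RamProgram.countDown v 0 p) (N * (T + 2) + 3) s fun s' =>
      Progress N m (fun x y => D x y ∨ ∃ j < N, E j x y) s' ∧ SameBelow v s s' := by
  have key := Does.countDown (s := s) (v := v) (b := 0) (T₂ := N) (T := T) (p := p)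
    (fun j s' => Progress N m (fun x y => D x y ∨ ∃ i < N, j ≤ i ∧ E i x y) s' ∧ SameBelow v s s')
    (by omega) (fun j s' h' => h'.1.reg1) h.reg0 le_rfl ?_ ?_ ?_
  · refine key.weaken le_rfl ?_
    rintro s' ⟨h1, h2⟩
    refine ⟨h1.mono ?_, h2⟩
    rintro x - y - (hD | ⟨j, hj, hE⟩)
    · exact Or.inl hD
    · exact Or.inr ⟨j, hj, Nat.zero_le _, hE⟩
  · intro s' h1 h2
    refine ⟨(h.congr h1 fun r hr => h2 r (by omega)).mono ?_, fun r hr => h2 r (by omega)⟩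
    rintro x - y - (hD | ⟨j, hj, hj', -⟩)
    · exact hD
    · omega
  · rintro j s' s'' ⟨h1, h2⟩ h3 h4
    exact ⟨h1.congr h3 fun r hr => h4 r (by omega), fun r hr => by rw [h4 r (by omega), h2 r hr]⟩
  · rintro j s' hj ⟨h1, h2⟩ h3
    refine (hbody j hj _ s' h1 h2 h3).weaken le_rfl ?_
    rintro s'' ⟨h4, h5⟩
    refine ⟨⟨h4.mono ?_, fun r hr => by rw [h5 r (by omega), h2 r hr]⟩, by rw [h5 v (by omega), h3]⟩
    rintro x - y - (hD | ⟨i, hi, hi', hE⟩)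
    · exact Or.inl (Or.inl hD)
    · rcases eq_or_lt_of_le hi' with rfl | hi'
      · exact Or.inr hE
      · exact Or.inl (Or.inr ⟨i, hi, hi', hE⟩)

open Polynomial in
/-- A bound for the running time of `blockingProgram`. -/
noncomputable def timeBound : ℕ[X] :=
  1 + ((3 * X + 4) + (X * ((X * ((X * ((2 + (X * ((X * (3 * X + 24) + 3) + 2) + 3) + (12 * X + 37 + 1)) +
    2) + 3) + 2) + 3) + 2) + 3))

theorem Does.blockingProgram (h0 : s.reg 0 = N) (h3 : s.reg 3 = 0) (hm : ∀ p < N, s.mem p < N) :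
    Does RamProgram.blockingProgram (timeBound.eval N) s fun s' => ∀ a < N, ∀ b < N,
      (∃ o, Valid N s.mem a b o) → Valid N s.mem a b (s'.mem (N + N * N + b + a * N)) := by
  refine Does.weaken (T₁ := 1 + ((3 * N + 4) + (N * ((N * ((N * ((2 + (N * ((N * (3 * N + 24) + 3) + 2) +
    3) + (12 * N + 37 + 1)) + 2) + 3) + 2) + 3) + 2) + 3))) ?_ (le_of_eq (by simp [timeBound]))
    fun _ h => h
  refine Does.seq (Does.const (post := (· = _)) rfl) ?_
  rintro s1 hs1
  have m1 : s1.mem = s.mem := by rw [hs1]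
  have b1 : ∀ r, r ≠ 1 → s1.reg r = s.reg r := fun r hr => by rw [hs1]; simp [hr]
  have e1 : s1.reg 1 = 1 := by rw [hs1]; simp
  clear hs1
  -- Register `3` still holds `0`, so register `2` receives `N + N * N`, the first cell of the
  -- output.
  refine Does.seq (Does.address (N := N) (a := 0) (u := 0) (v := 3) (e := 2) (by norm_num) (by norm_num) e1
    (by rw [b1 0 (by norm_num), h0])) ?_
  rintro s2 ⟨m2, b2, e2⟩
  rw [b1 0 (by norm_num), b1 3 (by norm_num), h0, h3] at e2
  have hP : Progress N s.mem (fun _ _ => False) s2 :=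
    ⟨by rw [b2 0 (by norm_num), b1 0 (by norm_num), h0], by rw [b2 1 (by norm_num), e1], e2,
      fun x _ => by rw [m2, m1], fun a _ b _ h => h.elim⟩
  refine (hP.countDown (v := 3) le_rfl
    (fun i x y => ∃ k < N, ∃ l < N, ∃ o, MayWrite N s.mem i k l x y o) fun i hi D s3 hP3 _ e3 =>
    (hP3.countDown (v := 4) (by norm_num)
      (fun k x y => ∃ l < N, ∃ o, MayWrite N s.mem i k l x y o) fun k hk D s4 hP4 b4 e4 =>
      (hP4.countDown (v := 5) (by norm_num)
        (fun l x y => ∃ o, MayWrite N s.mem i k l x y o) fun l hl D s5 hP5 b5 e5 => ?_))).weaken le_rfl ?_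
  · have e3' : s5.reg 3 = i := by rw [b5 3 (by norm_num), b4 3 (by norm_num), e3]
    have e4' : s5.reg 4 = k := by rw [b5 4 (by norm_num), e4]
    have := hP5.treat hm
    rw [e3', e4', e5] at this
    exact this hi hk hl
  · rintro s' ⟨hP', -⟩ a ha b hb ⟨o, i, hi, k, hk, l, hl, ho⟩
    exact hP'.output a ha b hb (Or.inr ⟨i, hi, k, hk, l, hl, o, ho⟩)

end RamProgram

/-! ## The program on the initial state -/

/-- The numbers `k` and `l` are the positions of `o` and `q`; the lists `A`, `B`, `C` are what
remains between the three marked entries. -/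
theorem exists_split_iff {α : Type*} (L : List α) (p o q : α) (R : α → α → Prop) :
    (∃ A B C : List α, L = p :: A ++ o :: (B ++ q :: C) ∧ ∀ x ∈ p :: A, ∀ y ∈ B ++ [q], R x y) ↔
      ∃ k l, 0 < k ∧ k < l ∧ L[0]? = some p ∧ L[k]? = some o ∧ L[l]? = some q ∧
        ∀ x < k, ∀ y < l - k, ∀ u v, L[x]? = some u → L[k + y + 1]? = some v → R u v := by
  constructor
  · rintro ⟨A, B, C, rfl, h⟩
    refine ⟨A.length + 1, A.length + 1 + (B.length + 1), by omega, by omega, by simp, by simp, ?_, ?_⟩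
    · rw [List.getElem?_append_right (by simp)]
      simp [show A.length + 1 + (B.length + 1) - (A.length + 1) = B.length + 1 by omega]
    · intro x hx y hy u v hu hv
      refine h u ?_ v ?_
      · rw [List.getElem?_append_left (by simpa using hx)] at hu
        exact List.mem_of_getElem? hu
      · rw [List.getElem?_append_right (by simp; omega)] at hv
        have e : A.length + 1 + y + 1 - (p :: A).length = y + 1 := by simp; omega
        rw [e, List.getElem?_cons_succ, show B ++ q :: C = B ++ [q] ++ C by simp,
          List.getElem?_append_left (by simp; omega)] at hv
        exact List.mem_of_getElem? hv
  · rintro ⟨k, l, hk, hkl, hp, ho, hq, h⟩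
    obtain ⟨hp', hp⟩ := List.getElem?_eq_some_iff.1 hp
    obtain ⟨ho', ho⟩ := List.getElem?_eq_some_iff.1 ho
    obtain ⟨hq', hq⟩ := List.getElem?_eq_some_iff.1 hq
    have e1 : L.take k = p :: (L.take k).tail := by
      conv_lhs => rw [← List.cons_head_tail (l := L.take k) (by
        rw [← List.length_pos_iff]; simp; omega)]
      simp [List.head_eq_getElem, hp]
    have e2 : L.drop k = o :: L.drop (k + 1) := by rw [List.drop_eq_getElem_cons ho', ho]
    have e3 : L.drop (k + 1) = (L.drop (k + 1)).take (l - k - 1) ++ q :: L.drop (l + 1) := by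
      conv_lhs => rw [← List.take_append_drop (l - k - 1) (L.drop (k + 1))]
      rw [List.drop_drop, show k + 1 + (l - k - 1) = l by omega, List.drop_eq_getElem_cons hq', hq]
    have e4 : (L.drop (k + 1)).take (l - k) = (L.drop (k + 1)).take (l - k - 1) ++ [q] := by
      rw [show l - k = l - k - 1 + 1 by omega, List.take_add_one]
      simp [show k + 1 + (l - k - 1) = l by omega, hq', hq]
    refine ⟨(L.take k).tail, (L.drop (k + 1)).take (l - k - 1), L.drop (l + 1), ?_, ?_⟩
    · rw [← e1, ← e3, ← e2, List.take_append_drop]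
    · rw [← e1, ← e4]
      intro u hu v hv
      obtain ⟨x, hx, rfl⟩ := List.mem_iff_getElem.1 hu
      obtain ⟨y, hy, rfl⟩ := List.mem_iff_getElem.1 hv
      simp only [List.length_take, List.length_drop, lt_min_iff] at hx hy
      refine h x hx.1 y hy.1 _ _ ?_ ?_
      · rw [List.getElem_take, List.getElem?_eq_getElem]
      · rw [List.getElem_take, List.getElem_drop, List.getElem?_eq_some_iff]
        refine ⟨by omega, ?_⟩
        congr 1
        omega

/-- Lists representing the same cycle are rotations of each other, so the decomposition is sought in
the rotations of the given list, which reduces it to a search over finitely many positions. -/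
theorem blocksAlong_coe_iff {V : Type*} (G : SimpleGraph V) (c : List V) (p q o : V) :
    BlocksAlong G (c : Cycle V) p q o ↔ ∃ i < c.length, ∃ k l, 0 < k ∧ k < l ∧
      (c.rotate i)[0]? = some p ∧ (c.rotate i)[k]? = some o ∧ (c.rotate i)[l]? = some q ∧
        ∀ x < k, ∀ y < l - k, ∀ u v, (c.rotate i)[x]? = some u → (c.rotate i)[k + y + 1]? = some v →
          ¬ G.Adj u v := by
  unfold BlocksAlong
  constructor
  · rintro ⟨A, B, C, h1, h2⟩
    obtain ⟨i, hi⟩ := Cycle.coe_eq_coe.1 h1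
    have hc : 0 < c.length := by
      rw [← List.length_rotate c i, hi]; simp
    refine ⟨i % c.length, Nat.mod_lt _ hc, ?_⟩
    rw [← exists_split_iff _ _ _ _ fun u v => ¬ G.Adj u v]
    exact ⟨A, B, C, by rw [List.rotate_mod, hi], h2⟩
  · rintro ⟨i, -, h⟩
    rw [← exists_split_iff _ _ _ _ fun u v => ¬ G.Adj u v] at h
    obtain ⟨A, B, C, h1, h2⟩ := h
    exact ⟨A, B, C, by rw [← h1, Cycle.coe_eq_coe]; exact ⟨i, rfl⟩, h2⟩

section Input

variable {N : ℕ} {G : SimpleGraph (Fin N)} {c : List (Fin N)}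

theorem inputState_mem_list (hc : c.length = N) {p : ℕ} (hp : p < N) :
    (inputState G c).mem p = (c.get ⟨p, hp.trans_eq hc.symm⟩).val := by
  simp [inputState, hp, hc]

theorem inputState_sees (a b : Fin N) :
    RamProgram.Sees N (inputState G c).mem a b ↔ G.Adj a b := by
  have hN : 0 < N := a.pos
  have e1 : (N + b.val + a.val * N - N) / N = a.val := by
    rw [Nat.add_assoc, Nat.add_sub_cancel_left, Nat.add_mul_div_right _ _ hN, Nat.div_eq_of_lt b.2, zero_add]
  have e2 : (N + b.val + a.val * N - N) % N = b.val := by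
    rw [Nat.add_assoc, Nat.add_sub_cancel_left, Nat.add_mul_mod_self_right, Nat.mod_eq_of_lt b.2]
  simp [RamProgram.Sees, inputState, show ¬ N + b.val + a.val * N < N by omega, e1, e2, Fin.val_inj]

theorem inputState_cyclicEntry (hc : c.length = N) {i t : ℕ} (hi : i < N) (ht : t < N) (v : Fin N) :
    (c.rotate i)[t]? = some v ↔ RamProgram.cyclicEntry N (inputState G c).mem (i + t) = v.val := by
  have e : (if i + t < N then i + t else i + t - N) = (t + i) % N := by
    split_ifs with h
    · rw [add_comm, Nat.mod_eq_of_lt (by omega)]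
    · rw [add_comm, Nat.mod_eq_sub_mod (by omega), Nat.mod_eq_of_lt (by omega)]
  have hlt : (t + i) % N < N := Nat.mod_lt _ (by omega)
  rw [RamProgram.cyclicEntry, e, inputState_mem_list hc hlt, Fin.val_inj,
    List.getElem?_rotate (by omega), List.getElem?_eq_some_iff]
  simp [hc, hlt]

theorem inputState_mem_lt (hc : c.length = N) : ∀ p < N, (inputState G c).mem p < N := by
  intro p hp
  rw [inputState_mem_list hc hp]
  exact Fin.is_lt _

theorem blocksAlong_iff_blocked (hc : c.length = N) (p q o : Fin N) :
    BlocksAlong G (c : Cycle (Fin N)) p q o ↔ ∃ i < N, ∃ k < N, ∃ l < N, 0 < k ∧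
      RamProgram.Blocked N (inputState G c).mem i k l ∧ p.val = (inputState G c).mem i ∧
        o.val = RamProgram.cyclicEntry N (inputState G c).mem (i + k) ∧
        q.val = RamProgram.cyclicEntry N (inputState G c).mem (i + l) := by
  rw [blocksAlong_coe_iff, hc]
  refine exists_congr fun i => and_congr_right fun hi => ?_
  have h0 : RamProgram.cyclicEntry N (inputState G c).mem (i + 0) = (inputState G c).mem i := by
    simp [RamProgram.cyclicEntry, hi]
  have hex : ∀ t < N, ∃ u : Fin N, RamProgram.cyclicEntry N (inputState G c).mem (i + t) = u.val :=
    fun t ht => ⟨⟨_, RamProgram.cyclicEntry_lt (inputState_mem_lt hc) (by omega)⟩, rfl⟩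
  constructor
  · rintro ⟨k, l, hk, hkl, hp, ho, hq, h⟩
    have hl : l < N := by
      obtain ⟨h', -⟩ := List.getElem?_eq_some_iff.1 hq
      simpa [hc] using h'
    rw [inputState_cyclicEntry (G := G) hc hi (by omega)] at hp ho hq
    refine ⟨k, by omega, l, hl, hk, ⟨hkl, fun x hx y hy => ?_⟩, ?_, ho.symm, hq.symm⟩
    · obtain ⟨u, hu⟩ := hex x (by omega)
      obtain ⟨v, hv⟩ := hex (k + y + 1) (by omega)
      rw [hu, hv, inputState_sees]
      exact h x hx y hy u v ((inputState_cyclicEntry hc hi (by omega) u).2 hu)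
        ((inputState_cyclicEntry hc hi (by omega) v).2 hv)
    · rw [← hp, h0]
  · rintro ⟨k, hk, l, hl, hk0, ⟨hkl, h⟩, hp, ho, hq⟩
    refine ⟨k, l, hk0, hkl, ?_, ?_, ?_, fun x hx y hy u v hu hv => ?_⟩
    · rw [inputState_cyclicEntry (G := G) hc hi (by omega), h0, hp]
    · rw [inputState_cyclicEntry (G := G) hc hi (by omega), ho]
    · rw [inputState_cyclicEntry (G := G) hc hi (by omega), hq]
    · rw [inputState_cyclicEntry (G := G) hc hi (by omega)] at hu hv
      have := h x hx y hy
      rwa [hu, hv, inputState_sees] at this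

end Input

/-- Reversing the walk swaps the two blocks of mutually invisible vertices. Thus the program needs
to read the list in one direction only. -/
theorem blocksAlong_reverse {V : Type*} {G : SimpleGraph V} {P : Cycle V} {p q o : V}
    (h : BlocksAlong G P p q o) : BlocksAlong G P.reverse q p o := by
  obtain ⟨A, B, C, rfl, h⟩ := h
  refine ⟨B.reverse, A.reverse, C.reverse, ?_, fun x hx y hy hxy => h y ?_ x ?_ hxy.symm⟩
  · rw [Cycle.reverse_coe]
    have := Cycle.coe_append_comm C.reverse (q :: B.reverse ++ o :: (A.reverse ++ [p]))
    simpa using this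
  · simpa [or_comm] using hy
  · simpa [or_comm] using hx

theorem isBlockingVertex_iff {V : Type*} {G : SimpleGraph V} {P : Cycle V} {p q o : V} :
    IsBlockingVertex G P p q o ↔ BlocksAlong G P p q o ∨ BlocksAlong G P q p o :=
  or_congr_right ⟨fun h => by simpa using blocksAlong_reverse h, blocksAlong_reverse⟩

theorem valid_inputState_iff {N : ℕ} {G : SimpleGraph (Fin N)} {c : List (Fin N)} (hc : c.length = N)
    {a b : Fin N} (hab : ¬ G.Adj a b) (o : Fin N) :
    RamProgram.Valid N (inputState G c).mem a b o ↔
      G.Adj a o ∧ IsBlockingVertex G (c : Cycle (Fin N)) a b o := by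
  rw [isBlockingVertex_iff, blocksAlong_iff_blocked hc, blocksAlong_iff_blocked hc]
  constructor
  · rintro ⟨i, hi, k, hk, l, hl, hB, ho, hS, h⟩
    rw [inputState_sees] at hS
    refine ⟨hS, ?_⟩
    -- `Blocked` admits `k = 0`, where the candidate is the starting point itself. Then `a` would
    -- see itself or `b`, and both are impossible.
    have hk0 : 0 < k := by
      by_contra hk0
      obtain rfl : k = 0 := by omega
      have h0 : RamProgram.cyclicEntry N (inputState G c).mem (i + 0) = (inputState G c).mem i := by
        simp [RamProgram.cyclicEntry, hi]
      rw [h0] at ho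
      rcases h with ⟨h, -⟩ | ⟨-, h⟩
      · rw [← ho, Fin.val_inj] at h
        exact hS.ne h
      · rw [← ho, Fin.val_inj] at h
        exact hab (h ▸ hS)
    rcases h with ⟨h1, h2⟩ | ⟨h1, h2⟩
    · exact Or.inl ⟨i, hi, k, hk, l, hl, hk0, hB, h1, ho, h2⟩
    · exact Or.inr ⟨i, hi, k, hk, l, hl, hk0, hB, h2, ho, h1⟩
  · rintro ⟨hS, ⟨i, hi, k, hk, l, hl, -, hB, h1, ho, h2⟩ | ⟨i, hi, k, hk, l, hl, -, hB, h1, ho, h2⟩⟩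
    · exact ⟨i, hi, k, hk, l, hl, hB, ho, (inputState_sees a o).2 hS, Or.inl ⟨h1, h2⟩⟩
    · exact ⟨i, hi, k, hk, l, hl, hB, ho, (inputState_sees a o).2 hS, Or.inr ⟨h2, h1⟩⟩

theorem IsHamiltonianCycle.length_eq {N : ℕ} {G : SimpleGraph (Fin N)} {c : List (Fin N)}
    (h : IsHamiltonianCycle G (c : Cycle (Fin N))) : c.length = N := by
  have h1 : c.Nodup := by simpa using h.1
  have h2 : c.toFinset = Finset.univ := by
    ext v; simpa using h.2.1 v
  rw [← List.toFinset_card_of_nodup h1, h2, Finset.card_univ, Fintype.card_fin]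

/-- The program computes blocking vertices for every graph with a Hamiltonian cycle. -/
theorem blockingProgram_spec {N : ℕ} {G : SimpleGraph (Fin N)} {c : List (Fin N)}
    (h : IsHamiltonianCycle G (c : Cycle (Fin N))) :
    ∃ (t : ℕ) (s : RamState), t ≤ RamProgram.timeBound.eval N ∧
      RamProgram.blockingProgram.Runs (inputState G c) t s ∧ ∀ p : InvisiblePair G,
        (∃ o : Fin N, G.Adj p.1.1 o ∧ IsBlockingVertex G (c : Cycle (Fin N)) p.1.1 p.1.2 o) →
        ∃ o : Fin N, G.Adj p.1.1 o ∧ IsBlockingVertex G (c : Cycle (Fin N)) p.1.1 p.1.2 o ∧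
          s.mem (outputCell p.1.1 p.1.2) = o.val := by
  have hc := h.length_eq
  obtain ⟨t, s, ht, hr, hs⟩ := RamProgram.Does.blockingProgram (s := inputState G c) (N := N)
    (by simp [inputState]) (by simp [inputState]) (inputState_mem_lt hc)
  refine ⟨t, s, ht, hr, ?_⟩
  rintro ⟨⟨a, b⟩, hne, hab⟩ ⟨o, ho⟩
  have hv := hs a a.2 b b.2 ⟨o, (valid_inputState_iff hc hab o).2 ho⟩
  -- A valid value is an entry of the cyclic list, hence the number of a vertex.
  have hlt : s.mem (N + N * N + b + a * N) < N := by
    obtain ⟨i, hi, k, hk, l, hl, -, he, -⟩ := hv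
    rw [he]
    exact RamProgram.cyclicEntry_lt (inputState_mem_lt hc) (by omega)
  obtain ⟨h1, h2⟩ := (valid_inputState_iff hc hab ⟨_, hlt⟩).1 hv
  refine ⟨⟨_, hlt⟩, h1, h2, ?_⟩
  simp only [outputCell]
  congr 1
  ring

/-! ## Isomorphic graphs -/

section Iso

variable {V W : Type*} {G : SimpleGraph V} {H : SimpleGraph W} {P : Cycle V}

theorem IsHamiltonianCycle.map (φ : G ≃g H) (h : IsHamiltonianCycle G P) :
    IsHamiltonianCycle H (P.map φ) := by
  obtain ⟨h1, h2, h3⟩ := h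
  refine ⟨?_, fun v => ?_, ?_⟩
  · induction P using Quotient.inductionOn with
    | h l =>
      exact List.Nodup.map φ.injective h1
  · rw [Cycle.mem_map]
    exact ⟨φ.symm v, h2 _, by simp⟩
  · rw [Cycle.chain_map]
    exact h3.imp fun _ _ => φ.map_adj_iff.2

theorem BlocksAlong.map (φ : G ≃g H) {p q o : V} (h : BlocksAlong G P p q o) :
    BlocksAlong H (P.map φ) (φ p) (φ q) (φ o) := by
  obtain ⟨A, B, C, rfl, h⟩ := h
  refine ⟨A.map φ, B.map φ, C.map φ, by simp, ?_⟩
  rw [← List.map_cons, show B.map φ ++ [φ q] = (B ++ [q]).map φ by simp]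
  intro x hx y hy
  obtain ⟨u, hu, rfl⟩ := List.mem_map.1 hx
  obtain ⟨v, hv, rfl⟩ := List.mem_map.1 hy
  rw [φ.map_adj_iff]
  exact h u hu v hv

theorem IsBlockingVertex.map (φ : G ≃g H) {p q o : V} (h : IsBlockingVertex G P p q o) :
    IsBlockingVertex H (P.map φ) (φ p) (φ q) (φ o) := by
  rw [isBlockingVertex_iff] at h ⊢
  exact h.imp (BlocksAlong.map φ) (BlocksAlong.map φ)

end Iso

/-! ### The theorem -/

theorem theorem5 :
    (∀ (n : ℕ) (S : Fin n → List (Fin n)) (K : Cuts n),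
      IsPseudolineArrangement S → K.OpenAllHoles S →
        (∃ P : Cycle (PolygonVertex S K), IsBoundaryCycle S K P) ∧
        ∀ P : Cycle (PolygonVertex S K), IsBoundaryCycle S K P →
          IsHamiltonianCycle (internalVisibility S K) P ∧
          ∃! β : InvisiblePair (internalVisibility S K) → PolygonVertex S K,
            IsBlockingVertexAssignment (internalVisibility S K) P β) ∧
    ∃ (Q : RamProgram) (f : Polynomial ℕ),
      (∀ (n : ℕ) (S : Fin n → List (Fin n)) (K : Cuts n),
        IsPseudolineArrangement S → K.OpenAllHoles S →
        ∀ P : Cycle (PolygonVertex S K), IsBoundaryCycle S K P →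
        ∀ β : InvisiblePair (internalVisibility S K) → PolygonVertex S K,
          IsBlockingVertexAssignment (internalVisibility S K) P β →
        ∀ (N : ℕ) (G : SimpleGraph (Fin N)) (φ : internalVisibility S K ≃g G) (c : List (Fin N)),
          P.map φ = (c : Cycle (Fin N)) →
          ∃ (t : ℕ) (s : RamState), t ≤ f.eval N ∧ Q.Runs (inputState G c) t s ∧
            ∀ p : InvisiblePair (internalVisibility S K),
              s.mem (outputCell (φ p.1.1) (φ p.1.2)) = (φ (β p)).val) ∧
      (∀ (N : ℕ) (G : SimpleGraph (Fin N)) (c : List (Fin N)),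
        IsHamiltonianCycle G (c : Cycle (Fin N)) →
          ∃ (t : ℕ) (s : RamState), t ≤ f.eval N ∧ Q.Runs (inputState G c) t s ∧
            ∀ p : InvisiblePair G,
              (∃ o : Fin N, G.Adj p.1.1 o ∧ IsBlockingVertex G (c : Cycle (Fin N)) p.1.1 p.1.2 o) →
              ∃ o : Fin N, G.Adj p.1.1 o ∧ IsBlockingVertex G (c : Cycle (Fin N)) p.1.1 p.1.2 o ∧
                s.mem (outputCell p.1.1 p.1.2) = o.val) := by

  refine ⟨fun n S K A hK => ?_, RamProgram.blockingProgram, RamProgram.timeBound,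
    fun n S K A hK P hP β hβ N G φ c hc => ?_, fun N G c h => blockingProgram_spec h⟩
  · obtain ⟨X, A⟩ := A.exists_crossingTimes
    exact ⟨A.exists_isBoundaryCycle hK, fun P hP =>
      ⟨A.isHamiltonianCycle hP, A.existsUnique_blockingVertexAssignment hK hP⟩⟩
  · obtain ⟨X, A⟩ := A.exists_crossingTimes
    have hH := (A.isHamiltonianCycle hP).map φ
    rw [hc] at hH
    obtain ⟨t, s, ht, hr, hs⟩ := blockingProgram_spec hH
    refine ⟨t, s, ht, hr, fun p => ?_⟩
    have hφ : φ p.1.1 ≠ φ p.1.2 ∧ ¬ G.Adj (φ p.1.1) (φ p.1.2) :=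
      ⟨fun h => p.2.1 (φ.injective h), by rw [φ.map_adj_iff]; exact p.2.2⟩
    obtain ⟨o, h1, h2, h3⟩ := hs ⟨(φ p.1.1, φ p.1.2), hφ⟩
      ⟨φ (β p), φ.map_adj_iff.2 (hβ p).1, hc ▸ (hβ p).2.map φ⟩
    -- The program returns some blocking vertex visible from the first vertex. Pulled back along
    -- `φ`, it equals the only one there is, as does `β p`.
    obtain ⟨x, hx⟩ := A.exists_blockingVertex_iff_eq hK hP p.2.1 p.2.2
    have e1 := (hx _).1 (hβ p)
    have hback : P = (c : Cycle (Fin N)).map φ.symm := by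
      rw [← hc]
      induction P using Quotient.inductionOn with
      | h l => simp [Cycle.map_coe]
    have h2' := h2.map φ.symm
    rw [← hback] at h2'
    have e2 := (hx (φ.symm o)).1 ⟨by simpa using φ.symm.map_adj_iff.2 h1, by simpa using h2'⟩
    rw [h3, e1, ← e2]
    simp
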